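/- Let $J:\mathbb R\to[0,\infty)$ be a symmetric probability density with continuous derivative, support in $[-1,1]$ and $J(0)>0$. For $\gamma>0$ small, put $J_\gamma(x,y)=c_\gamma\,\gamma\,J(\gamma(x-y))$ for $x,y\in\mathbb Z$, where $c_\gamma$ is the constant for which $\sum_{y\neq x}J_\gamma(x,y)=1$. For $\epsilon>0$ consider the Ising model on $\mathbb Z\times\mathbb Z$, with spins $\sigma(x,i)\in\{-1,+1\}$, at inverse temperature $\beta=1$ (the mean-field critical value of the Kac interaction), with formal Hamiltonian $$H(\sigma)=-\frac12\sum_{i}\sum_{x\neq y}J_\gamma(x,y)\,\sigma(x,i)\,\sigma(y,i)-\epsilon\sum_{x,i}\sigma(x,i)\,\sigma(x,i+1),$$ where the first sum runs over ordered pairs $(x,y)$. For a finite $\Lambda\subset\mathbb Z\times\mathbb Z$ and a configuration $\tau$, the Gibbs measure in $\Lambda$ with boundary condition $\tau$ is the probability measure on the configurations $\sigma$ that equal $\tau$ outside $\Lambda$, with weights proportional to $e^{-H_\Lambda(\sigma)}$, where $H_\Lambda$ consists of the terms of $H$ that involve at least one site of $\Lambda$. Then for every $J$ as above and every $\epsilon>0$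 there is $\gamma_0>0$ such that for all $0<\gamma<\gamma_0$ the following holds: as $\Lambda\uparrow\mathbb Z\times\mathbb Z$, the Gibbs measures in $\Lambda$ with boundary conditions $\tau\equiv+1$ and $\tau\equiv-1$ converge weakly to probability measures $\mu_\gamma^+$ and $\mu_\gamma^-$ respectively, both of these satisfy the DLR equations, and $\mu_\gamma^+\neq\mu_\gamma^-$. -/

import Mathlib

open MeasureTheory Filter Topology

noncomputable section

namespace KacIsing

/-- Sites `(x, i)` of the lattice `ℤ × ℤ`: `x` is the horizontal coordinate, `i` the layer. -/
abbrev Site : Type := ℤ × ℤ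

/-- Spin configurations, with the product topology and the product σ-algebra.
`true` encodes the spin `+1` and `false` the spin `-1`. -/
abbrev Config : Type := Site → Bool

/-- The numerical value `σ(u) ∈ {-1, +1}` of the spin at `u`. -/
def spin (σ : Config) (u : Site) : ℝ := if σ u then 1 else -1

/-- The assumptions on the profile of the Kac interaction: a symmetric probability density on `ℝ`
with continuous derivative and support in `[-1, 1]`, positive at the origin. -/
structure IsKacProfile (J : ℝ → ℝ) : Prop where
  nonneg : ∀ r, 0 ≤ J r
  integral_eq_one : ∫ r, J r = 1
  symm : ∀ r, J (-r) = J r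
  contDiff : ContDiff ℝ 1 J
  support_subset : Function.support J ⊆ Set.Icc (-1) 1
  pos_zero : 0 < J 0

/-- The constant `c_γ` that makes `∑_{y ≠ x} c_γ γ J(γ (x - y)) = 1`. -/
def kacNormalization (J : ℝ → ℝ) (γ : ℝ) : ℝ :=
  (∑' k : ℤ, if k = 0 then 0 else γ * J (γ * (k : ℝ)))⁻¹

/-- `J_γ(x, y) = c_γ γ J(γ (x - y))`. -/
def kac (J : ℝ → ℝ) (γ : ℝ) (x y : ℤ) : ℝ :=
  kacNormalization J γ * γ * J (γ * ((x : ℝ) - (y : ℝ)))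

/-- The symmetric pair coupling: `J_γ(x, y)` between distinct sites of the same layer and `ε`
between vertical nearest neighbours; all other couplings vanish. -/
def coupling (J : ℝ → ℝ) (γ ε : ℝ) (u v : Site) : ℝ :=
  (if u.2 = v.2 ∧ u.1 ≠ v.1 then kac J γ u.1 v.1 else 0) +
    (if u.1 = v.1 ∧ (v.2 = u.2 + 1 ∨ u.2 = v.2 + 1) then ε else 0)

/-- The energy of the spins in `Λ`, given those outside `Λ`: the terms that involve a site of `Λ`
in the formal Hamiltonian
`-(1/2) ∑_i ∑_{x ≠ y} J_γ(x,y) σ(x,i) σ(y,i) - ε ∑_{x,i} σ(x,i) σ(x,i+1)`,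
in which `(x, y)` runs over ordered pairs. Every pair of interacting sites with one site in `Λ`
and one outside enters the second line once; for `γ > 0` that sum has finitely many nonzero
terms. -/
def hamiltonian (J : ℝ → ℝ) (γ ε : ℝ) (Λ : Finset Site) (σ : Config) : ℝ :=
  -(1 / 2) * ∑ u ∈ Λ, ∑ v ∈ Λ, coupling J γ ε u v * spin σ u * spin σ v
    - ∑ u ∈ Λ, ∑' v : {v : Site // v ∉ Λ}, coupling J γ ε u v * spin σ u * spin σ v

/-- The configuration equal to `s` in `Λ` and to the boundary condition `τ` outside `Λ`. -/
def glue (Λ : Finset Site) (s : Λ → Bool) (τ : Config) : Config :=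
  fun u => if h : u ∈ Λ then s ⟨u, h⟩ else τ u

/-- The Boltzmann weight at inverse temperature `1`. -/
def weight (J : ℝ → ℝ) (γ ε : ℝ) (Λ : Finset Site) (τ : Config) (s : Λ → Bool) : ℝ :=
  Real.exp (-hamiltonian J γ ε Λ (glue Λ s τ))

/-- The partition function in `Λ` with boundary condition `τ`. -/
def partitionFunction (J : ℝ → ℝ) (γ ε : ℝ) (Λ : Finset Site) (τ : Config) : ℝ :=
  ∑ s : Λ → Bool, weight J γ ε Λ τ s

/-- The Gibbs measure in `Λ` with boundary condition `τ`, as a measure on all configurations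
(concentrated on those equal to `τ` outside `Λ`). -/
def gibbs (J : ℝ → ℝ) (γ ε : ℝ) (Λ : Finset Site) (τ : Config) : Measure Config :=
  ∑ s : Λ → Bool,
    ENNReal.ofReal (weight J γ ε Λ τ s / partitionFunction J γ ε Λ τ) •
      Measure.dirac (glue Λ s τ)

theorem partitionFunction_pos (J : ℝ → ℝ) (γ ε : ℝ) (Λ : Finset Site) (τ : Config) :
    0 < partitionFunction J γ ε Λ τ :=
  Finset.sum_pos (fun _ _ => Real.exp_pos _) Finset.univ_nonempty

instance gibbs_isProbabilityMeasure (J : ℝ → ℝ) (γ ε : ℝ) (Λ : Finset Site) (τ : Config) :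
    IsProbabilityMeasure (gibbs J γ ε Λ τ) := by
  have hZ := partitionFunction_pos J γ ε Λ τ
  have hw : ∀ s, 0 ≤ weight J γ ε Λ τ s := fun _ => (Real.exp_pos _).le
  constructor
  simp only [gibbs, Measure.coe_finsetSum, Finset.sum_apply, Measure.smul_apply, measure_univ,
    smul_eq_mul, mul_one]
  rw [← ENNReal.ofReal_sum_of_nonneg
    (fun s _ => div_nonneg (hw s) hZ.le), ← Finset.sum_div]
  change ENNReal.ofReal (partitionFunction J γ ε Λ τ / _) = 1
  rw [div_self hZ.ne', ENNReal.ofReal_one]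

/-- The finite-volume Gibbs measure as a bundled probability measure. -/
def gibbsProb (J : ℝ → ℝ) (γ ε : ℝ) (Λ : Finset Site) (τ : Config) : ProbabilityMeasure Config :=
  ⟨gibbs J γ ε Λ τ, inferInstance⟩

/-- The constant boundary condition `+1`. -/
def plusConfig : Config := fun _ => true

/-- The constant boundary condition `-1`. -/
def minusConfig : Config := fun _ => false

/-- `μ` is the thermodynamic limit of the Gibbs measures with boundary condition `τ`: they converge
weakly to `μ` as `Λ` runs through the finite subsets of the lattice, directed by inclusion (hence
along every increasing sequence of finite sets that exhausts the lattice). -/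
def IsThermodynamicLimit (J : ℝ → ℝ) (γ ε : ℝ) (τ : Config)
    (μ : ProbabilityMeasure Config) : Prop :=
  Tendsto (fun Λ : Finset Site => gibbsProb J γ ε Λ τ) atTop (𝓝 μ)

/-- The DLR equations: for every finite `Λ`, averaging the Gibbs measures in `Λ` over boundary
conditions distributed according to `μ` gives back `μ`. -/
def IsDLR (J : ℝ → ℝ) (γ ε : ℝ) (μ : ProbabilityMeasure Config) : Prop :=
  ∀ (Λ : Finset Site) (A : Set Config), MeasurableSet A →
    ∫⁻ τ, gibbs J γ ε Λ τ A ∂(μ : Measure Config) = (μ : Measure Config) A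

end KacIsing

end

/-! The couplings of a site inside its layer sum to one. Percolation with edge probabilities `tanh`
of the couplings therefore has mean degree at most one in a single layer, and it approaches one as
`γ → 0`. Two adjacent layers do better: a column whose vertical bond is open, which has a
probability depending on `ε` but not on `γ`, can be left through both layers. The gain is a factor
above one that does not depend on `γ`, so for small `γ` it outweighs every error, and the
percolation on pairs of layers is supercritical.

Percolation bounds the magnetization as follows. A Boltzmann factor `exp (K χ)` with a sign
character `χ` is proportional to `1 + t χ`, where `t = tanh K`. By the second Griffiths inequality
the mean of a character is concave in each `t` separately (`ferroMean_ge_convexComb`), so it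
dominates the Bernoulli average of its values at the vertices of the cube. At a vertex, the bonds
with `t = 1` force equal spins: the mean of the spin at `v` is `1` if open bonds join `v` to the
plus boundary, and it is nonnegative otherwise. Hence the magnetization is at least a connection
probability (`connectionProbability_le_gibbsMean_plus`).

The percolation estimate is a renormalization. A brick consists of two layers and `R` blocks of `b`
columns, with `b` of order `1 / γ`. The columns are sorted by block and by whether they are
vertically open in a chosen set `T`. An exploration from a tiny seed multiplies the density of all
classes by `1 + θ` in every step until the density is positive (`bernProb_reachSet_small_le`). Since
the seed is tiny, most reached columns lie in clusters of size at least `K`. There are at most `R b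
/ K` such clusters, and a reserved share of the couplings merges them into one core
(`bernProb_sprinkling_fails_le`, `exists_brickCore_density`). The finite length of the brick costs
little, because the profile `blockWeight` is almost preserved by the block kernel
(`sum_kernel_blockWeight_ge`).

The bricks are placed along diagonals, so that the top layer of one brick continues in the bottom
layer of a neighbour; they form a square lattice on which adjacent cores are joined with high
probability. A set of `n` bricks is bad with probability at most `q ^ n`. A hierarchy of `3 × 3`
boxes, bad when two children are bad, then shows that with probability at least `1 / 2` the brick at
the origin is joined to far away sites (`half_le_bernProb_not_hierBad`, `exists_far_connected`). So
the magnetizations in a fixed finite set sum to at least `1 / 2`, uniformly in `Λ`.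

The limits exist by Griffiths monotonicity and compactness, they satisfy the DLR equations because
the interaction has finite range, and the spin flip exchanges them. A positive magnetization
therefore separates them (`phaseTransition_of_magnetization`). -/

open MeasureTheory Filter Topology

noncomputable section

namespace KacIsing

/-! ### Griffiths inequalities for sign characters of a finite abelian group -/

section Griffiths

variable {G : Type*} [CommGroup G] {ι : Type*}

/-- The real value of a sign character of a group. -/
def chr (χ : G →* ℤˣ) (g : G) : ℝ := ((χ g : ℤ) : ℝ)

lemma chr_mul (χ ψ : G →* ℤˣ) (g : G) : chr (χ * ψ) g = chr χ g * chr ψ g := by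
  simp [chr]

lemma chr_map_mul (χ : G →* ℤˣ) (g h : G) : chr χ (g * h) = chr χ g * chr χ h := by
  simp [chr]

@[simp] lemma chr_one (g : G) : chr (1 : G →* ℤˣ) g = 1 := by simp [chr]

@[simp] lemma chr_map_one (χ : G →* ℤˣ) : chr χ 1 = 1 := by simp [chr]

lemma chr_eq_or (χ : G →* ℤˣ) (g : G) : chr χ g = 1 ∨ chr χ g = -1 := by
  rcases Int.units_eq_one_or (χ g) with h | h <;> simp [chr, h]

lemma chr_mul_self (χ : G →* ℤˣ) (g : G) : chr χ g * chr χ g = 1 := by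
  rcases chr_eq_or χ g with h | h <;> simp [h]

lemma chr_prod {κ : Type*} (s : Finset κ) (χ : κ → G →* ℤˣ) (g : G) :
    chr (∏ i ∈ s, χ i) g = ∏ i ∈ s, chr (χ i) g := by
  classical
  induction s using Finset.induction_on with
  | empty => simp
  | insert a s ha ih => rw [Finset.prod_insert ha, Finset.prod_insert ha, chr_mul, ih]

/-- The ferromagnetic weight `∏ (1 + tᵢ χᵢ)`. -/
def ferroWeight (s : Finset ι) (χ : ι → G →* ℤˣ) (t : ι → ℝ) (g : G) : ℝ :=
  ∏ i ∈ s, (1 + t i * chr (χ i) g)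

lemma one_add_mul_chr_nonneg {t : ℝ} (h0 : 0 ≤ t) (h1 : t ≤ 1) (χ : G →* ℤˣ) (g : G) :
    0 ≤ 1 + t * chr χ g := by
  rcases chr_eq_or χ g with h | h <;> rw [h] <;> linarith

lemma ferroWeight_nonneg (s : Finset ι) (χ : ι → G →* ℤˣ) {t : ι → ℝ}
    (ht : ∀ i, t i ∈ Set.Icc (0 : ℝ) 1) (g : G) : 0 ≤ ferroWeight s χ t g :=
  Finset.prod_nonneg fun i _ => one_add_mul_chr_nonneg (ht i).1 (ht i).2 _ _

variable [Fintype G]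

/-- Orthogonality: translation by an element where the character is `-1` shows that the sum
vanishes, and otherwise all terms are `1`. -/
lemma sum_chr_nonneg (χ : G →* ℤˣ) : 0 ≤ ∑ g, chr χ g := by
  by_cases h : ∃ τ, chr χ τ = -1
  · obtain ⟨τ, hτ⟩ := h
    have h1 : ∑ g, chr χ g = ∑ g, chr χ (g * τ) :=
      (Equiv.sum_comp (Equiv.mulRight τ) (fun g => chr χ g)).symm
    simp only [chr_map_mul, hτ, mul_neg, mul_one, Finset.sum_neg_distrib] at h1
    linarith
  · push Not at h
    exact Finset.sum_nonneg fun g _ => by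
      rcases chr_eq_or χ g with h' | h'
      · rw [h']; exact zero_le_one
      · exact absurd h' (h g)

/-- Functions all of whose correlations with sign characters are nonnegative. -/
def IsFerro (f : G → ℝ) : Prop := ∀ χ : G →* ℤˣ, 0 ≤ ∑ g, chr χ g * f g

lemma isFerro_one : IsFerro (fun _ : G => (1 : ℝ)) := fun χ => by
  simpa using sum_chr_nonneg χ

/-- Multiplication by a character only permutes the characters against which `f` is tested. -/
lemma IsFerro.affine_mul {f : G → ℝ} (hf : IsFerro f) {c d : ℝ} (hc : 0 ≤ c) (hd : 0 ≤ d)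
    (χ : G →* ℤˣ) : IsFerro (fun g => (c + d * chr χ g) * f g) := fun ψ => by
  have h : ∑ g, chr ψ g * ((c + d * chr χ g) * f g) =
      c * ∑ g, chr ψ g * f g + d * ∑ g, chr (ψ * χ) g * f g := by
    rw [Finset.mul_sum, Finset.mul_sum, ← Finset.sum_add_distrib]
    exact Finset.sum_congr rfl fun g _ => by rw [chr_mul]; ring
  rw [h]
  exact add_nonneg (mul_nonneg hc (hf _)) (mul_nonneg hd (hf _))

lemma isFerro_prod (s : Finset ι) (χ : ι → G →* ℤˣ) {c d : ι → ℝ} (hc : ∀ i, 0 ≤ c i)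
    (hd : ∀ i, 0 ≤ d i) : IsFerro (fun g => ∏ i ∈ s, (c i + d i * chr (χ i) g)) := by
  classical
  induction s using Finset.induction_on with
  | empty => simpa using isFerro_one
  | insert a s ha ih =>
    simp only [Finset.prod_insert ha]
    exact ih.affine_mul (hc a) (hd a) (χ a)

/-- The first Griffiths inequality. -/
lemma isFerro_ferroWeight (s : Finset ι) (χ : ι → G →* ℤˣ) {t : ι → ℝ}
    (ht : ∀ i, 0 ≤ t i) : IsFerro (ferroWeight s χ t) :=
  isFerro_prod s χ (fun _ => zero_le_one) ht

lemma sum_ferroWeight_pos (s : Finset ι) (χ : ι → G →* ℤˣ) {t : ι → ℝ}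
    (ht : ∀ i, t i ∈ Set.Icc (0 : ℝ) 1) : 0 < ∑ g, ferroWeight s χ t g := by
  refine Finset.sum_pos' (fun g _ => ferroWeight_nonneg s χ ht g) ⟨1, Finset.mem_univ _, ?_⟩
  refine Finset.prod_pos fun i _ => ?_
  simp only [chr_map_one, mul_one]
  linarith [(ht i).1]

/-- The second Griffiths inequality. -/
theorem griffiths_second (s : Finset ι) (χ : ι → G →* ℤˣ) {t : ι → ℝ}
    (ht : ∀ i, t i ∈ Set.Icc (0 : ℝ) 1) (φ ψ : G →* ℤˣ) :
    (∑ g, chr φ g * ferroWeight s χ t g) * (∑ g, chr ψ g * ferroWeight s χ t g) ≤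
      (∑ g, chr φ g * (chr ψ g * ferroWeight s χ t g)) * ∑ g, ferroWeight s χ t g := by
  set W := ferroWeight s χ t with hW
  -- Ginibre's duplication: the second copy of the system is written as `g * τ`, and the relative
  -- variable `τ` is summed last.
  have key : (∑ g, chr φ g * (chr ψ g * W g)) * (∑ g, W g) -
      (∑ g, chr φ g * W g) * (∑ g, chr ψ g * W g) =
      ∑ τ, (1 - chr ψ τ) * ∑ g, chr (φ * ψ) g * (W g * W (g * τ)) := by
    have h1 : ∀ f h : G → ℝ, (∑ g, f g) * (∑ g, h g) = ∑ τ, ∑ g, f g * h (g * τ) := by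
      intro f h
      rw [Finset.sum_mul_sum, Finset.sum_comm (s := Finset.univ (α := G))]
      rw [Finset.sum_comm]
      rw [Finset.sum_comm (f := fun τ g => f g * h (g * τ))]
      refine Finset.sum_congr rfl fun g _ => ?_
      exact (Equiv.sum_comp (Equiv.mulLeft g) (fun x => f g * h x)).symm
    rw [h1, h1, ← Finset.sum_sub_distrib]
    refine Finset.sum_congr rfl fun τ _ => ?_
    rw [← Finset.sum_sub_distrib, Finset.mul_sum]
    refine Finset.sum_congr rfl fun g _ => ?_
    rw [chr_mul, chr_map_mul]
    ring
  have hnn : 0 ≤ ∑ τ, (1 - chr ψ τ) * ∑ g, chr (φ * ψ) g * (W g * W (g * τ)) := by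
    refine Finset.sum_nonneg fun τ _ => mul_nonneg ?_ ?_
    · rcases chr_eq_or ψ τ with h | h <;> rw [h] <;> norm_num
    -- For fixed `τ` the doubled weight is again a product of affine factors in the characters with
    -- nonnegative coefficients, since the square of each character is `1`.
    · have hWW : ∀ g, W g * W (g * τ) =
          ∏ i ∈ s, ((1 + t i ^ 2 * chr (χ i) τ) +
            (t i * (1 + chr (χ i) τ)) * chr (χ i) g) := by
        intro g
        rw [hW, ferroWeight, ferroWeight, ← Finset.prod_mul_distrib]
        refine Finset.prod_congr rfl fun i _ => ?_
        rw [chr_map_mul]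
        linear_combination (t i ^ 2 * chr (χ i) τ) * chr_mul_self (χ i) g
      simp only [hWW]
      refine isFerro_prod s χ (fun i => ?_) (fun i => ?_) (φ * ψ)
      · refine one_add_mul_chr_nonneg (by positivity) ?_ _ _
        have := (ht i).1
        have := (ht i).2
        nlinarith
      · refine mul_nonneg (ht i).1 ?_
        rcases chr_eq_or (χ i) τ with h | h <;> rw [h] <;> norm_num
  linarith

/-- The mean of the character `φ` under the ferromagnetic weight. -/
def ferroMean (s : Finset ι) (χ : ι → G →* ℤˣ) (t : ι → ℝ) (φ : G →* ℤˣ) : ℝ :=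
  (∑ g, chr φ g * ferroWeight s χ t g) / ∑ g, ferroWeight s χ t g

lemma ferroMean_nonneg (s : Finset ι) (χ : ι → G →* ℤˣ) {t : ι → ℝ}
    (ht : ∀ i, t i ∈ Set.Icc (0 : ℝ) 1) (φ : G →* ℤˣ) : 0 ≤ ferroMean s χ t φ :=
  div_nonneg (isFerro_ferroWeight s χ (fun i => (ht i).1) φ) (sum_ferroWeight_pos s χ ht).le

/-- As a function of the new parameter the mean is `(a + t b) / (c + t d)`, and the second Griffiths
inequality says `a d ≤ b c`. -/
lemma ferroMean_le_insert [DecidableEq ι] {s : Finset ι} (χ : ι → G →* ℤˣ) {t : ι → ℝ}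
    (ht : ∀ i, t i ∈ Set.Icc (0 : ℝ) 1) (φ : G →* ℤˣ) {a : ι} (ha : a ∉ s) :
    ferroMean s χ t φ ≤ ferroMean (insert a s) χ t φ := by
  have hZ := sum_ferroWeight_pos s χ ht
  have hZ' := sum_ferroWeight_pos (insert a s) χ ht
  rw [ferroMean, ferroMean, div_le_div_iff₀ hZ hZ']
  have h1 : ∀ g, ferroWeight (insert a s) χ t g =
      ferroWeight s χ t g + t a * (chr (χ a) g * ferroWeight s χ t g) := fun g => by
    rw [ferroWeight, Finset.prod_insert ha, ferroWeight]; ring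
  have h2 := griffiths_second s χ ht φ (χ a)
  simp only [h1, mul_add, Finset.sum_add_distrib, ← Finset.mul_sum, mul_left_comm (chr φ _) (t a)]
  nlinarith [mul_le_mul_of_nonneg_left h2 (ht a).1]

/-- Griffiths monotonicity: adding ferromagnetic terms increases correlations. -/
lemma ferroMean_mono [DecidableEq ι] {s s' : Finset ι} (hs : s ⊆ s') (χ : ι → G →* ℤˣ)
    {t : ι → ℝ} (ht : ∀ i, t i ∈ Set.Icc (0 : ℝ) 1) (φ : G →* ℤˣ) :
    ferroMean s χ t φ ≤ ferroMean s' χ t φ := by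
  have : ∀ u : Finset ι, ferroMean s χ t φ ≤ ferroMean (s ∪ u) χ t φ := by
    intro u
    induction u using Finset.induction_on with
    | empty => simp
    | insert a u _ ih =>
      rw [Finset.union_insert]
      by_cases h : a ∈ s ∪ u
      · rwa [Finset.insert_eq_of_mem h]
      · exact ih.trans (ferroMean_le_insert χ ht φ h)
  have h := this s'
  rwa [Finset.union_eq_right.mpr hs] at h

lemma update_mem_Icc [DecidableEq ι] {t : ι → ℝ} (ht : ∀ i, t i ∈ Set.Icc (0 : ℝ) 1) (i : ι)
    {x : ℝ} (hx : x ∈ Set.Icc (0 : ℝ) 1) (j : ι) :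
    Function.update t i x j ∈ Set.Icc (0 : ℝ) 1 := by
  by_cases h : j = i
  · subst h; simpa using hx
  · simpa [h] using ht j

/-- Concavity of the mean in each of the parameters, evaluated at the endpoints. -/
lemma ferroMean_ge_convexComb [DecidableEq ι] (s : Finset ι) (χ : ι → G →* ℤˣ) {t : ι → ℝ}
    (ht : ∀ i, t i ∈ Set.Icc (0 : ℝ) 1) (φ : G →* ℤˣ) {i : ι} (hi : i ∈ s) :
    (1 - t i) * ferroMean s χ (Function.update t i 0) φ +
      t i * ferroMean s χ (Function.update t i 1) φ ≤ ferroMean s χ t φ := by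
  set r := s.erase i with hr
  -- In the single variable `x` the weight is affine, so the mean is a quotient of two affine
  -- functions.
  have h1 : ∀ x g, ferroWeight s χ (Function.update t i x) g =
      ferroWeight r χ t g + x * (chr (χ i) g * ferroWeight r χ t g) := fun x g => by
    rw [ferroWeight, ← Finset.mul_prod_erase s _ hi, ferroWeight, Function.update_self]
    have : ∏ j ∈ s.erase i, (1 + Function.update t i x j * chr (χ j) g) =
        ∏ j ∈ r, (1 + t j * chr (χ j) g) :=
      Finset.prod_congr rfl fun j hj => by
        rw [Function.update_of_ne (Finset.ne_of_mem_erase hj)]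
    rw [this]; ring
  have hF : ∀ x, ferroMean s χ (Function.update t i x) φ =
      (∑ g, chr φ g * ferroWeight r χ t g +
        x * ∑ g, chr φ g * (chr (χ i) g * ferroWeight r χ t g)) /
      (∑ g, ferroWeight r χ t g + x * ∑ g, chr (χ i) g * ferroWeight r χ t g) := fun x => by
    rw [ferroMean]
    simp only [h1, mul_add, Finset.sum_add_distrib, ← Finset.mul_sum,
      mul_left_comm (chr φ _) x]
  have hself : ferroMean s χ t φ = ferroMean s χ (Function.update t i (t i)) φ := by
    rw [Function.update_eq_self]
  rw [hself, hF, hF, hF]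
  have hgks := griffiths_second r χ ht φ (χ i)
  have hd : 0 ≤ ∑ g, chr (χ i) g * ferroWeight r χ t g :=
    isFerro_ferroWeight r χ (fun j => (ht j).1) (χ i)
  have hc : 0 < ∑ g, ferroWeight r χ t g := sum_ferroWeight_pos r χ ht
  generalize (∑ g, chr φ g * ferroWeight r χ t g) = a at *
  generalize (∑ g, chr φ g * (chr (χ i) g * ferroWeight r χ t g)) = b at *
  generalize (∑ g, ferroWeight r χ t g) = c at *
  generalize (∑ g, chr (χ i) g * ferroWeight r χ t g) = d at *
  obtain ⟨h0, h1'⟩ := ht i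
  generalize t i = x at *
  have hx : 0 < c + x * d := by positivity
  have h1d : 0 < c + 1 * d := by positivity
  have h0d : 0 < c + 0 * d := by simpa using hc
  -- The height above the chord factors, and its sign is that of `b * c - a * d`, which is
  -- nonnegative by the second Griffiths inequality.
  have e : (a + x * b) / (c + x * d) -
      ((1 - x) * ((a + 0 * b) / (c + 0 * d)) + x * ((a + 1 * b) / (c + 1 * d))) =
      x * (1 - x) * d * (b * c - a * d) / (c * (c + d) * (c + x * d)) := by
    have : c + d ≠ 0 := by linarith
    simp only [zero_mul, add_zero, one_mul]
    field_simp
    ring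
  have : 0 ≤ x * (1 - x) * d * (b * c - a * d) / (c * (c + d) * (c + x * d)) := by
    have h2 : 0 ≤ 1 - x := by linarith
    have h3 : 0 ≤ b * c - a * d := by linarith
    positivity
  linarith

end Griffiths

/-! ### Coordinatewise concavity and Bernoulli averages over the vertices of a cube -/

section Bernoulli

variable {ι : Type*} [Fintype ι] [DecidableEq ι]

/-- The weight of the outcome `b` of a Bernoulli variable with success probability `p`. -/
def bernWeight (p : ℝ) (b : Bool) : ℝ := if b then p else 1 - p

/-- The expectation of `f` under independent Bernoulli variables with parameters `t`. -/
def bernMean (t : ι → ℝ) (f : (ι → Bool) → ℝ) : ℝ :=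
  ∑ ω, (∏ i, bernWeight (t i) (ω i)) * f ω

lemma bernWeight_nonneg {p : ℝ} (hp : p ∈ Set.Icc (0 : ℝ) 1) (b : Bool) :
    0 ≤ bernWeight p b := by
  cases b <;> simp [bernWeight, hp.1, hp.2]

lemma sum_bernWeight (p : ℝ) : ∑ b, bernWeight p b = 1 := by
  simp [bernWeight]

lemma bernMean_convexComb (t : ι → ℝ) (f : (ι → Bool) → ℝ) (i : ι) :
    bernMean t f = (1 - t i) * bernMean (Function.update t i 0) f +
      t i * bernMean (Function.update t i 1) f := by
  simp only [bernMean, Finset.mul_sum, ← Finset.sum_add_distrib]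
  refine Finset.sum_congr rfl fun ω _ => ?_
  have h : ∀ x, ∏ j, bernWeight (Function.update t i x j) (ω j) =
      bernWeight x (ω i) * ∏ j ∈ Finset.univ.erase i, bernWeight (t j) (ω j) := fun x => by
    rw [← Finset.mul_prod_erase Finset.univ _ (Finset.mem_univ i), Function.update_self]
    congr 1
    exact Finset.prod_congr rfl fun j hj => by
      rw [Function.update_of_ne (Finset.ne_of_mem_erase hj)]
  have hs := h (t i)
  rw [Function.update_eq_self] at hs
  rw [hs, h, h]
  cases ω i <;> simp [bernWeight] <;> ring

/-- A function on the cube that lies above its chords in every coordinate direction dominates the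
Bernoulli average of its values at the vertices. -/
theorem bernMean_le_of_convexComb_le (F : (ι → ℝ) → ℝ)
    (hF : ∀ t : ι → ℝ, (∀ i, t i ∈ Set.Icc (0 : ℝ) 1) → ∀ i,
      (1 - t i) * F (Function.update t i 0) + t i * F (Function.update t i 1) ≤ F t)
    (t : ι → ℝ) (ht : ∀ i, t i ∈ Set.Icc (0 : ℝ) 1) :
    bernMean t (fun ω => F (fun i => if ω i then 1 else 0)) ≤ F t := by
  -- Induction on a set containing the coordinates that are not yet `0` or `1`; at a vertex of the
  -- cube the Bernoulli measure is a point mass and equality holds.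
  have key : ∀ s : Finset ι, ∀ t : ι → ℝ, (∀ i, t i ∈ Set.Icc (0 : ℝ) 1) →
      (∀ i, i ∉ s → t i = 0 ∨ t i = 1) →
      bernMean t (fun ω => F (fun i => if ω i then 1 else 0)) ≤ F t := by
    intro s
    induction s using Finset.induction_on with
    | empty =>
      intro t _ h
      have h' : ∀ i, t i = 0 ∨ t i = 1 := fun i => h i (by simp)
      have ht0 : (fun i => if (decide (t i = 1) : Bool) then (1 : ℝ) else 0) = t := by
        funext i
        rcases h' i with h | h <;> simp [h]
      refine le_of_eq ?_
      rw [bernMean, Finset.sum_eq_single (fun i => decide (t i = 1))]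
      · simp only [ht0]
        rw [Finset.prod_eq_one, one_mul]
        intro i _
        rcases h' i with h | h <;> simp [bernWeight, h]
      · intro ω _ hω
        obtain ⟨i, hi⟩ := Function.ne_iff.mp hω
        rw [Finset.prod_eq_zero (Finset.mem_univ i), zero_mul]
        rcases h' i with h | h <;> cases hb : ω i <;> simp_all [bernWeight]
      · simp
    | insert a s _ ih =>
      intro t ht h
      have hu : ∀ x : ℝ, x = 0 ∨ x = 1 → ∀ i, i ∉ s →
          Function.update t a x i = 0 ∨ Function.update t a x i = 1 := by
        intro x hx i hi
        by_cases hia : i = a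
        · subst hia; simpa using hx
        · simpa [hia] using h i (by simp [hia, hi])
      have h0 := ih (Function.update t a 0)
        (update_mem_Icc ht a (by simp)) (hu 0 (Or.inl rfl))
      have h1 := ih (Function.update t a 1)
        (update_mem_Icc ht a (by simp)) (hu 1 (Or.inr rfl))
      rw [bernMean_convexComb t _ a]
      refine le_trans ?_ (hF t ht a)
      have := (ht a).1
      have := (ht a).2
      gcongr
  exact key Finset.univ t ht (by simp)

end Bernoulli

/-! ### The interaction: positivity, finite range, and finite sums for the energy -/

section Coupling

variable {J : ℝ → ℝ} {γ ε : ℝ}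

lemma coupling_symm (hJ : IsKacProfile J) (u v : Site) :
    coupling J γ ε u v = coupling J γ ε v u := by
  have h : kac J γ u.1 v.1 = kac J γ v.1 u.1 := by
    rw [kac, kac, ← hJ.symm (γ * ((u.1 : ℝ) - v.1))]
    congr 2; ring
  simp only [coupling, h, eq_comm (a := u.2) (b := v.2), ne_comm (a := u.1) (b := v.1),
    eq_comm (a := u.1) (b := v.1), or_comm (a := v.2 = u.2 + 1)]

lemma kacNormalization_nonneg (hJ : IsKacProfile J) (hγ : 0 < γ) : 0 ≤ kacNormalization J γ := by
  refine inv_nonneg.mpr (tsum_nonneg fun k => ?_)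
  split_ifs
  · exact le_rfl
  · exact mul_nonneg hγ.le (hJ.nonneg _)

lemma kac_nonneg (hJ : IsKacProfile J) (hγ : 0 < γ) (x y : ℤ) : 0 ≤ kac J γ x y :=
  mul_nonneg (mul_nonneg (kacNormalization_nonneg hJ hγ) hγ.le) (hJ.nonneg _)

lemma coupling_nonneg (hJ : IsKacProfile J) (hγ : 0 < γ) (hε : 0 < ε) (u v : Site) :
    0 ≤ coupling J γ ε u v := by
  refine add_nonneg ?_ ?_ <;> split_ifs
  · exact kac_nonneg hJ hγ _ _
  · exact le_rfl
  · exact hε.le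
  · exact le_rfl

lemma kac_eq_zero (hJ : IsKacProfile J) (hγ : 0 < γ) {x y : ℤ} (h : 1 / γ < |(x : ℝ) - y|) :
    kac J γ x y = 0 := by
  have : γ * ((x : ℝ) - y) ∉ Function.support J := fun hm => by
    have := hJ.support_subset hm
    have h2 : |γ * ((x : ℝ) - y)| ≤ 1 := abs_le.mpr this
    rw [abs_mul, abs_of_pos hγ] at h2
    rw [div_lt_iff₀ hγ] at h
    linarith
  rw [kac, Function.notMem_support.mp this, mul_zero]

lemma coupling_support_finite (hJ : IsKacProfile J) (hγ : 0 < γ) (u : Site) :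
    {v | coupling J γ ε u v ≠ 0}.Finite := by
  set N : ℤ := ⌈1 / γ⌉ with hN
  refine ((Set.finite_Icc (u.1 - N) (u.1 + N)).prod
    (Set.finite_Icc (u.2 - 1) (u.2 + 1))).subset fun v hv => ?_
  have hN0 : 0 ≤ N := Int.ceil_nonneg (by positivity)
  rw [Set.mem_ofPred_eq, coupling] at hv
  by_cases h1 : u.1 = v.1 ∧ (v.2 = u.2 + 1 ∨ u.2 = v.2 + 1)
  · simp only [Set.mem_prod, Set.mem_Icc]
    omega
  · rw [if_neg h1, add_zero] at hv
    have h2 : u.2 = v.2 ∧ u.1 ≠ v.1 := by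
      by_contra h2
      rw [if_neg h2] at hv
      exact hv rfl
    rw [if_pos h2] at hv
    have h3 : |(u.1 : ℝ) - v.1| ≤ 1 / γ := by
      by_contra h3
      exact hv (kac_eq_zero hJ hγ (not_le.mp h3))
    have h4 : |(u.1 : ℝ) - v.1| ≤ (N : ℝ) := h3.trans (Int.le_ceil _)
    have h5 : |u.1 - v.1| ≤ N := by exact_mod_cast h4
    rw [abs_le] at h5
    simp only [Set.mem_prod, Set.mem_Icc]
    omega

/-- `F` contains `Λ` and all sites that interact with `Λ`. -/
def IsNbhd (J : ℝ → ℝ) (γ ε : ℝ) (Λ F : Finset Site) : Prop :=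
  Λ ⊆ F ∧ ∀ u ∈ Λ, ∀ v, coupling J γ ε u v ≠ 0 → v ∈ F

lemma exists_isNbhd (hJ : IsKacProfile J) (hγ : 0 < γ) (Λ : Finset Site) :
    ∃ F, IsNbhd J γ ε Λ F := by
  classical
  refine ⟨Λ ∪ Λ.biUnion fun u => (coupling_support_finite (ε := ε) hJ hγ u).toFinset,
    Finset.subset_union_left, fun u hu v hv => ?_⟩
  refine Finset.mem_union_right _ (Finset.mem_biUnion.mpr ⟨u, hu, ?_⟩)
  simpa using hv

lemma IsNbhd.mono {Λ F F' : Finset Site} (h : IsNbhd J γ ε Λ F) (hF : F ⊆ F') :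
    IsNbhd J γ ε Λ F' :=
  ⟨h.1.trans hF, fun u hu v hv => hF (h.2 u hu v hv)⟩

lemma IsNbhd.anti {Λ Λ' F : Finset Site} (h : IsNbhd J γ ε Λ' F) (hΛ : Λ ⊆ Λ') :
    IsNbhd J γ ε Λ F :=
  ⟨hΛ.trans h.1, fun u hu v hv => h.2 u (hΛ hu) v hv⟩

/-- The pair energy of all ordered pairs in `F`. -/
def pairSum (J : ℝ → ℝ) (γ ε : ℝ) (F : Finset Site) (σ : Config) : ℝ :=
  ∑ u ∈ F, ∑ v ∈ F, coupling J γ ε u v * spin σ u * spin σ v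

/-- The ordered pairs in `F` without those in `F \ Λ` count every interacting pair that meets `Λ`
twice. This removes the infinite sum and isolates a term that depends only on the spins outside `Λ`.
-/
lemma hamiltonian_eq (hJ : IsKacProfile J) {Λ F : Finset Site} (hF : IsNbhd J γ ε Λ F)
    (σ : Config) : hamiltonian J γ ε Λ σ =
      -(1 / 2) * pairSum J γ ε F σ + (1 / 2) * pairSum J γ ε (F \ Λ) σ := by
  classical
  set g : Site → Site → ℝ := fun u v => coupling J γ ε u v * spin σ u * spin σ v with hg
  have h1 : ∀ u ∈ Λ, ∑' v : {v : Site // v ∉ Λ}, g u v = ∑ v ∈ F \ Λ, g u v := by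
    intro u hu
    have e1 : ∑' v : {v : Site // v ∉ Λ}, g u v =
        ∑' v, Set.indicator {v : Site | v ∉ Λ} (g u) v :=
      tsum_subtype {v : Site | v ∉ Λ} (g u)
    rw [e1, tsum_eq_sum (s := F \ Λ)]
    · refine Finset.sum_congr rfl fun v hv => ?_
      rw [Set.indicator_of_mem]
      exact (Finset.mem_sdiff.mp hv).2
    · intro v hv
      by_cases hv' : v ∈ Λ
      · exact Set.indicator_of_notMem (by simpa using hv') _
      · have hvF : v ∉ F := fun h => hv (Finset.mem_sdiff.mpr ⟨h, hv'⟩)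
        have : coupling J γ ε u v = 0 := by
          by_contra hne
          exact hvF (hF.2 u hu v hne)
        rw [Set.indicator_of_mem (by simpa using hv')]
        simp [hg, this]
  have h2 : hamiltonian J γ ε Λ σ = -(1 / 2) * ∑ u ∈ Λ, ∑ v ∈ Λ, g u v
      - ∑ u ∈ Λ, ∑ v ∈ F \ Λ, g u v := by
    rw [hamiltonian]
    congr 1
    exact Finset.sum_congr rfl h1
  have hsplit : ∀ f : Site → ℝ, ∑ v ∈ F, f v = ∑ v ∈ F \ Λ, f v + ∑ v ∈ Λ, f v := fun f =>
    (Finset.sum_sdiff hF.1).symm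
  have h3 : pairSum J γ ε F σ = pairSum J γ ε (F \ Λ) σ + ∑ u ∈ Λ, ∑ v ∈ Λ, g u v +
      2 * ∑ u ∈ Λ, ∑ v ∈ F \ Λ, g u v := by
    have hsym : ∑ u ∈ F \ Λ, ∑ v ∈ Λ, g u v = ∑ u ∈ Λ, ∑ v ∈ F \ Λ, g u v := by
      rw [Finset.sum_comm]
      refine Finset.sum_congr rfl fun u _ => Finset.sum_congr rfl fun v _ => ?_
      simp only [hg]
      rw [coupling_symm hJ v u]; ring
    rw [pairSum, hsplit]
    simp only [hsplit, Finset.sum_add_distrib]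
    change (∑ u ∈ F \ Λ, ∑ v ∈ F \ Λ, g u v + ∑ u ∈ F \ Λ, ∑ v ∈ Λ, g u v) + _ =
      ∑ u ∈ F \ Λ, ∑ v ∈ F \ Λ, g u v + _ + _
    rw [hsym]
    ring
  rw [h2, h3]
  ring

lemma pairSum_congr {F : Finset Site} {σ σ' : Config} (h : ∀ u ∈ F, σ u = σ' u) :
    pairSum J γ ε F σ = pairSum J γ ε F σ' := by
  refine Finset.sum_congr rfl fun u hu => Finset.sum_congr rfl fun v hv => ?_
  rw [spin, spin, spin, spin, h u hu, h v hv]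

/-- With a common neighbourhood `F` for both volumes, only the pair energy of `F` changes when the
spins in `Λ` do. -/
lemma hamiltonian_sub (hJ : IsKacProfile J) (hγ : 0 < γ) {Λ Λ' : Finset Site} (hΛ : Λ ⊆ Λ')
    {σ σ' : Config} (h : ∀ u, u ∉ Λ → σ u = σ' u) :
    hamiltonian J γ ε Λ' σ - hamiltonian J γ ε Λ' σ' =
      hamiltonian J γ ε Λ σ - hamiltonian J γ ε Λ σ' := by
  obtain ⟨F, hF⟩ := exists_isNbhd (ε := ε) hJ hγ Λ'
  rw [hamiltonian_eq hJ hF, hamiltonian_eq hJ hF, hamiltonian_eq hJ (hF.anti hΛ),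
    hamiltonian_eq hJ (hF.anti hΛ),
    pairSum_congr (F := F \ Λ) fun u hu => h u (Finset.mem_sdiff.mp hu).2,
    pairSum_congr (F := F \ Λ') fun u hu => h u fun h' => (Finset.mem_sdiff.mp hu).2 (hΛ h')]
  ring

end Coupling

/-! ### Consistency of the finite-volume Gibbs measures -/

section Gibbs

variable {J : ℝ → ℝ} {γ ε : ℝ}

/-- The expectation of `f` in the Gibbs measure in `Λ` with boundary condition `τ`. -/
def gibbsMean (J : ℝ → ℝ) (γ ε : ℝ) (Λ : Finset Site) (τ : Config) (f : Config → ℝ) : ℝ :=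
  ∑ s : Λ → Bool, weight J γ ε Λ τ s / partitionFunction J γ ε Λ τ * f (glue Λ s τ)

lemma weight_pos (Λ : Finset Site) (τ : Config) (s : Λ → Bool) : 0 < weight J γ ε Λ τ s :=
  Real.exp_pos _

/-- Replace the values of `s'` in `Λ` by those of `s`. -/
def overwrite {Λ Λ' : Finset Site} (s' : Λ' → Bool) (s : Λ → Bool) : Λ' → Bool :=
  fun u => if h : (u : Site) ∈ Λ then s ⟨u, h⟩ else s' u

lemma glue_glue {Λ Λ' : Finset Site} (hΛ : Λ ⊆ Λ') (s' : Λ' → Bool) (s : Λ → Bool) (τ : Config) :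
    glue Λ s (glue Λ' s' τ) = glue Λ' (overwrite s' s) τ := by
  funext u
  by_cases h : u ∈ Λ
  · simp [glue, overwrite, h, hΛ h]
  · by_cases h' : u ∈ Λ' <;> simp [glue, overwrite, h, h']

lemma weight_congr_boundary {Λ : Finset Site} {τ τ' : Config} (h : ∀ u, u ∉ Λ → τ u = τ' u)
    (s : Λ → Bool) : weight J γ ε Λ τ s = weight J γ ε Λ τ' s := by
  have : glue Λ s τ = glue Λ s τ' := by
    funext u
    by_cases hu : u ∈ Λ
    · simp [glue, hu]
    · simp [glue, hu, h u hu]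
  rw [weight, weight, this]

/-- Consistency of the finite-volume Gibbs measures. -/
theorem gibbsMean_gibbsMean (hJ : IsKacProfile J) (hγ : 0 < γ) {Λ Λ' : Finset Site}
    (hΛ : Λ ⊆ Λ') (τ : Config) (f : Config → ℝ) :
    gibbsMean J γ ε Λ' τ (fun σ => gibbsMean J γ ε Λ σ f) = gibbsMean J γ ε Λ' τ f := by
  classical
  set Z := partitionFunction J γ ε Λ' τ
  let rs : (Λ' → Bool) → (Λ → Bool) := fun s' u => s' ⟨u, hΛ u.2⟩
  -- The involution exchanges the spins in `Λ` of the outer configuration with the resampled ones.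
  let e : (Λ' → Bool) × (Λ → Bool) → (Λ' → Bool) × (Λ → Bool) :=
    fun q => (overwrite q.1 q.2, rs q.1)
  have he : Function.Involutive e := by
    rintro ⟨s', s⟩
    refine Prod.ext ?_ ?_
    · funext u
      by_cases h : (u : Site) ∈ Λ <;> simp [e, rs, overwrite, h]
    · funext u
      simp [e, rs, overwrite]
  have hrs : ∀ s' : Λ' → Bool, glue Λ (rs s') (glue Λ' s' τ) = glue Λ' s' τ := by
    intro s'
    rw [glue_glue hΛ]
    congr 1
    funext u
    by_cases h : (u : Site) ∈ Λ <;> simp [rs, overwrite, h]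
  have hoff : ∀ (s' : Λ' → Bool) (s : Λ → Bool) (u : Site), u ∉ Λ →
      glue Λ' (overwrite s' s) τ u = glue Λ' s' τ u := by
    intro s' s u hu
    rw [← glue_glue hΛ]
    simp [glue, hu]
  have hpf : ∀ (s' : Λ' → Bool) (s : Λ → Bool),
      partitionFunction J γ ε Λ (glue Λ' (overwrite s' s) τ) =
        partitionFunction J γ ε Λ (glue Λ' s' τ) := fun s' s =>
    Finset.sum_congr rfl fun r _ => weight_congr_boundary (hoff s' s) r
  -- Detailed balance for the resampling of `Λ`: the joint weight of old and new configuration is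
  -- symmetric.
  have hw : ∀ (s' : Λ' → Bool) (s : Λ → Bool), weight J γ ε Λ' τ (overwrite s' s) *
      weight J γ ε Λ (glue Λ' s' τ) (rs s') =
      weight J γ ε Λ' τ s' * weight J γ ε Λ (glue Λ' s' τ) s := by
    intro s' s
    have := hamiltonian_sub (ε := ε) hJ hγ hΛ (hoff s' s)
    rw [weight, weight, weight, weight, ← Real.exp_add, ← Real.exp_add, hrs, glue_glue hΛ]
    congr 1
    linarith
  have h1 : gibbsMean J γ ε Λ' τ (fun σ => gibbsMean J γ ε Λ σ f) =
      ∑ q : (Λ' → Bool) × (Λ → Bool), weight J γ ε Λ' τ q.1 / Z *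
        (weight J γ ε Λ (glue Λ' q.1 τ) q.2 / partitionFunction J γ ε Λ (glue Λ' q.1 τ) *
          f (glue Λ' (overwrite q.1 q.2) τ)) := by
    rw [Fintype.sum_prod_type]
    simp only [gibbsMean, Finset.mul_sum, glue_glue hΛ]
    rfl
  rw [h1, ← Equiv.sum_comp he.toPerm, Fintype.sum_prod_type, gibbsMean]
  refine Finset.sum_congr rfl fun s' _ => ?_
  have h2 : ∀ s : Λ → Bool, overwrite (overwrite s' s) (rs s') = s' := by
    intro s
    funext u
    by_cases h : (u : Site) ∈ Λ <;> simp [rs, overwrite, h]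
  have h3 : ∀ s : Λ → Bool,
      weight J γ ε Λ (glue Λ' (overwrite s' s) τ) (rs s') =
        weight J γ ε Λ (glue Λ' s' τ) (rs s') := fun s =>
    weight_congr_boundary (hoff s' s) _
  simp only [Function.Involutive.coe_toPerm, e, h2, h3, hpf]
  have hP := partitionFunction_pos J γ ε Λ (glue Λ' s' τ)
  have h4 : ∀ s : Λ → Bool, weight J γ ε Λ' τ (overwrite s' s) / Z *
      (weight J γ ε Λ (glue Λ' s' τ) (rs s') / partitionFunction J γ ε Λ (glue Λ' s' τ) *
        f (glue Λ' s' τ)) =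
      weight J γ ε Λ (glue Λ' s' τ) s * (weight J γ ε Λ' τ s' / Z *
        f (glue Λ' s' τ) / partitionFunction J γ ε Λ (glue Λ' s' τ)) := by
    intro s
    linear_combination (f (glue Λ' s' τ) / Z / partitionFunction J γ ε Λ (glue Λ' s' τ)) * hw s' s
  simp only [h4]
  rw [← Finset.sum_mul]
  change partitionFunction J γ ε Λ (glue Λ' s' τ) * _ = _
  rw [mul_div_cancel₀ _ hP.ne']

end Gibbs

/-! ### The plus state as a ferromagnetic system, and its monotonicity in the volume -/

section PlusState

variable {J : ℝ → ℝ} {γ ε : ℝ}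

/-- The sign group of a finite volume. -/
abbrev SignGroup (Λ : Finset Site) : Type := Λ → ℤˣ

/-- The spin at `u` as a character of the sign group; it is trivial outside `Λ`. -/
def spinChar (Λ : Finset Site) (u : Site) : SignGroup Λ →* ℤˣ :=
  if h : u ∈ Λ then Pi.evalMonoidHom (fun _ : Λ => ℤˣ) ⟨u, h⟩ else 1

/-- Spin values as signs. -/
def boolSign : Bool ≃ ℤˣ where
  toFun b := if b then 1 else -1
  invFun x := decide (x = 1)
  left_inv b := by cases b <;> decide
  right_inv x := by rcases Int.units_eq_one_or x with h | h <;> subst h <;> decide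

/-- Configurations in `Λ` as elements of the sign group. -/
def signEquiv (Λ : Finset Site) : (Λ → Bool) ≃ SignGroup Λ :=
  Equiv.piCongrRight fun _ => boolSign

lemma chr_spinChar (Λ : Finset Site) (u : Site) (s : Λ → Bool) :
    chr (spinChar Λ u) (signEquiv Λ s) = spin (glue Λ s plusConfig) u := by
  by_cases h : u ∈ Λ
  · cases hb : s ⟨u, h⟩ <;> simp [chr, spinChar, h, signEquiv, boolSign, spin, glue, hb]
  · simp [chr, spinChar, h, spin, glue, plusConfig]

lemma spinChar_of_notMem {Λ : Finset Site} {u : Site} (h : u ∉ Λ) : spinChar Λ u = 1 := by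
  simp [spinChar, h]

/-- The product of the spins in `B`. -/
def spinProd (B : Finset Site) (σ : Config) : ℝ := ∏ u ∈ B, spin σ u

lemma chr_prod_spinChar (Λ B : Finset Site) (s : Λ → Bool) :
    chr (∏ u ∈ B, spinChar Λ u) (signEquiv Λ s) = spinProd B (glue Λ s plusConfig) := by
  rw [chr_prod, spinProd]
  exact Finset.prod_congr rfl fun u _ => chr_spinChar Λ u s

/-- A function of a sign is affine in that sign; this is where the hyperbolic tangent enters as the
natural parameter of a bond. -/
lemma exp_mul_chr {G : Type*} [CommGroup G] (K : ℝ) (χ : G →* ℤˣ) (g : G) :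
    Real.exp (K * chr χ g) = Real.cosh K * (1 + Real.tanh K * chr χ g) := by
  have hc : Real.cosh K ≠ 0 := (Real.cosh_pos K).ne'
  have : Real.cosh K * (1 + Real.tanh K * chr χ g) =
      Real.cosh K + Real.sinh K * chr χ g := by
    rw [Real.tanh_eq_sinh_div_cosh]; field_simp
  rw [this]
  rcases chr_eq_or χ g with h | h
  · rw [h, mul_one, mul_one, Real.cosh_add_sinh]
  · rw [h, mul_neg, mul_one, mul_neg, mul_one, ← sub_eq_add_neg, Real.cosh_sub_sinh]

lemma tanh_mem_Icc {K : ℝ} (hK : 0 ≤ K) : Real.tanh K ∈ Set.Icc (0 : ℝ) 1 :=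
  ⟨by rw [Real.tanh_eq_sinh_div_cosh]; exact div_nonneg (Real.sinh_nonneg_iff.mpr hK) (Real.cosh_pos K).le,
    (Real.tanh_lt_one K).le⟩

lemma exp_sum_chr {G : Type*} [CommGroup G] {κ : Type*} (s : Finset κ) (χ : κ → G →* ℤˣ)
    (K : κ → ℝ) (g : G) : Real.exp (∑ k ∈ s, K k * chr (χ k) g) =
      (∏ k ∈ s, Real.cosh (K k)) * ferroWeight s χ (fun k => Real.tanh (K k)) g := by
  rw [Real.exp_sum, ferroWeight, ← Finset.prod_mul_distrib]
  exact Finset.prod_congr rfl fun k _ => exp_mul_chr _ _ _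

lemma weight_plus_eq (hJ : IsKacProfile J) {Λ F : Finset Site} (hF : IsNbhd J γ ε Λ F)
    (s : Λ → Bool) : weight J γ ε Λ plusConfig s =
      Real.exp (-(1 / 2) * pairSum J γ ε (F \ Λ) plusConfig) *
        Real.exp ((1 / 2) * pairSum J γ ε F (glue Λ s plusConfig)) := by
  rw [weight, hamiltonian_eq hJ hF, ← Real.exp_add,
    pairSum_congr (F := F \ Λ) (σ' := plusConfig) fun u hu => by
      simp [glue, (Finset.mem_sdiff.mp hu).2]]
  congr 1
  ring

lemma gibbsMean_eq_div {Λ : Finset Site} {τ : Config} {C : ℝ} (hC : C ≠ 0)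
    {w : (Λ → Bool) → ℝ} (hw : ∀ s, weight J γ ε Λ τ s = C * w s) (f : Config → ℝ) :
    gibbsMean J γ ε Λ τ f = (∑ s, w s * f (glue Λ s τ)) / ∑ s, w s := by
  have h : partitionFunction J γ ε Λ τ = C * ∑ s, w s := by
    rw [partitionFunction, Finset.mul_sum]
    exact Finset.sum_congr rfl fun s _ => hw s
  have h2 : C * ∑ s, w s ≠ 0 := h ▸ (partitionFunction_pos J γ ε Λ τ).ne'
  have h3 : ∑ s, w s ≠ 0 := fun h0 => h2 (by rw [h0, mul_zero])
  rw [gibbsMean, h, Finset.sum_div]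
  refine Finset.sum_congr rfl fun s _ => ?_
  rw [hw]
  field_simp

/-- A representation of the plus state as a ferromagnetic system of sign characters. -/
theorem gibbsMean_plus_eq_ferroMean (hJ : IsKacProfile J) {Λ F : Finset Site}
    (hF : IsNbhd J γ ε Λ F) {κ : Type*} (S : Finset κ) (a b : κ → Site) (K : κ → ℝ)
    (hK : ∀ σ : Config, (1 / 2) * pairSum J γ ε F σ = ∑ k ∈ S, K k * (spin σ (a k) * spin σ (b k)))
    (B : Finset Site) :
    gibbsMean J γ ε Λ plusConfig (spinProd B) =
      ferroMean S (fun k => spinChar Λ (a k) * spinChar Λ (b k)) (fun k => Real.tanh (K k))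
        (∏ u ∈ B, spinChar Λ u) := by
  set χ : κ → SignGroup Λ →* ℤˣ := fun k => spinChar Λ (a k) * spinChar Λ (b k)
  have hw : ∀ s : Λ → Bool, weight J γ ε Λ plusConfig s =
      (Real.exp (-(1 / 2) * pairSum J γ ε (F \ Λ) plusConfig) * ∏ k ∈ S, Real.cosh (K k)) *
        ferroWeight S χ (fun k => Real.tanh (K k)) (signEquiv Λ s) := by
    intro s
    rw [weight_plus_eq hJ hF, hK, mul_assoc, ← exp_sum_chr]
    congr 2
    refine Finset.sum_congr rfl fun k _ => ?_
    rw [chr_mul, chr_spinChar, chr_spinChar]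
  have hC : Real.exp (-(1 / 2) * pairSum J γ ε (F \ Λ) plusConfig) *
      ∏ k ∈ S, Real.cosh (K k) ≠ 0 :=
    mul_ne_zero (Real.exp_pos _).ne' (Finset.prod_ne_zero_iff.mpr fun k _ => (Real.cosh_pos _).ne')
  rw [gibbsMean_eq_div hC hw, ferroMean, ← Equiv.sum_comp (signEquiv Λ),
    ← Equiv.sum_comp (signEquiv Λ)]
  congr 1
  refine Finset.sum_congr rfl fun s _ => ?_
  rw [chr_prod_spinChar, mul_comm]

lemma pairSum_eq_sum_product (F : Finset Site) (σ : Config) :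
    (1 / 2) * pairSum J γ ε F σ =
      ∑ k ∈ F ×ˢ F, (coupling J γ ε k.1 k.2 / 2) * (spin σ k.1 * spin σ k.2) := by
  rw [pairSum, Finset.sum_product, Finset.mul_sum]
  refine Finset.sum_congr rfl fun u _ => ?_
  rw [Finset.mul_sum]
  exact Finset.sum_congr rfl fun v _ => by ring

/-- In the plus state the correlations decrease with the volume. -/
theorem gibbsMean_plus_anti (hJ : IsKacProfile J) (hγ : 0 < γ) (hε : 0 < ε)
    {Λ Λ' : Finset Site} (hΛ : Λ ⊆ Λ') (B : Finset Site) :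
    gibbsMean J γ ε Λ' plusConfig (spinProd B) ≤ gibbsMean J γ ε Λ plusConfig (spinProd B) := by
  classical
  obtain ⟨F, hF⟩ := exists_isNbhd (ε := ε) hJ hγ Λ'
  rw [gibbsMean_plus_eq_ferroMean hJ hF (F ×ˢ F) Prod.fst Prod.snd
    (fun k => coupling J γ ε k.1 k.2 / 2) (pairSum_eq_sum_product F) B]
  -- A factor `1 + 1 * spin` vanishes unless the spin is plus. Pinning the sites of `Λ' \ Λ` to plus
  -- therefore adds ferromagnetic terms with parameter `1`, and it turns the plus state in `Λ'` into
  -- the one in `Λ`.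
  set M := Λ' \ Λ
  -- pairs in the left summand, pinned sites in the right one
  let χ : (Site × Site) ⊕ Site → SignGroup Λ' →* ℤˣ :=
    Sum.elim (fun k => spinChar Λ' k.1 * spinChar Λ' k.2) (fun u => spinChar Λ' u)
  let t : (Site × Site) ⊕ Site → ℝ :=
    Sum.elim (fun k => Real.tanh (coupling J γ ε k.1 k.2 / 2)) (fun _ => 1)
  have ht : ∀ i, t i ∈ Set.Icc (0 : ℝ) 1 := by
    rintro (k | u)
    · exact tanh_mem_Icc (div_nonneg (coupling_nonneg hJ hγ hε _ _) zero_le_two)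
    · simp [t]
  set φ := ∏ u ∈ B, spinChar Λ' u
  have h1 : ferroMean (F ×ˢ F) (fun k => spinChar Λ' k.1 * spinChar Λ' k.2)
      (fun k => Real.tanh (coupling J γ ε k.1 k.2 / 2)) φ =
      ferroMean ((F ×ˢ F).disjSum ∅) χ t φ := by
    simp [ferroMean, ferroWeight, χ, t]
  rw [h1]
  refine (ferroMean_mono (Finset.disjSum_mono le_rfl (Finset.empty_subset M)) χ ht φ).trans
    (le_of_eq ?_)
  have hfw : ∀ s : Λ' → Bool, ferroWeight ((F ×ˢ F).disjSum M) χ t (signEquiv Λ' s) =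
      (∏ k ∈ F ×ˢ F, Real.cosh (coupling J γ ε k.1 k.2 / 2))⁻¹ *
        Real.exp ((1 / 2) * pairSum J γ ε F (glue Λ' s plusConfig)) *
        ∏ u ∈ M, (1 + spin (glue Λ' s plusConfig) u) := by
    intro s
    rw [pairSum_eq_sum_product]
    have h2 := exp_sum_chr (F ×ˢ F) (fun k => spinChar Λ' k.1 * spinChar Λ' k.2)
      (fun k => coupling J γ ε k.1 k.2 / 2) (signEquiv Λ' s)
    simp only [chr_mul, chr_spinChar] at h2
    have hc : ∏ k ∈ F ×ˢ F, Real.cosh (coupling J γ ε k.1 k.2 / 2) ≠ 0 :=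
      Finset.prod_ne_zero_iff.mpr fun k _ => (Real.cosh_pos _).ne'
    rw [h2, ← mul_assoc, inv_mul_cancel₀ hc, one_mul]
    simp [ferroWeight, χ, t, chr_spinChar, chr_mul]
  let ext : (Λ → Bool) → (Λ' → Bool) := fun s u => glue Λ s plusConfig u
  have hext : ∀ s, glue Λ' (ext s) plusConfig = glue Λ s plusConfig := by
    intro s
    funext u
    by_cases h : u ∈ Λ'
    · simp [glue, ext, h]
    · have : u ∉ Λ := fun h' => h (hΛ h')
      simp [glue, h, this]
  have hinj : Function.Injective ext := by
    intro s s' h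
    funext u
    have := congrFun h ⟨u, hΛ u.2⟩
    simpa [ext, glue] using this
  have hzero : ∀ s' : Λ' → Bool, s' ∉ Set.range ext →
      ∏ u ∈ M, (1 + spin (glue Λ' s' plusConfig) u) = 0 := by
    intro s' hs'
    by_contra hne
    apply hs'
    refine ⟨fun u => s' ⟨u, hΛ u.2⟩, ?_⟩
    funext u
    by_cases hu : (u : Site) ∈ Λ
    · simp [ext, glue, hu]
    · have h3 := (Finset.prod_ne_zero_iff.mp hne) u (Finset.mem_sdiff.mpr ⟨u.2, hu⟩)
      cases hb : s' u
      · simp [spin, glue, hb] at h3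
      · simp [ext, glue, hu, plusConfig]
  have hone : ∀ s, ∏ u ∈ M, (1 + spin (glue Λ' (ext s) plusConfig) u) = 2 ^ M.card := by
    intro s
    rw [hext, Finset.prod_congr rfl (g := fun _ => (2 : ℝ)), Finset.prod_const]
    intro u hu
    have : u ∉ Λ := (Finset.mem_sdiff.mp hu).2
    simp [spin, glue, this, plusConfig]
    norm_num
  have hsum : ∀ f : Config → ℝ,
      ∑ s : Λ' → Bool, ferroWeight ((F ×ˢ F).disjSum M) χ t (signEquiv Λ' s) *
        f (glue Λ' s plusConfig) =
      (∏ k ∈ F ×ˢ F, Real.cosh (coupling J γ ε k.1 k.2 / 2))⁻¹ * 2 ^ M.card *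
        ∑ s : Λ → Bool, Real.exp ((1 / 2) * pairSum J γ ε F (glue Λ s plusConfig)) *
          f (glue Λ s plusConfig) := by
    intro f
    rw [Finset.mul_sum]
    rw [← Finset.sum_subset (Finset.subset_univ (Finset.univ.map ⟨ext, hinj⟩)), Finset.sum_map]
    · refine Finset.sum_congr rfl fun s _ => ?_
      rw [Function.Embedding.coeFn_mk, hfw, hone, hext]
      ring
    · intro s' _ hs'
      rw [hfw, hzero s' (by simpa using hs')]
      ring
  have hC : (∏ k ∈ F ×ˢ F, Real.cosh (coupling J γ ε k.1 k.2 / 2))⁻¹ * (2 : ℝ) ^ M.card ≠ 0 :=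
    mul_ne_zero (inv_ne_zero (Finset.prod_ne_zero_iff.mpr fun k _ => (Real.cosh_pos _).ne'))
      (by positivity)
  rw [gibbsMean_eq_div (Real.exp_pos _).ne' (weight_plus_eq hJ (hF.anti hΛ)), ferroMean,
    ← Equiv.sum_comp (signEquiv Λ'), ← Equiv.sum_comp (signEquiv Λ')]
  have hs1 := hsum (fun _ => 1)
  have hs2 := hsum (spinProd B)
  simp only [mul_one] at hs1
  simp only [φ, chr_prod_spinChar]
  rw [hs1, Finset.sum_congr rfl fun s _ => mul_comm (spinProd B _) _, hs2,
    mul_div_mul_left _ _ hC]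

end PlusState

/-! ### Comparison of the magnetization with a Bernoulli percolation -/

section Percolation

variable {J : ℝ → ℝ} {γ ε : ℝ} {ι : Type*}

/-- `x` and `y` are joined by an open edge of the family with endpoints `a i`, `b i`. -/
def OpenStep (a b : ι → Site) (ω : ι → Bool) (x y : Site) : Prop :=
  ∃ i, ω i = true ∧ ((a i = x ∧ b i = y) ∨ (a i = y ∧ b i = x))

/-- Connectivity by open edges. -/
def OpenConn (a b : ι → Site) (ω : ι → Bool) : Site → Site → Prop :=
  Relation.ReflTransGen (OpenStep a b ω)

open Classical in
/-- The magnetization of the plus state dominates the probability of a connection to the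
boundary in a Bernoulli percolation whose edge probabilities are the hyperbolic tangents of the
couplings. -/
theorem connectionProbability_le_gibbsMean_plus [Fintype ι] [DecidableEq ι]
    (hJ : IsKacProfile J) (hγ : 0 < γ) (a b : ι → Site) (K : ι → ℝ) (hK0 : ∀ i, 0 ≤ K i)
    (hK : ∀ u v, ∑ i, (if a i = u ∧ b i = v then K i else 0) +
      ∑ i, (if a i = v ∧ b i = u then K i else 0) ≤ coupling J γ ε u v)
    (Λ : Finset Site) (v : Site) :
    bernMean (fun i => Real.tanh (K i))
      (fun ω => if ∃ w, w ∉ Λ ∧ OpenConn a b ω v w then 1 else 0) ≤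
      gibbsMean J γ ε Λ plusConfig (spinProd {v}) := by
  obtain ⟨F₀, hF₀⟩ := exists_isNbhd (ε := ε) hJ hγ Λ
  set F : Finset Site := F₀ ∪ (Finset.univ.image a ∪ Finset.univ.image b) with hFdef
  have hF : IsNbhd J γ ε Λ F := hF₀.mono Finset.subset_union_left
  have haF : ∀ i, a i ∈ F := fun i => by simp [hFdef]
  have hbF : ∀ i, b i ∈ F := fun i => by simp [hFdef]
  let k : Site → Site → ℝ := fun u v => ∑ i, if a i = u ∧ b i = v then K i else 0
  -- The part of the coupling that the edges do not use stays in the system; the division by two is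
  -- there because `F ×ˢ F` contains every pair in both orders.
  let rest : Site × Site → ℝ := fun q => (coupling J γ ε q.1 q.2 - (k q.1 q.2 + k q.2 q.1)) / 2
  have hrest : ∀ q, 0 ≤ rest q := fun q =>
    div_nonneg (sub_nonneg.mpr (hK q.1 q.2)) zero_le_two
  let A : ι ⊕ (Site × Site) → Site := Sum.elim a Prod.fst
  let B : ι ⊕ (Site × Site) → Site := Sum.elim b Prod.snd
  let K' : ι ⊕ (Site × Site) → ℝ := Sum.elim K rest
  set S : Finset (ι ⊕ (Site × Site)) := Finset.univ.disjSum (F ×ˢ F) with hS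
  have hksum : ∀ σ : Config, ∑ q ∈ F ×ˢ F, k q.1 q.2 * (spin σ q.1 * spin σ q.2) =
      ∑ i, K i * (spin σ (a i) * spin σ (b i)) := by
    intro σ
    simp only [k, Finset.sum_mul]
    rw [Finset.sum_comm]
    refine Finset.sum_congr rfl fun i _ => ?_
    rw [Finset.sum_eq_single (a i, b i)]
    · simp
    · rintro ⟨u, w⟩ _ hne
      rw [if_neg, zero_mul]
      rintro ⟨rfl, rfl⟩
      exact hne rfl
    · intro h
      exact absurd (Finset.mem_product.mpr ⟨haF i, hbF i⟩) h
  have hksum' : ∀ σ : Config, ∑ q ∈ F ×ˢ F, k q.2 q.1 * (spin σ q.1 * spin σ q.2) =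
      ∑ i, K i * (spin σ (a i) * spin σ (b i)) := by
    intro σ
    rw [← hksum σ, Finset.sum_product, Finset.sum_comm, Finset.sum_product]
    exact Finset.sum_congr rfl fun u _ => Finset.sum_congr rfl fun w _ => by ring
  have hrep : ∀ σ : Config, (1 / 2) * pairSum J γ ε F σ =
      ∑ q ∈ S, K' q * (spin σ (A q) * spin σ (B q)) := by
    intro σ
    have h1 : ∑ q ∈ F ×ˢ F, rest q * (spin σ q.1 * spin σ q.2) =
        (1 / 2) * pairSum J γ ε F σ - ∑ i, K i * (spin σ (a i) * spin σ (b i)) := by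
      have h2 : ∀ q : Site × Site, rest q * (spin σ q.1 * spin σ q.2) =
          (coupling J γ ε q.1 q.2 / 2) * (spin σ q.1 * spin σ q.2) -
          (1 / 2) * (k q.1 q.2 * (spin σ q.1 * spin σ q.2)) -
          (1 / 2) * (k q.2 q.1 * (spin σ q.1 * spin σ q.2)) := fun q => by
        simp only [rest]; ring
      simp only [h2, Finset.sum_sub_distrib, ← Finset.mul_sum]
      rw [hksum, hksum', pairSum_eq_sum_product]
      ring
    rw [hS, Finset.sum_disjSum]
    simp only [K', A, B, Sum.elim_inl, Sum.elim_inr]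
    rw [h1]
    ring
  rw [gibbsMean_plus_eq_ferroMean hJ hF S A B K' hrep {v}]
  set χ : ι ⊕ (Site × Site) → SignGroup Λ →* ℤˣ := fun q => spinChar Λ (A q) * spinChar Λ (B q)
  set φ := ∏ u ∈ {v}, spinChar Λ u with hφ
  -- Only the parameters of the percolation edges vary; those of the remaining couplings are kept.
  let Φ : (ι → ℝ) → ℝ := fun t => ferroMean S χ (Sum.elim t fun q => Real.tanh (rest q)) φ
  have hmem : ∀ t : ι → ℝ, (∀ i, t i ∈ Set.Icc (0 : ℝ) 1) →
      ∀ q, (Sum.elim t (fun q => Real.tanh (rest q)) : ι ⊕ (Site × Site) → ℝ) q ∈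
        Set.Icc (0 : ℝ) 1 := by
    rintro t ht (i | q)
    · exact ht i
    · exact tanh_mem_Icc (hrest q)
  have hΦ := bernMean_le_of_convexComb_le Φ (fun t ht i => by
    have := ferroMean_ge_convexComb S χ (hmem t ht) φ (i := Sum.inl i) (by simp [hS])
    rw [Sum.update_elim_inl, Sum.update_elim_inl] at this
    exact this) (fun i => Real.tanh (K i)) (fun i => tanh_mem_Icc (hK0 i))
  have hlast : Φ (fun i => Real.tanh (K i)) =
      ferroMean S χ (fun q => Real.tanh (K' q)) φ := by
    simp only [Φ]
    congr 1
    funext q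
    cases q <;> rfl
  rw [← hlast]
  refine le_trans ?_ hΦ
  refine Finset.sum_le_sum fun ω _ => mul_le_mul_of_nonneg_left ?_
    (Finset.prod_nonneg fun i _ => bernWeight_nonneg (tanh_mem_Icc (hK0 i)) _)
  have htω : ∀ i, (if ω i then (1 : ℝ) else 0) ∈ Set.Icc (0 : ℝ) 1 := fun i => by
    split_ifs <;> simp
  beta_reduce
  split_ifs with hconn
  · obtain ⟨w, hw, hvw⟩ := hconn
    have hpos := sum_ferroWeight_pos S χ (hmem _ htω)
    refine le_of_eq ?_
    simp only [Φ, ferroMean]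
    rw [eq_div_iff hpos.ne', one_mul]
    refine Finset.sum_congr rfl fun g _ => ?_
    by_cases hg : ferroWeight S χ
        (Sum.elim (fun i => if ω i then (1 : ℝ) else 0) fun q => Real.tanh (rest q)) g = 0
    · rw [hg, mul_zero]
    -- An open edge has parameter `1`, so its factor vanishes unless the spins at its ends agree. On
    -- the support of the weight, the spin at `v` thus equals the one at `w`, which is plus because
    -- `w` is outside `Λ`.
    · have hstep : ∀ x y, OpenStep a b ω x y → chr (spinChar Λ x) g = chr (spinChar Λ y) g := by
        rintro x y ⟨i, hi, hxy⟩
        have h1 := (Finset.prod_ne_zero_iff.mp hg) (Sum.inl i) (by simp [hS])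
        simp only [Sum.elim_inl, hi, if_true, one_mul, χ, A, B, chr_mul] at h1
        have h2 : chr (spinChar Λ (a i)) g = chr (spinChar Λ (b i)) g := by
          rcases chr_eq_or (spinChar Λ (a i)) g with h | h <;>
            rcases chr_eq_or (spinChar Λ (b i)) g with h' | h' <;> simp_all
        rcases hxy with ⟨rfl, rfl⟩ | ⟨rfl, rfl⟩
        · exact h2
        · exact h2.symm
      have hall : ∀ y, OpenConn a b ω v y → chr (spinChar Λ v) g = chr (spinChar Λ y) g := by
        intro y hy
        induction hy with
        | refl => rfl
        | tail _ h ih => exact ih.trans (hstep _ _ h)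
      have : chr φ g = 1 := by
        rw [hφ, Finset.prod_singleton, hall w hvw, spinChar_of_notMem hw, chr_one]
      rw [this, one_mul]
  · exact ferroMean_nonneg S χ (hmem _ htω) φ

end Percolation

/-! ### Thermodynamic limits, DLR equations and the spin flip -/

section Limit

variable {J : ℝ → ℝ} {γ ε : ℝ}

lemma continuous_spin (u : Site) : Continuous fun σ : Config => spin σ u := by
  have h : Continuous fun b : Bool => (if b then (1 : ℝ) else -1) := continuous_of_discreteTopology
  exact h.comp (continuous_apply u)

lemma continuous_spinProd (B : Finset Site) : Continuous (spinProd B) :=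
  continuous_finsetProd B fun u _ => continuous_spin u

lemma continuous_glue (Λ : Finset Site) (s : Λ → Bool) : Continuous (glue Λ s) := by
  refine continuous_pi fun u => ?_
  by_cases h : u ∈ Λ
  · simpa [glue, h] using continuous_const
  · simpa [glue, h] using continuous_apply u

lemma continuous_weight (hJ : IsKacProfile J) (hγ : 0 < γ) (Λ : Finset Site) (s : Λ → Bool) :
    Continuous fun τ => weight J γ ε Λ τ s := by
  obtain ⟨F, hF⟩ := exists_isNbhd (ε := ε) hJ hγ Λ
  have hp : ∀ F' : Finset Site, Continuous (pairSum J γ ε F') := fun F' =>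
    continuous_finsetSum F' fun u _ => continuous_finsetSum F' fun v _ =>
      (continuous_const.mul (continuous_spin u)).mul (continuous_spin v)
  simp only [weight, hamiltonian_eq hJ hF]
  have h1 := (hp F).comp (continuous_glue Λ s)
  have h2 := (hp (F \ Λ)).comp (continuous_glue Λ s)
  exact Real.continuous_exp.comp ((continuous_const.mul h1).add (continuous_const.mul h2)).neg

lemma continuous_gibbsWeight (hJ : IsKacProfile J) (hγ : 0 < γ) (Λ : Finset Site)
    (s : Λ → Bool) :
    Continuous fun τ => weight J γ ε Λ τ s / partitionFunction J γ ε Λ τ :=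
  (continuous_weight hJ hγ Λ s).div
    (continuous_finsetSum _ fun r _ => continuous_weight hJ hγ Λ r)
    fun τ => (partitionFunction_pos J γ ε Λ τ).ne'

lemma continuous_gibbsMean (hJ : IsKacProfile J) (hγ : 0 < γ) (Λ : Finset Site) {f : Config → ℝ}
    (hf : Continuous f) : Continuous fun τ => gibbsMean J γ ε Λ τ f :=
  continuous_finsetSum _ fun s _ =>
    (continuous_gibbsWeight hJ hγ Λ s).mul (hf.comp (continuous_glue Λ s))

lemma gibbsWeight_nonneg (Λ : Finset Site) (τ : Config) (s : Λ → Bool) :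
    0 ≤ weight J γ ε Λ τ s / partitionFunction J γ ε Λ τ :=
  div_nonneg (weight_pos Λ τ s).le (partitionFunction_pos J γ ε Λ τ).le

lemma sum_gibbsWeight (Λ : Finset Site) (τ : Config) :
    ∑ s, weight J γ ε Λ τ s / partitionFunction J γ ε Λ τ = 1 := by
  rw [← Finset.sum_div]
  exact div_self (partitionFunction_pos J γ ε Λ τ).ne'

lemma integral_gibbs (Λ : Finset Site) (τ : Config) (f : Config → ℝ) :
    ∫ σ, f σ ∂(gibbs J γ ε Λ τ) = gibbsMean J γ ε Λ τ f := by
  rw [gibbs, integral_finsetSum_measure, gibbsMean]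
  · refine Finset.sum_congr rfl fun s _ => ?_
    rw [integral_smul_measure, integral_dirac, ENNReal.toReal_ofReal (gibbsWeight_nonneg Λ τ s),
      smul_eq_mul]
  · intro s _
    exact (integrable_dirac (by simp)).smul_measure ENNReal.ofReal_ne_top

/-- The event that all spins in `B` are `+1`. -/
def allPlus (B : Finset Site) : Set Config := {σ | ∀ u ∈ B, σ u = true}

/-- The indicator function of `allPlus B`. -/
def allPlusFun (B : Finset Site) (σ : Config) : ℝ := ∏ u ∈ B, (1 + spin σ u) / 2

open Classical in
lemma allPlusFun_eq (B : Finset Site) (σ : Config) :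
    allPlusFun B σ = if σ ∈ allPlus B then 1 else 0 := by
  split_ifs with h
  · exact Finset.prod_eq_one fun u hu => by simp [spin, h u hu]
  · simp only [allPlus, Set.mem_ofPred_eq, not_forall] at h
    obtain ⟨u, hu, hσ⟩ := h
    exact Finset.prod_eq_zero hu (by simp [spin, hσ])

lemma continuous_allPlusFun (B : Finset Site) : Continuous (allPlusFun B) :=
  continuous_finsetProd B fun u _ => (continuous_const.add (continuous_spin u)).div_const 2

/-- Reduces the convergence of cylinder probabilities to that of the spin products, which are
monotone in the volume. -/
lemma allPlusFun_eq_sum (B : Finset Site) (σ : Config) :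
    allPlusFun B σ = ∑ A ∈ B.powerset, (1 / 2) ^ B.card * spinProd A σ := by
  have h : allPlusFun B σ = (1 / 2) ^ B.card * ∏ u ∈ B, (spin σ u + 1) := by
    rw [allPlusFun, ← Finset.prod_const, ← Finset.prod_mul_distrib]
    exact Finset.prod_congr rfl fun u _ => by ring
  rw [h, Finset.prod_add, Finset.mul_sum]
  refine Finset.sum_congr rfl fun A _ => ?_
  simp [spinProd]

lemma measurableSet_allPlus (B : Finset Site) : MeasurableSet (allPlus B) := by
  have : allPlus B = ⋂ u ∈ B, (fun σ : Config => σ u) ⁻¹' {true} := by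
    ext σ; simp [allPlus]
  rw [this]
  exact Finset.measurableSet_biInter B fun u _ =>
    (measurable_pi_apply u) (MeasurableSet.of_discrete)

/-- These events form a π-system, the intersection belonging to the union of the two sets, and the
ones for single sites generate the product σ-algebra. -/
lemma measure_ext_of_allPlus {μ ν : Measure Config} [IsProbabilityMeasure μ]
    [IsProbabilityMeasure ν] (h : ∀ B, μ (allPlus B) = ν (allPlus B)) : μ = ν := by
  classical
  refine ext_of_generate_finite (Set.range allPlus) ?_ ?_ ?_ (by simp)
  · refine le_antisymm ?_ (MeasurableSpace.generateFrom_le ?_)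
    · refine iSup_le fun u => ?_
      rw [← measurable_iff_comap_le]
      refine @measurable_to_bool _ (MeasurableSpace.generateFrom _) _ ?_
      refine MeasurableSpace.measurableSet_generateFrom ⟨{u}, ?_⟩
      ext σ; simp [allPlus]
    · rintro _ ⟨B, rfl⟩
      exact measurableSet_allPlus B
  · rintro _ ⟨B, rfl⟩ _ ⟨B', rfl⟩ _
    refine ⟨B ∪ B', ?_⟩
    ext σ
    simp only [allPlus, Set.mem_ofPred_eq, Finset.mem_union, Set.mem_inter_iff]
    constructor
    · exact fun h => ⟨fun u hu => h u (Or.inl hu), fun u hu => h u (Or.inr hu)⟩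
    · rintro ⟨h1, h2⟩ u (hu | hu)
      exacts [h1 u hu, h2 u hu]
  · rintro _ ⟨B, rfl⟩
    exact h B

lemma measure_allPlus (μ : Measure Config) [IsProbabilityMeasure μ] (B : Finset Site) :
    μ (allPlus B) = ENNReal.ofReal (∫ σ, allPlusFun B σ ∂μ) := by
  classical
  have : allPlusFun B = (allPlus B).indicator 1 := by
    funext σ
    rw [allPlusFun_eq, Set.indicator_apply]; rfl
  rw [this, integral_indicator_one (measurableSet_allPlus B), ofReal_measureReal]

/-- Continuous functions on configurations as bounded continuous functions. -/
def toBCF (f : Config → ℝ) (hf : Continuous f) : BoundedContinuousFunction Config ℝ :=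
  BoundedContinuousFunction.mkOfCompact ⟨f, hf⟩

lemma tendsto_integral {α : Type*} {l : Filter α} {μs : α → ProbabilityMeasure Config}
    {μ : ProbabilityMeasure Config} (h : Tendsto μs l (𝓝 μ)) {f : Config → ℝ}
    (hf : Continuous f) :
    Tendsto (fun i => ∫ σ, f σ ∂(μs i : Measure Config)) l
      (𝓝 (∫ σ, f σ ∂(μ : Measure Config))) :=
  ProbabilityMeasure.tendsto_iff_forall_integral_tendsto.mp h (toBCF f hf)

lemma integrable_of_continuous (μ : Measure Config) [IsProbabilityMeasure μ] {f : Config → ℝ}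
    (hf : Continuous f) : Integrable f μ :=
  (toBCF f hf).integrable μ

/-- The plus states converge. -/
theorem exists_plusLimit (hJ : IsKacProfile J) (hγ : 0 < γ) (hε : 0 < ε) :
    ∃ μ, IsThermodynamicLimit J γ ε plusConfig μ := by
  have hspin : ∀ B, ∃ c, Tendsto (fun Λ => gibbsMean J γ ε Λ plusConfig (spinProd B)) atTop
      (𝓝 c) := by
    intro B
    refine ⟨_, tendsto_atTop_ciInf
      (fun Λ Λ' hΛ => gibbsMean_plus_anti hJ hγ hε hΛ B) ⟨-1, ?_⟩⟩
    rintro _ ⟨Λ, rfl⟩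
    have h1 : ∀ σ, -1 ≤ spinProd B σ := fun σ => by
      have : |spinProd B σ| ≤ 1 := by
        rw [spinProd, Finset.abs_prod]
        refine Finset.prod_le_one (fun _ _ => abs_nonneg _) fun u _ => ?_
        rw [spin]; split_ifs <;> simp
      exact (abs_le.mp this).1
    calc (-1 : ℝ) = ∑ s : Λ → Bool, weight J γ ε Λ plusConfig s /
          partitionFunction J γ ε Λ plusConfig * (-1) := by
            rw [← Finset.sum_mul, sum_gibbsWeight, one_mul]
      _ ≤ _ := Finset.sum_le_sum fun s _ =>
          mul_le_mul_of_nonneg_left (h1 _) (gibbsWeight_nonneg Λ _ s)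
  have hall : ∀ B, ∃ c, Tendsto (fun Λ => ∫ σ, allPlusFun B σ ∂(gibbsProb J γ ε Λ plusConfig :
      Measure Config)) atTop (𝓝 c) := by
    intro B
    choose c hc using hspin
    refine ⟨∑ A ∈ B.powerset, (1 / 2) ^ B.card * c A, ?_⟩
    have : ∀ Λ, ∫ σ, allPlusFun B σ ∂(gibbsProb J γ ε Λ plusConfig : Measure Config) =
        ∑ A ∈ B.powerset, (1 / 2) ^ B.card * gibbsMean J γ ε Λ plusConfig (spinProd A) := by
      intro Λ
      simp only [allPlusFun_eq_sum]
      rw [integral_finsetSum]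
      · refine Finset.sum_congr rfl fun A _ => ?_
        rw [integral_const_mul]
        congr 1
        exact integral_gibbs Λ _ _
      · intro A _
        exact (integrable_of_continuous _ (continuous_spinProd A)).const_mul _
    simp only [this]
    exact tendsto_finsetSum _ fun A _ => (hc A).const_mul _
  choose c hc using hall
  set l := Filter.map (fun Λ => gibbsProb J γ ε Λ plusConfig) atTop
  -- All cluster points give the events `allPlus B` the same probabilities, so compactness of the
  -- space of probability measures yields convergence.
  have hcl : ∀ μ : ProbabilityMeasure Config, ClusterPt μ l → ∀ B,
      ∫ σ, allPlusFun B σ ∂(μ : Measure Config) = c B := by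
    intro μ hμ B
    have hcont : ContinuousAt (fun ν : ProbabilityMeasure Config =>
        ∫ σ, allPlusFun B σ ∂(ν : Measure Config)) μ :=
      tendsto_integral tendsto_id (continuous_allPlusFun B)
    have h1 := hμ.map hcont (tendsto_map (x := l))
    have h2 := h1.mono (hc B)
    exact eq_of_nhds_neBot h2
  obtain ⟨μ, hμ⟩ := exists_clusterPt_of_compactSpace l
  refine ⟨μ, le_nhds_of_unique_clusterPt fun ν hν => ?_⟩
  have h : (ν : Measure Config) = μ := measure_ext_of_allPlus fun B => by
    rw [measure_allPlus, measure_allPlus, hcl μ hμ B, hcl ν hν B]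
  exact Subtype.ext h

lemma gibbs_apply (Λ : Finset Site) (τ : Config) (A : Set Config) :
    gibbs J γ ε Λ τ A = ∑ s : Λ → Bool,
      ENNReal.ofReal (weight J γ ε Λ τ s / partitionFunction J γ ε Λ τ) *
        Measure.dirac (glue Λ s τ) A := by
  simp [gibbs, Measure.coe_finsetSum, Finset.sum_apply]

lemma measurable_gibbs (hJ : IsKacProfile J) (hγ : 0 < γ) (Λ : Finset Site) :
    Measurable (gibbs J γ ε Λ) := by
  refine Measure.measurable_of_measurable_coe _ fun A hA => ?_
  simp only [gibbs_apply]
  refine Finset.measurable_fun_sum _ fun s _ => ?_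
  refine ((continuous_gibbsWeight hJ hγ Λ s).measurable.ennreal_ofReal).mul ?_
  simp only [Measure.dirac_apply' _ hA]
  exact (measurable_one.indicator hA).comp (continuous_glue Λ s).measurable

/-- Thermodynamic limits satisfy the DLR equations. -/
theorem isDLR_of_isThermodynamicLimit (hJ : IsKacProfile J) (hγ : 0 < γ) {τ : Config}
    {μ : ProbabilityMeasure Config} (hμ : IsThermodynamicLimit J γ ε τ μ) : IsDLR J γ ε μ := by
  intro Λ A hA
  have hm := (measurable_gibbs (ε := ε) hJ hγ Λ).aemeasurable (μ := (μ : Measure Config))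
  set ν : Measure Config := Measure.bind (μ : Measure Config) (gibbs J γ ε Λ) with hν
  have hνp : IsProbabilityMeasure ν := ⟨by
    rw [hν, Measure.bind_apply MeasurableSet.univ hm]; simp⟩
  have key : ν = (μ : Measure Config) := by
    refine measure_ext_of_allPlus fun B => ?_
    have h1 : ∀ σ, gibbs J γ ε Λ σ (allPlus B) =
        ENNReal.ofReal (gibbsMean J γ ε Λ σ (allPlusFun B)) := fun σ => by
      rw [measure_allPlus, integral_gibbs]
    -- The Feller property, a consequence of the finite range of the interaction: it allows passing
    -- to the weak limit in the boundary condition.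
    have hcont := continuous_gibbsMean (ε := ε) hJ hγ Λ (continuous_allPlusFun B)
    have h0 : ∀ σ, 0 ≤ gibbsMean J γ ε Λ σ (allPlusFun B) := fun σ => by
      refine Finset.sum_nonneg fun s _ => mul_nonneg (gibbsWeight_nonneg Λ σ s) ?_
      classical
      rw [allPlusFun_eq]; split_ifs <;> simp
    rw [hν, Measure.bind_apply (measurableSet_allPlus B) hm, measure_allPlus]
    simp only [h1]
    rw [← ofReal_integral_eq_lintegral_ofReal (integrable_of_continuous _ hcont)
      (Eventually.of_forall h0)]
    congr 1
    have t1 := tendsto_integral hμ hcont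
    have t2 := tendsto_integral hμ (continuous_allPlusFun B)
    -- By consistency the two nets coincide as soon as the volume contains `Λ`.
    refine tendsto_nhds_unique (t1.congr' ?_) t2
    filter_upwards [eventually_ge_atTop Λ] with Λ' hΛ'
    change ∫ σ, _ ∂(gibbs J γ ε Λ' τ) = ∫ σ, _ ∂(gibbs J γ ε Λ' τ)
    rw [integral_gibbs, integral_gibbs]
    exact gibbsMean_gibbsMean hJ hγ hΛ' τ _
  rw [← Measure.bind_apply hA hm, ← hν, key]

/-- The global spin flip. -/
def flip (σ : Config) : Config := fun u => !(σ u)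

lemma continuous_flip : Continuous flip :=
  continuous_pi fun u => (continuous_of_discreteTopology (f := not)).comp (continuous_apply u)

lemma spin_flip (σ : Config) (u : Site) : spin (flip σ) u = -spin σ u := by
  cases h : σ u <;> simp [spin, flip, h]

lemma hamiltonian_flip (Λ : Finset Site) (σ : Config) :
    hamiltonian J γ ε Λ (flip σ) = hamiltonian J γ ε Λ σ := by
  simp [hamiltonian, spin_flip]

/-- The energy is even in the spins, and the flip exchanges the two boundary conditions. -/
lemma gibbs_minus (Λ : Finset Site) :
    gibbs J γ ε Λ minusConfig = (gibbs J γ ε Λ plusConfig).map flip := by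
  have hm : Measurable flip := continuous_flip.measurable
  have hg : ∀ s : Λ → Bool, glue Λ (fun u => !(s u)) minusConfig = flip (glue Λ s plusConfig) := by
    intro s
    funext u
    by_cases h : u ∈ Λ <;> simp [glue, flip, h, minusConfig, plusConfig]
  let e : (Λ → Bool) ≃ (Λ → Bool) := Equiv.piCongrRight fun _ => Equiv.boolNot
  have he : ∀ s, e s = fun u => !(s u) := fun s => rfl
  have hw : ∀ s, weight J γ ε Λ minusConfig (e s) = weight J γ ε Λ plusConfig s := fun s => by
    rw [weight, weight, he, hg, hamiltonian_flip]
  have hZ : partitionFunction J γ ε Λ minusConfig = partitionFunction J γ ε Λ plusConfig := by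
    rw [partitionFunction, ← Equiv.sum_comp e]
    exact Finset.sum_congr rfl fun s _ => hw s
  ext A hA
  rw [Measure.map_apply hm hA, gibbs_apply, gibbs_apply, ← Equiv.sum_comp e]
  refine Finset.sum_congr rfl fun s _ => ?_
  rw [hw, hZ, he, hg, Measure.dirac_apply' _ hA, Measure.dirac_apply' _ (hm hA)]
  rfl

/-- A uniform lower bound on the magnetization of the plus states in a fixed finite set implies a
phase transition. -/
theorem phaseTransition_of_magnetization (hJ : IsKacProfile J) (hγ : 0 < γ) (hε : 0 < ε)
    (Q : Finset Site) {c : ℝ} (hc : 0 < c)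
    (h : ∀ Λ, c ≤ ∑ v ∈ Q, gibbsMean J γ ε Λ plusConfig (spinProd {v})) :
    ∃ μplus μminus : ProbabilityMeasure Config,
      IsThermodynamicLimit J γ ε plusConfig μplus ∧
      IsThermodynamicLimit J γ ε minusConfig μminus ∧
      IsDLR J γ ε μplus ∧ IsDLR J γ ε μminus ∧ μplus ≠ μminus := by
  obtain ⟨μ, hμ⟩ := exists_plusLimit hJ hγ hε
  have hmin : IsThermodynamicLimit J γ ε minusConfig
      (μ.map continuous_flip.measurable.aemeasurable) := by
    have := ProbabilityMeasure.tendsto_map_of_tendsto_of_continuous _ _ hμ continuous_flip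
    refine this.congr fun Λ => Subtype.ext ?_
    exact (gibbs_minus Λ).symm
  refine ⟨μ, _, hμ, hmin, isDLR_of_isThermodynamicLimit hJ hγ hμ,
    isDLR_of_isThermodynamicLimit hJ hγ hmin, fun heq => ?_⟩
  let m : Config → ℝ := fun σ => ∑ v ∈ Q, spin σ v
  have hm : Continuous m := continuous_finsetSum _ fun v _ => continuous_spin v
  have h1 : c ≤ ∫ σ, m σ ∂(μ : Measure Config) := by
    refine ge_of_tendsto' (tendsto_integral hμ hm) fun Λ => (h Λ).trans (le_of_eq ?_)
    change _ = ∫ σ, _ ∂(gibbs J γ ε Λ plusConfig)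
    rw [integral_gibbs]
    simp only [gibbsMean, m, spinProd, Finset.prod_singleton, Finset.mul_sum]
    rw [Finset.sum_comm]
  -- If the two limits were equal, `μ` would be invariant under the flip, which changes the sign of
  -- `m`.
  have h2 : ∫ σ, m σ ∂(μ : Measure Config) = -∫ σ, m σ ∂(μ : Measure Config) := by
    conv_lhs => rw [heq]
    rw [ProbabilityMeasure.toMeasure_map, integral_map continuous_flip.measurable.aemeasurable
      hm.aestronglyMeasurable, ← integral_neg]
    simp [m, spin_flip]
  linarith

end Limit

/-! ### Independent Bernoulli variables: independence, union bounds, Chebyshev, staged exposure -/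

section BernoulliToolkit

variable {ι κ : Type*} [Fintype ι] [DecidableEq ι] [Fintype κ] [DecidableEq κ]
  {t : ι → ℝ}

lemma sum_prod_bernWeight (t : ι → ℝ) : ∑ ω : ι → Bool, ∏ i, bernWeight (t i) (ω i) = 1 := by
  rw [← Fintype.piFinset_univ, ← Finset.prod_univ_sum (fun _ => Finset.univ)
    (fun i b => bernWeight (t i) b)]
  exact Finset.prod_eq_one fun i _ => sum_bernWeight _

lemma prod_bernWeight_nonneg (ht : ∀ i, t i ∈ Set.Icc (0 : ℝ) 1) (ω : ι → Bool) :
    0 ≤ ∏ i, bernWeight (t i) (ω i) :=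
  Finset.prod_nonneg fun i _ => bernWeight_nonneg (ht i) _

lemma bernMean_const (t : ι → ℝ) (c : ℝ) : bernMean t (fun _ => c) = c := by
  rw [bernMean, ← Finset.sum_mul, sum_prod_bernWeight, one_mul]

lemma bernMean_add (t : ι → ℝ) (f g : (ι → Bool) → ℝ) :
    bernMean t (fun ω => f ω + g ω) = bernMean t f + bernMean t g := by
  simp only [bernMean, mul_add, Finset.sum_add_distrib]

lemma bernMean_const_mul (t : ι → ℝ) (c : ℝ) (f : (ι → Bool) → ℝ) :
    bernMean t (fun ω => c * f ω) = c * bernMean t f := by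
  simp only [bernMean, Finset.mul_sum]
  exact Finset.sum_congr rfl fun ω _ => by ring

lemma bernMean_sum {α : Type*} (t : ι → ℝ) (s : Finset α) (f : α → (ι → Bool) → ℝ) :
    bernMean t (fun ω => ∑ a ∈ s, f a ω) = ∑ a ∈ s, bernMean t (f a) := by
  simp only [bernMean, Finset.mul_sum]
  rw [Finset.sum_comm]

lemma bernMean_mono (ht : ∀ i, t i ∈ Set.Icc (0 : ℝ) 1) {f g : (ι → Bool) → ℝ}
    (h : ∀ ω, f ω ≤ g ω) : bernMean t f ≤ bernMean t g :=
  Finset.sum_le_sum fun ω _ => mul_le_mul_of_nonneg_left (h ω) (prod_bernWeight_nonneg ht ω)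

/-- Functions of disjoint sets of coordinates are independent. -/
lemma bernMean_mul_of_dependsOn (t : ι → ℝ) {f g : (ι → Bool) → ℝ} {S T : Set ι}
    (hf : DependsOn f S) (hg : DependsOn g T) (hST : Disjoint S T) :
    bernMean t (fun ω => f ω * g ω) = bernMean t f * bernMean t g := by
  classical
  -- Two independent copies exchange their coordinates in `T`; this preserves the joint weight, and
  -- afterwards `f` sees only one copy and `g` only the other.
  let mix : (ι → Bool) → (ι → Bool) → (ι → Bool) := fun ω ω' i => if i ∈ T then ω' i else ω i
  let e : (ι → Bool) × (ι → Bool) → (ι → Bool) × (ι → Bool) :=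
    fun q => (mix q.1 q.2, mix q.2 q.1)
  have he : Function.Involutive e := by
    rintro ⟨ω, ω'⟩
    refine Prod.ext ?_ ?_ <;> funext i <;> by_cases h : i ∈ T <;> simp [e, mix, h]
  have hw : ∀ ω ω' : ι → Bool, (∏ i, bernWeight (t i) (mix ω ω' i)) *
      (∏ i, bernWeight (t i) (mix ω' ω i)) =
      (∏ i, bernWeight (t i) (ω i)) * ∏ i, bernWeight (t i) (ω' i) := by
    intro ω ω'
    rw [← Finset.prod_mul_distrib, ← Finset.prod_mul_distrib]
    refine Finset.prod_congr rfl fun i _ => ?_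
    by_cases h : i ∈ T <;> simp [mix, h, mul_comm]
  have hfm : ∀ ω ω', f (mix ω ω') = f ω := fun ω ω' => hf fun i hi => by
    have : i ∉ T := fun h => Set.disjoint_left.mp hST hi h
    simp [mix, this]
  have hgm : ∀ ω ω', g (mix ω ω') = g ω' := fun ω ω' => hg fun i hi => by simp [mix, hi]
  have h1 : bernMean t f * bernMean t g = ∑ q : (ι → Bool) × (ι → Bool),
      ((∏ i, bernWeight (t i) (q.1 i)) * ∏ i, bernWeight (t i) (q.2 i)) * (f q.1 * g q.2) := by
    rw [bernMean, bernMean, Finset.sum_mul_sum, Fintype.sum_prod_type]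
    exact Finset.sum_congr rfl fun ω _ => Finset.sum_congr rfl fun ω' _ => by ring
  have h2 : bernMean t (fun ω => f ω * g ω) = ∑ q : (ι → Bool) × (ι → Bool),
      ((∏ i, bernWeight (t i) (q.1 i)) * ∏ i, bernWeight (t i) (q.2 i)) * (f q.1 * g q.1) := by
    rw [Fintype.sum_prod_type, bernMean]
    refine Finset.sum_congr rfl fun ω _ => ?_
    dsimp only
    rw [← Finset.sum_mul, ← Finset.mul_sum, sum_prod_bernWeight, mul_one]
  rw [h1, h2, ← Equiv.sum_comp he.toPerm]
  refine Finset.sum_congr rfl fun q _ => ?_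
  simp only [Function.Involutive.coe_toPerm, e, hfm, hgm, hw]

open Classical in
/-- The probability of an event under independent Bernoulli variables with parameters `t`. -/
def bernProb (t : ι → ℝ) (P : (ι → Bool) → Prop) : ℝ :=
  bernMean t (fun ω => if P ω then 1 else 0)

lemma bernProb_eq (t : ι → ℝ) (P : (ι → Bool) → Prop) [DecidablePred P] :
    bernProb t P = bernMean t (fun ω => if P ω then 1 else 0) := by
  rw [bernProb]; congr 1; funext ω; congr

lemma bernProb_nonneg (ht : ∀ i, t i ∈ Set.Icc (0 : ℝ) 1) (P : (ι → Bool) → Prop) :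
    0 ≤ bernProb t P := by
  classical
  have := bernMean_mono ht (f := fun _ => 0) (g := fun ω => if P ω then 1 else 0)
    (fun ω => by split_ifs <;> simp)
  rw [bernMean_const] at this
  convert this using 1
  rw [bernProb]

lemma bernProb_mono (ht : ∀ i, t i ∈ Set.Icc (0 : ℝ) 1) {P Q : (ι → Bool) → Prop}
    (h : ∀ ω, P ω → Q ω) : bernProb t P ≤ bernProb t Q := by
  classical
  refine bernMean_mono ht fun ω => ?_
  by_cases hP : P ω
  · simp [hP, h ω hP]
  · rw [if_neg hP]; split_ifs <;> simp

lemma bernProb_true (t : ι → ℝ) : bernProb t (fun _ => True) = 1 := by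
  simp [bernProb, bernMean_const]

lemma bernProb_false (t : ι → ℝ) : bernProb t (fun _ => False) = 0 := by
  simp [bernProb, bernMean_const]

lemma bernProb_le_one (ht : ∀ i, t i ∈ Set.Icc (0 : ℝ) 1) (P : (ι → Bool) → Prop) :
    bernProb t P ≤ 1 :=
  (bernProb_mono ht fun _ _ => trivial).trans (bernProb_true t).le

lemma bernProb_compl (t : ι → ℝ) (P : (ι → Bool) → Prop) :
    bernProb t (fun ω => ¬ P ω) = 1 - bernProb t P := by
  classical
  have h : (fun ω => (if ¬ P ω then (1 : ℝ) else 0) + if P ω then 1 else 0) = fun _ => 1 := by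
    funext ω
    by_cases h : P ω <;> simp [h]
  rw [eq_sub_iff_add_eq, bernProb_eq, bernProb_eq, ← bernMean_add, h, bernMean_const]

lemma bernProb_or_le (ht : ∀ i, t i ∈ Set.Icc (0 : ℝ) 1) (P Q : (ι → Bool) → Prop) :
    bernProb t (fun ω => P ω ∨ Q ω) ≤ bernProb t P + bernProb t Q := by
  classical
  rw [bernProb, bernProb, bernProb, ← bernMean_add]
  refine bernMean_mono ht fun ω => ?_
  by_cases h : P ω <;> by_cases h' : Q ω <;> simp [h, h']

lemma bernProb_exists_le {α : Type*} (ht : ∀ i, t i ∈ Set.Icc (0 : ℝ) 1) (s : Finset α)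
    (P : α → (ι → Bool) → Prop) :
    bernProb t (fun ω => ∃ a ∈ s, P a ω) ≤ ∑ a ∈ s, bernProb t (P a) := by
  classical
  simp only [bernProb]
  rw [← bernMean_sum]
  refine bernMean_mono ht fun ω => ?_
  split_ifs with h
  · obtain ⟨a, ha, hP⟩ := h
    refine le_trans ?_ (Finset.single_le_sum (f := fun a => if P a ω then (1 : ℝ) else 0)
      (fun b _ => by positivity) ha)
    simp [hP]
  · exact Finset.sum_nonneg fun b _ => by positivity

/-- Events depend on coordinates in the same way as functions. -/
lemma bernProb_and_of_dependsOn (t : ι → ℝ) {P Q : (ι → Bool) → Prop} {S T : Set ι}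
    (hP : DependsOn P S) (hQ : DependsOn Q T) (hST : Disjoint S T) :
    bernProb t (fun ω => P ω ∧ Q ω) = bernProb t P * bernProb t Q := by
  classical
  have h1 : DependsOn (fun ω => if P ω then (1 : ℝ) else 0) S := fun ω ω' h => by
    simp only [hP h]
  have h2 : DependsOn (fun ω => if Q ω then (1 : ℝ) else 0) T := fun ω ω' h => by
    simp only [hQ h]
  have := bernMean_mul_of_dependsOn t h1 h2 hST
  rw [bernProb, bernProb, bernProb, ← this]
  congr 1
  funext ω
  by_cases h : P ω <;> by_cases h' : Q ω <;> simp [h, h']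

lemma bernProb_forall_of_dependsOn {α : Type*} (t : ι → ℝ) (s : Finset α)
    {P : α → (ι → Bool) → Prop} {S : α → Set ι} (hP : ∀ a ∈ s, DependsOn (P a) (S a))
    (hS : ∀ a ∈ s, ∀ b ∈ s, a ≠ b → Disjoint (S a) (S b)) :
    bernProb t (fun ω => ∀ a ∈ s, P a ω) = ∏ a ∈ s, bernProb t (P a) := by
  classical
  induction s using Finset.induction_on with
  | empty => simpa using bernProb_true t
  | insert a s ha ih =>
    rw [Finset.prod_insert ha, ← ih (fun b hb => hP b (Finset.mem_insert_of_mem hb))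
      (fun b hb c hc => hS b (Finset.mem_insert_of_mem hb) c (Finset.mem_insert_of_mem hc)),
      ← bernProb_and_of_dependsOn t (S := S a) (T := ⋃ b ∈ s, S b)
        (hP a (Finset.mem_insert_self a s))]
    · simp only [Finset.forall_mem_insert]
    · intro ω ω' h
      refine propext (forall₂_congr fun b hb => ?_)
      exact iff_of_eq (hP b (Finset.mem_insert_of_mem hb) fun i hi => h i
        (Set.mem_biUnion hb hi))
    · refine Set.disjoint_iUnion₂_right.mpr fun b hb => ?_
      exact hS a (Finset.mem_insert_self a s) b (Finset.mem_insert_of_mem hb)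
        (fun h => ha (h ▸ hb))

lemma bernProb_coord (t : ι → ℝ) (i : ι) : bernProb t (fun ω => ω i = true) = t i := by
  classical
  have h := bernMean_convexComb t (fun ω => if ω i = true then 1 else 0) i
  have h0 : bernMean (Function.update t i 0) (fun ω => if ω i = true then 1 else 0) = 0 := by
    refine Finset.sum_eq_zero fun ω _ => ?_
    by_cases hi : ω i = true
    · rw [Finset.prod_eq_zero (Finset.mem_univ i), zero_mul]
      simp [bernWeight, hi]
    · simp [hi]
  have h1 : bernMean (Function.update t i 1) (fun ω => if ω i = true then 1 else 0) = 1 := by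
    refine Eq.trans ?_ (sum_prod_bernWeight (Function.update t i 1))
    refine Finset.sum_congr rfl fun ω _ => ?_
    beta_reduce
    by_cases hi : ω i = true
    · rw [if_pos hi, mul_one]
    · rw [Finset.prod_eq_zero (Finset.mem_univ i), zero_mul]
      simp [bernWeight, hi]
  rw [h0, h1, mul_zero, mul_one, zero_add] at h
  rw [bernProb_eq, h]

lemma bernProb_coord_false (t : ι → ℝ) (i : ι) :
    bernProb t (fun ω => ω i = false) = 1 - t i := by
  rw [← bernProb_coord t i, ← bernProb_compl]
  simp

lemma dependsOn_coord (i : ι) (b : Bool) : DependsOn (fun ω : ι → Bool => ω i = b) {i} :=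
  fun ω ω' h => by simp only [h i rfl]

/-- The probability that all variables in `s` are closed. -/
lemma bernProb_forall_closed (t : ι → ℝ) (s : Finset ι) :
    bernProb t (fun ω => ∀ i ∈ s, ω i = false) = ∏ i ∈ s, (1 - t i) := by
  rw [bernProb_forall_of_dependsOn t s (S := fun i => {i}) (fun i _ => dependsOn_coord i false)
    (fun i _ j _ hij => by simpa using hij)]
  exact Finset.prod_congr rfl fun i _ => bernProb_coord_false t i

lemma bernProb_forall_closed_le (ht : ∀ i, t i ∈ Set.Icc (0 : ℝ) 1) (s : Finset ι) :
    bernProb t (fun ω => ∀ i ∈ s, ω i = false) ≤ Real.exp (-∑ i ∈ s, t i) := by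
  rw [bernProb_forall_closed, ← Finset.sum_neg_distrib, Real.exp_sum]
  refine Finset.prod_le_prod (fun i _ => by linarith [(ht i).2]) fun i _ => ?_
  have := Real.add_one_le_exp (-t i)
  linarith

open Classical in
/-- Chebyshev's inequality for the number of occurrences among pairwise independent events. -/
lemma bernProb_card_lt_le {α : Type*} (ht : ∀ i, t i ∈ Set.Icc (0 : ℝ) 1) (s : Finset α)
    {P : α → (ι → Bool) → Prop}
    (hP : ∀ a ∈ s, ∀ b ∈ s, a ≠ b →
      bernProb t (fun ω => P a ω ∧ P b ω) = bernProb t (P a) * bernProb t (P b))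
    {m θ : ℝ} (hθ : 0 < θ) (hμ : 0 < ∑ a ∈ s, bernProb t (P a))
    (hm : m * (1 + θ) ≤ ∑ a ∈ s, bernProb t (P a)) :
    bernProb t (fun ω => ((s.filter fun a => P a ω).card : ℝ) < m) ≤
      (1 + θ) ^ 2 / (θ ^ 2 * ∑ a ∈ s, bernProb t (P a)) := by
  set μ := ∑ a ∈ s, bernProb t (P a) with hμdef
  let X : (ι → Bool) → ℝ := fun ω => ∑ a ∈ s, if P a ω then (1 : ℝ) else 0
  have hX : ∀ ω, ((s.filter fun a => P a ω).card : ℝ) = X ω := fun ω => by simp [X]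
  have hEX : bernMean t X = μ := by
    simp only [X]; rw [bernMean_sum]; rfl
  -- Pairwise independence bounds the variance by the mean; the diagonal terms give the additional
  -- `μ`.
  have hEX2 : bernMean t (fun ω => X ω * X ω) ≤ μ ^ 2 + μ := by
    have h1 : ∀ ω, X ω * X ω =
        ∑ a ∈ s, ∑ b ∈ s, if P a ω ∧ P b ω then (1 : ℝ) else 0 := fun ω => by
      simp only [X]
      rw [Finset.sum_mul_sum]
      refine Finset.sum_congr rfl fun a _ => Finset.sum_congr rfl fun b _ => ?_
      by_cases h : P a ω <;> by_cases h' : P b ω <;> simp [h, h']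
    simp only [h1, bernMean_sum]
    have h2 : ∀ a ∈ s, ∑ b ∈ s, bernMean t (fun ω => if P a ω ∧ P b ω then (1 : ℝ) else 0) ≤
        bernProb t (P a) * μ + bernProb t (P a) := by
      intro a ha
      have h3 : ∀ b ∈ s, bernMean t (fun ω => if P a ω ∧ P b ω then (1 : ℝ) else 0) ≤
          bernProb t (P a) * bernProb t (P b) + if b = a then bernProb t (P a) else 0 := by
        intro b hb
        by_cases hab : b = a
        · subst hab
          simp only [and_self, if_true]
          have := mul_nonneg (bernProb_nonneg ht (P b)) (bernProb_nonneg ht (P b))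
          have h4 : bernMean t (fun ω => if P b ω then (1 : ℝ) else 0) = bernProb t (P b) := rfl
          linarith
        · rw [if_neg hab, add_zero]
          rw [← bernProb_eq]
          exact (hP a ha b hb (Ne.symm hab)).le
      refine (Finset.sum_le_sum h3).trans (le_of_eq ?_)
      rw [Finset.sum_add_distrib, ← Finset.mul_sum, Finset.sum_ite_eq' s a]
      simp [ha, hμdef]
    refine (Finset.sum_le_sum h2).trans (le_of_eq ?_)
    rw [Finset.sum_add_distrib, ← Finset.sum_mul, ← hμdef]
    ring
  have hc : 0 < θ * μ / (1 + θ) := by positivity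
  -- Since `m ≤ μ / (1 + θ)`, a count below `m` deviates from the mean by at least `θ * μ / (1 +
  -- θ)`.
  have key : ∀ ω, (if ((s.filter fun a => P a ω).card : ℝ) < m then (1 : ℝ) else 0) ≤
      ((1 + θ) / (θ * μ)) ^ 2 * (X ω * X ω + (-2 * μ) * X ω + μ ^ 2) := by
    intro ω
    have hsq : X ω * X ω + (-2 * μ) * X ω + μ ^ 2 = (μ - X ω) ^ 2 := by ring
    rw [hsq]
    split_ifs with h
    · rw [hX] at h
      have h1 : m ≤ μ / (1 + θ) := by rw [le_div_iff₀ (by positivity)]; exact hm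
      have h2 : θ * μ / (1 + θ) ≤ μ - X ω := by
        have : μ / (1 + θ) + θ * μ / (1 + θ) = μ := by field_simp
        linarith
      rw [← mul_pow]
      have h3 : 1 ≤ (1 + θ) / (θ * μ) * (μ - X ω) := by
        calc (1 : ℝ) = (1 + θ) / (θ * μ) * (θ * μ / (1 + θ)) := by field_simp
          _ ≤ _ := by gcongr
      exact one_le_pow₀ h3
    · positivity
  refine (bernMean_mono ht key).trans ?_
  rw [bernMean_const_mul, bernMean_add, bernMean_add, bernMean_const_mul, bernMean_const, hEX]
  have h5 : bernMean t (fun ω => X ω * X ω) + -2 * μ * μ + μ ^ 2 ≤ μ := by nlinarith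
  calc ((1 + θ) / (θ * μ)) ^ 2 * (bernMean t (fun ω => X ω * X ω) + -2 * μ * μ + μ ^ 2)
      ≤ ((1 + θ) / (θ * μ)) ^ 2 * μ := by gcongr
    _ = (1 + θ) ^ 2 / (θ ^ 2 * μ) := by field_simp

lemma bernMean_sum_elim (t : ι → ℝ) (t' : κ → ℝ) (f : (ι ⊕ κ → Bool) → ℝ) :
    bernMean (Sum.elim t t') f =
      bernMean t (fun ω => bernMean t' fun ω' => f (Sum.elim ω ω')) := by
  rw [bernMean, ← Equiv.sum_comp (Equiv.sumArrowEquivProdArrow ι κ Bool).symm,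
    Fintype.sum_prod_type]
  simp only [bernMean, Finset.mul_sum]
  refine Finset.sum_congr rfl fun ω _ => Finset.sum_congr rfl fun ω' _ => ?_
  rw [Fintype.prod_sum_type]
  simp only [Equiv.sumArrowEquivProdArrow, Equiv.coe_fn_symm_mk, Sum.elim_inl, Sum.elim_inr]
  ring

/-- A two-stage bound: if the first stage is good, then the second one fails with small
probability. -/
lemma bernProb_sum_elim_le (ht : ∀ i, t i ∈ Set.Icc (0 : ℝ) 1) {t' : κ → ℝ}
    (ht' : ∀ i, t' i ∈ Set.Icc (0 : ℝ) 1) {P : (ι ⊕ κ → Bool) → Prop} (R : (ι → Bool) → Prop)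
    {η η' : ℝ} (hR : bernProb t (fun ω => ¬ R ω) ≤ η) (hη' : 0 ≤ η')
    (hP : ∀ ω, R ω → bernProb t' (fun ω' => P (Sum.elim ω ω')) ≤ η') :
    bernProb (Sum.elim t t') P ≤ η + η' := by
  classical
  rw [bernProb, bernMean_sum_elim]
  have h : ∀ ω, bernMean t' (fun ω' => if P (Sum.elim ω ω') then (1 : ℝ) else 0) ≤
      (if ¬ R ω then (1 : ℝ) else 0) + η' := by
    intro ω
    by_cases hω : R ω
    · rw [← bernProb_eq]
      simpa [hω] using hP ω hω
    · have := bernProb_le_one ht' (fun ω' => P (Sum.elim ω ω'))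
      rw [← bernProb_eq, if_pos hω]
      refine le_trans this ?_
      linarith
  refine (bernMean_mono ht h).trans ?_
  rw [bernMean_add, bernMean_const, ← bernProb_eq]
  exact add_le_add_left hR η'

end BernoulliToolkit

/-! ### Exploration of a random graph with several classes of vertices -/

section Exploration

variable {W ι κ : Type*} [Fintype W] [DecidableEq W] [Fintype ι] [DecidableEq ι]
  [Fintype κ] [DecidableEq κ]

/-- Vertices joined by an open edge; `E e` is the set of parallel edges between the ends of `e`. -/
def OpenAdj (E : Sym2 W → Finset ι) (ω : ι → Bool) (x y : W) : Prop :=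
  ∃ i ∈ E s(x, y), ω i = true

/-- Connectivity by open edges inside `B`. -/
def ConnIn (E : Sym2 W → Finset ι) (ω : ι → Bool) (B : Finset W) : W → W → Prop :=
  Relation.ReflTransGen fun u v => u ∈ B ∧ v ∈ B ∧ OpenAdj E ω u v

open Classical in
/-- The vertices that are connected to `A` inside `B`. -/
def reachSet (E : Sym2 W → Finset ι) (ω : ι → Bool) (A B : Finset W) : Finset W :=
  Finset.univ.filter fun y => ∃ a ∈ A, ConnIn E ω B a y

open Classical in
/-- The neighbours of `A` in `U`. -/
def hitSet (E : Sym2 W → Finset ι) (ω : ι → Bool) (A U : Finset W) : Finset W :=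
  U.filter fun y => ∃ x ∈ A, OpenAdj E ω x y

/-- The part of `A` in class `k`. -/
def classPart (cl : W → κ) (A : Finset W) (k : κ) : Finset W := A.filter fun w => cl w = k

lemma mem_classPart {cl : W → κ} {A : Finset W} {k : κ} {w : W} :
    w ∈ classPart cl A k ↔ w ∈ A ∧ cl w = k := by simp [classPart]

lemma classPart_mono {cl : W → κ} {A B : Finset W} (h : A ⊆ B) (k : κ) :
    classPart cl A k ⊆ classPart cl B k := Finset.filter_subset_filter _ h

lemma subset_reachSet (E : Sym2 W → Finset ι) (ω : ι → Bool) (A B : Finset W) :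
    A ⊆ reachSet E ω A B := fun a ha => by
  classical
  exact Finset.mem_filter.mpr ⟨Finset.mem_univ _, a, ha, Relation.ReflTransGen.refl⟩

lemma reachSet_subset_reachSet (E : Sym2 W → Finset ι) (ω : ι → Bool) {A B h : Finset W}
    (hAB : A ⊆ B) (hh : h ⊆ hitSet E ω A (B \ A)) :
    reachSet E ω h (B \ A) ⊆ reachSet E ω A B := by
  classical
  intro y hy
  obtain ⟨-, z, hz, hzy⟩ := Finset.mem_filter.mp hy
  obtain ⟨hzU, x, hx, hxz⟩ := Finset.mem_filter.mp (hh hz)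
  refine Finset.mem_filter.mpr ⟨Finset.mem_univ _, x, hx, ?_⟩
  refine Relation.ReflTransGen.head ⟨hAB hx, (Finset.mem_sdiff.mp hzU).1, hxz⟩ ?_
  refine Relation.ReflTransGen.mono (fun u v huv => ?_) _ _ hzy
  exact ⟨(Finset.mem_sdiff.mp huv.1).1, (Finset.mem_sdiff.mp huv.2.1).1, huv.2.2⟩

lemma bernProb_not_hit_le {E : Sym2 W → Finset ι} (hE : ∀ e e', e ≠ e' → Disjoint (E e) (E e'))
    {t : ι → ℝ} (ht : ∀ i, t i ∈ Set.Icc (0 : ℝ) 1) (A : Finset W) (y : W) :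
    bernProb t (fun ω => ¬ ∃ x ∈ A, OpenAdj E ω x y) ≤
      Real.exp (-∑ x ∈ A, ∑ i ∈ E s(x, y), t i) := by
  have h := bernProb_forall_closed_le ht (A.biUnion fun x => E s(x, y))
  rw [Finset.sum_biUnion] at h
  · refine (bernProb_mono ht fun ω hω i hi => ?_).trans h
    obtain ⟨x, hx, hix⟩ := Finset.mem_biUnion.mp hi
    by_contra hne
    exact hω ⟨x, hx, i, hix, by simpa using hne⟩
  · intro x _ x' _ hne
    refine hE _ _ fun h => hne ?_
    rcases Sym2.eq_iff.mp h with ⟨h, -⟩ | ⟨h, h'⟩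
    exacts [h, h.trans h']

lemma dependsOn_hit (E : Sym2 W → Finset ι) (A : Finset W) (y : W) :
    DependsOn (fun ω => ∃ x ∈ A, OpenAdj E ω x y) (⋃ x ∈ A, (E s(x, y) : Set ι)) := by
  intro ω ω' h
  refine propext (exists_congr fun x => and_congr_right fun hx => exists_congr fun i =>
    and_congr_right fun hi => ?_)
  rw [h i (Set.mem_biUnion hx hi)]

lemma sym2_ne_of_mem {A : Finset W} {x y x' y' : W} (hx : x ∈ A) (hy' : y' ∉ A)
    (hne : y ≠ y') : s(x, y) ≠ s(x', y') := by
  intro h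
  rcases Sym2.eq_iff.mp h with ⟨-, h2⟩ | ⟨h1, -⟩
  · exact hne h2
  · exact hy' (h1 ▸ hx)

lemma disjoint_hit {E : Sym2 W → Finset ι} (hE : ∀ e e', e ≠ e' → Disjoint (E e) (E e'))
    {A : Finset W} {y y' : W} (hy' : y' ∉ A) (hne : y ≠ y') :
    Disjoint (⋃ x ∈ A, (E s(x, y) : Set ι)) (⋃ x ∈ A, (E s(x, y') : Set ι)) := by
  simp only [Set.disjoint_iUnion_left, Set.disjoint_iUnion_right]
  intro x' _ x hx
  exact Finset.disjoint_coe.mpr (hE _ _ (sym2_ne_of_mem ‹_› hy' hne))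

/-- At low density the probability of being hit is linear in the rate `s` up to one factor `1 + θ`,
because `exp (-s) ≤ 1 / (1 + s)`. -/
lemma one_sub_exp_neg_ge {s θ : ℝ} (hs : 0 ≤ s) (hθ : 0 < θ) (h : s * (1 + θ) ≤ θ) :
    s / (1 + θ) ≤ 1 - Real.exp (-s) := by
  have h1 : Real.exp (-s) ≤ 1 / (1 + s) := by
    rw [Real.exp_neg, ← one_div]
    exact one_div_le_one_div_of_le (by linarith) (by linarith [Real.add_one_le_exp s])
  have h2 : s / (1 + θ) ≤ 1 - 1 / (1 + s) := by
    rw [show 1 - 1 / (1 + s) = s / (1 + s) by field_simp; ring]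
    refine div_le_div_of_nonneg_left hs (by linarith) ?_
    nlinarith
  linarith

open Classical in
/-- One step of the exploration: the number of neighbours of `A` in a class. -/
lemma bernProb_hitSet_card_lt_le {E : Sym2 W → Finset ι}
    (hE : ∀ e e', e ≠ e' → Disjoint (E e) (E e'))
    {t : ι → ℝ} (ht : ∀ i, t i ∈ Set.Icc (0 : ℝ) 1) (cl : W → κ) (k : κ) {A U : Finset W}
    (hAU : Disjoint A U) {n s m θ : ℝ} (hθ : 0 < θ) (hs : 0 ≤ s) (hsθ : s * (1 + θ) ≤ θ)
    (hU : n / (1 + θ) ≤ (classPart cl U k).card)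
    (hrate : ∀ y ∈ classPart cl U k, s ≤ ∑ x ∈ A, ∑ i ∈ E s(x, y), t i)
    (hm0 : 0 < m) (hm : m * (1 + θ) ^ 3 ≤ n * s) :
    bernProb t (fun ω => ((classPart cl (hitSet E ω A U) k).card : ℝ) < m) ≤
      (1 + θ) / (θ ^ 2 * m) := by
  set Uk := classPart cl U k
  have hUA : ∀ y ∈ Uk, y ∉ A := fun y hy hyA =>
    Finset.disjoint_left.mp hAU hyA (mem_classPart.mp hy).1
  let P : W → (ι → Bool) → Prop := fun y ω => ∃ x ∈ A, OpenAdj E ω x y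
  have hhit : ∀ y ∈ Uk, s / (1 + θ) ≤ bernProb t (P y) := by
    intro y hy
    have h1 := bernProb_not_hit_le hE ht A y
    rw [bernProb_compl] at h1
    have h2 : Real.exp (-∑ x ∈ A, ∑ i ∈ E s(x, y), t i) ≤ Real.exp (-s) :=
      Real.exp_le_exp.mpr (neg_le_neg (hrate y hy))
    have h3 := one_sub_exp_neg_ge hs hθ hsθ
    linarith
  -- The three factors `1 + θ` in `hm` pay for the vertices already used, for the difference between
  -- rate and probability, and for the deviation in Chebyshev's inequality.
  have hμ : m * (1 + θ) ≤ ∑ y ∈ Uk, bernProb t (P y) := by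
    calc m * (1 + θ) = m * (1 + θ) ^ 3 / (1 + θ) ^ 2 := by field_simp
      _ ≤ n * s / (1 + θ) ^ 2 := by gcongr
      _ = (n / (1 + θ)) * (s / (1 + θ)) := by field_simp
      _ ≤ Uk.card * (s / (1 + θ)) := by gcongr
      _ = ∑ y ∈ Uk, s / (1 + θ) := by rw [Finset.sum_const, nsmul_eq_mul]
      _ ≤ _ := Finset.sum_le_sum hhit
  have hpos : 0 < m * (1 + θ) := by positivity
  have h := bernProb_card_lt_le ht Uk (P := P) (fun y hy y' hy' hne =>
    bernProb_and_of_dependsOn t (dependsOn_hit E A y) (dependsOn_hit E A y')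
      (disjoint_hit hE (hUA y' hy') hne)) hθ (hpos.trans_le hμ) hμ
  have heq : ∀ ω, classPart cl (hitSet E ω A U) k = Uk.filter fun y => P y ω := by
    intro ω
    ext y
    simp only [classPart, hitSet, Finset.mem_filter, Uk, P]
    tauto
  refine le_trans (le_of_eq ?_) (h.trans ?_)
  · congr! 6
    rw [heq]
    congr!
  calc (1 + θ) ^ 2 / (θ ^ 2 * ∑ y ∈ Uk, bernProb t (P y))
      ≤ (1 + θ) ^ 2 / (θ ^ 2 * (m * (1 + θ))) := by gcongr
    _ = (1 + θ) / (θ ^ 2 * m) := by field_simp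

/-- Serves to choose the seed and to trim the newly reached sets to prescribed sizes, so that the
exploration uses up a controlled number of vertices of each class. -/
lemma exists_subset_classPart_card (cl : W → κ) (h : Finset W) (c : κ → ℕ)
    (hc : ∀ k, c k ≤ (classPart cl h k).card) :
    ∃ h' ⊆ h, ∀ k, (classPart cl h' k).card = c k := by
  choose g hg hgc using fun k => Finset.exists_subset_card_eq (hc k)
  refine ⟨Finset.univ.biUnion g, ?_, fun k => ?_⟩
  · refine Finset.biUnion_subset.mpr fun k _ => (hg k).trans (Finset.filter_subset _ _)
  · rw [← hgc k]
    congr 1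
    ext w
    simp only [mem_classPart, Finset.mem_biUnion, Finset.mem_univ, true_and]
    constructor
    · rintro ⟨⟨k', hk'⟩, hw⟩
      have := (mem_classPart.mp (hg k' hk')).2
      rw [← hw, this]
      exact hk'
    · intro hw
      exact ⟨⟨k, hw⟩, (mem_classPart.mp (hg k hw)).2⟩

lemma dependsOn_hitSet_eq (E : Sym2 W → Finset ι) (A U h : Finset W) :
    DependsOn (fun ω => hitSet E ω A U = h)
      (⋃ y ∈ U, ⋃ x ∈ A, (E s(x, y) : Set ι)) := by
  classical
  intro ω ω' hω
  have : hitSet E ω A U = hitSet E ω' A U := by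
    refine Finset.filter_congr fun y hy => ?_
    exact iff_of_eq (dependsOn_hit E A y fun i hi => hω i (Set.mem_biUnion hy hi))
  simp only [this]

lemma dependsOn_reachSet (E : Sym2 W → Finset ι) (A B : Finset W) :
    DependsOn (fun ω => reachSet E ω A B) (⋃ x ∈ B, ⋃ y ∈ B, (E s(x, y) : Set ι)) := by
  classical
  intro ω ω' hω
  have : (fun u v => u ∈ B ∧ v ∈ B ∧ OpenAdj E ω u v) =
      fun u v => u ∈ B ∧ v ∈ B ∧ OpenAdj E ω' u v := by
    funext u v
    refine propext (and_congr_right fun hu => and_congr_right fun hv =>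
      exists_congr fun i => and_congr_right fun hi => ?_)
    rw [hω i (Set.mem_biUnion hu (Set.mem_biUnion hv hi))]
  have hc : ConnIn E ω B = ConnIn E ω' B := by rw [ConnIn, ConnIn, this]
  simp only [reachSet, hc]

/-- The Markov property of the exploration: a step reveals edges between `A` and `U`, while the
later steps depend only on edges inside `U`. -/
lemma disjoint_hit_interior {E : Sym2 W → Finset ι}
    (hE : ∀ e e', e ≠ e' → Disjoint (E e) (E e')) {A U : Finset W} (hAU : Disjoint A U) :
    Disjoint (⋃ y ∈ U, ⋃ x ∈ A, (E s(x, y) : Set ι))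
      (⋃ x ∈ U, ⋃ y ∈ U, (E s(x, y) : Set ι)) := by
  simp only [Set.disjoint_iUnion_left, Set.disjoint_iUnion_right]
  intro x' hx' y' hy' y hy x hx
  refine Finset.disjoint_coe.mpr (hE _ _ fun h => ?_)
  rcases Sym2.eq_iff.mp h with ⟨h1, -⟩ | ⟨h1, -⟩ <;> subst h1 <;>
    exact Finset.disjoint_left.mp hAU ‹_› ‹_›

/-- Exploration from a set `A` with given densities in all classes: the densities grow by a factor
`1 + θ` in every step, up to the level `ρ`. -/
theorem bernProb_reachSet_small_le {E : Sym2 W → Finset ι}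
    (hE : ∀ e e', e ≠ e' → Disjoint (E e) (E e'))
    {t : ι → ℝ} (ht : ∀ i, t i ∈ Set.Icc (0 : ℝ) 1) (cl : W → κ) (d n : κ → ℝ) {θ ρ η : ℝ}
    (hθ : 0 < θ) (hρ : 0 < ρ) (hd : ∀ k, 0 < d k) (hn : ∀ k, 0 < n k) (hη : 0 ≤ η)
    (hρd : ∀ k, ρ * d k * (1 + θ) ^ 5 ≤ θ)
    (hrate : ∀ A : Finset W, ∀ x, 0 ≤ x →
      (∀ k, x * d k * n k ≤ (classPart cl A k).card) → ∀ y, y ∉ A →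
      x * (1 + θ) ^ 4 * d (cl y) ≤ ∑ u ∈ A, ∑ i ∈ E s(u, y), t i)
    (N : ℕ)
    (hηN : ∑ k, (1 + θ) ^ (N + 1) / (θ ^ 2 * (ρ * d k * n k)) ≤ η) :
    ∀ r ≤ N, ∀ A B : Finset W, A ⊆ B →
      (∀ k, ρ / (1 + θ) ^ r * d k * n k ≤ (classPart cl A k).card) →
      (∀ k, n k / (1 + θ) + ∑ i ∈ Finset.range r, (ρ / (1 + θ) ^ i * d k * n k + 1) ≤
        (classPart cl (B \ A) k).card) →
      bernProb t (fun ω => ∃ k, ((classPart cl (reachSet E ω A B) k).card : ℝ) < ρ * d k * n k) ≤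
        r * η := by
  classical
  have hθ1 : 0 < 1 + θ := by linarith
  intro r
  induction r with
  | zero =>
    intro _ A B _ hA _
    rw [Nat.cast_zero, zero_mul]
    refine le_of_eq ?_
    rw [← bernProb_false t]
    congr 1
    funext ω
    refine eq_false ?_
    rintro ⟨k, hk⟩
    have h1 := hA k
    rw [pow_zero, div_one] at h1
    have h2 : ((classPart cl A k).card : ℝ) ≤ (classPart cl (reachSet E ω A B) k).card := by
      exact_mod_cast Finset.card_le_card (classPart_mono (subset_reachSet E ω A B) k)
    linarith
  | succ r ih =>
    intro hr A B hAB hA hB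
    have hdisj : Disjoint A (B \ A) := Finset.disjoint_sdiff
    set U := B \ A with hU
    set x' : ℝ := ρ / (1 + θ) ^ r with hx'
    have hx'0 : 0 < x' := by positivity
    have hx'ρ : x' ≤ ρ := div_le_self hρ.le (one_le_pow₀ (by linarith))
    have hxx : ρ / (1 + θ) ^ (r + 1) * (1 + θ) = x' := by
      rw [hx', pow_succ]; field_simp
    have hsum0 : ∀ k, 0 ≤ ∑ i ∈ Finset.range r, (ρ / (1 + θ) ^ i * d k * n k + 1) := fun k =>
      Finset.sum_nonneg fun i _ => by
        have := hd k
        have := hn k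
        positivity
    let Suff : Finset W → Prop := fun h => ∀ k, x' * d k * n k ≤ (classPart cl h k).card
    -- The next explored set is trimmed to the target sizes, rounded up; in the insufficient case
    -- its choice is irrelevant.
    have htr : ∀ h : Finset W, ∃ h' ⊆ h, Suff h →
        ∀ k, (classPart cl h' k).card = ⌈x' * d k * n k⌉₊ := by
      intro h
      by_cases hS : Suff h
      · obtain ⟨h', hh', hc⟩ := exists_subset_classPart_card cl h
          (fun k => ⌈x' * d k * n k⌉₊) fun k => Nat.ceil_le.mpr (hS k)
        exact ⟨h', hh', fun _ => hc⟩
      · exact ⟨h, Finset.Subset.refl _, fun hS' => absurd hS' hS⟩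
    choose tr htrsub htrcard using htr
    let Bad : Finset W → Finset W → (ι → Bool) → Prop := fun A B ω =>
      ∃ k, ((classPart cl (reachSet E ω A B) k).card : ℝ) < ρ * d k * n k
    -- failure of the first step
    have hfirst : bernProb t (fun ω => ¬ Suff (hitSet E ω A U)) ≤ η := by
      have h1 : ∀ k, bernProb t (fun ω => ((classPart cl (hitSet E ω A U) k).card : ℝ) <
          x' * d k * n k) ≤ (1 + θ) ^ (N + 1) / (θ ^ 2 * (ρ * d k * n k)) := by
        intro k
        have hdk := hd k
        have hnk := hn k
        have hρk := hρd k
        have hpow : (1 + θ) ^ 5 = (1 + θ) ^ 3 * (1 + θ) * (1 + θ) := by ring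
        -- Of the factor `(1 + θ) ^ 4` in `hrate`, one power is the growth of the level to `x'`; the
        -- other three pay for the losses of a single step.
        refine (bernProb_hitSet_card_lt_le hE ht cl k hdisj (n := n k)
          (s := x' * (1 + θ) ^ 3 * d k) hθ (by positivity) ?_ ?_ ?_ (by positivity) ?_).trans ?_
        · have h2 : x' * (1 + θ) ^ 3 * d k * (1 + θ) ≤ ρ * d k * (1 + θ) ^ 5 := by
            rw [hpow]
            calc x' * (1 + θ) ^ 3 * d k * (1 + θ) ≤ ρ * (1 + θ) ^ 3 * d k * (1 + θ) := by gcongr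
              _ ≤ ρ * (1 + θ) ^ 3 * d k * (1 + θ) * (1 + θ) :=
                  le_mul_of_one_le_right (by positivity) (by linarith)
              _ = _ := by ring
          exact h2.trans hρk
        · have := hB k
          rw [Finset.sum_range_succ] at this
          have h3 : 0 ≤ ρ / (1 + θ) ^ r * d k * n k + 1 := by positivity
          linarith [hsum0 k]
        · intro y hy
          have hyU := (mem_classPart.mp hy).1
          have := hrate A (ρ / (1 + θ) ^ (r + 1)) (by positivity) hA y
            (Finset.mem_sdiff.mp hyU).2
          rw [(mem_classPart.mp hy).2] at this
          refine le_trans (le_of_eq ?_) this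
          rw [← hxx]; ring
        · exact le_of_eq (by ring)
        · rw [hx']
          have h4 : (1 + θ) / (θ ^ 2 * (ρ / (1 + θ) ^ r * d k * n k)) =
              (1 + θ) ^ (r + 1) / (θ ^ 2 * (ρ * d k * n k)) := by
            field_simp
            ring
          rw [h4]
          gcongr
          · linarith
          · omega
      refine le_trans ?_ hηN
      refine le_trans ?_ (Finset.sum_le_sum fun k _ => h1 k)
      refine le_trans (bernProb_mono ht fun ω hω => ?_)
        (bernProb_exists_le ht Finset.univ fun k ω =>
          ((classPart cl (hitSet E ω A U) k).card : ℝ) < x' * d k * n k)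
      simp only [Suff, not_forall, not_le] at hω
      obtain ⟨k, hk⟩ := hω
      exact ⟨k, Finset.mem_univ k, hk⟩
    -- failure after a successful first step
    have hsecond : bernProb t (fun ω => ∃ h ∈ U.powerset,
        hitSet E ω A U = h ∧ (Suff h ∧ Bad (tr h) U ω)) ≤ r * η := by
      refine (bernProb_exists_le ht _ _).trans ?_
      have h1 : ∀ h ∈ U.powerset, bernProb t (fun ω => hitSet E ω A U = h ∧
          (Suff h ∧ Bad (tr h) U ω)) ≤ bernProb t (fun ω => hitSet E ω A U = h) * (r * η) := by
        intro h hh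
        -- Conditioning on the set `h` that is hit: what happens inside `U` is independent of it,
        -- and the probabilities of the values of `h` sum to at most one.
        rw [bernProb_and_of_dependsOn t (dependsOn_hitSet_eq E A U h)
          (T := ⋃ x ∈ U, ⋃ y ∈ U, (E s(x, y) : Set ι))
          (fun ω ω' hω => by
            have := dependsOn_reachSet E (tr h) U hω
            simp only at this
            simp only [Bad, this])
          (disjoint_hit_interior hE hdisj)]
        refine mul_le_mul_of_nonneg_left ?_ (bernProb_nonneg ht _)
        by_cases hS : Suff h
        swap
        · simp only [hS, false_and]
          rw [bernProb_false]; positivity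
        have hsub : tr h ⊆ U := (htrsub h).trans (Finset.mem_powerset.mp hh)
        refine (bernProb_mono ht fun ω hω => hω.2).trans
          (ih (by omega) (tr h) U hsub (fun k => ?_) fun k => ?_)
        · rw [htrcard h hS k]
          exact Nat.le_ceil _
        · have hsd : classPart cl (U \ tr h) k = classPart cl U k \ classPart cl (tr h) k := by
            ext w
            simp only [mem_classPart, Finset.mem_sdiff]
            tauto
          have h2 := Finset.card_sdiff_add_card_eq_card (classPart_mono (cl := cl) hsub k)
          rw [← hsd, htrcard h hS k] at h2
          have h3 : ((classPart cl (U \ tr h) k).card : ℝ) + ⌈x' * d k * n k⌉₊ =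
              (classPart cl U k).card := by exact_mod_cast h2
          -- The trimmed set uses at most `x' * d k * n k + 1` vertices of the class, which is the
          -- last summand of the budget in `hB`.
          have h4 := hB k
          rw [Finset.sum_range_succ] at h4
          have hdk := hd k
          have hnk := hn k
          have h5 := (Nat.ceil_lt_add_one (a := x' * d k * n k) (by positivity)).le
          linarith
      refine (Finset.sum_le_sum h1).trans ?_
      rw [← Finset.sum_mul]
      refine mul_le_of_le_one_left (by positivity) ?_
      simp only [bernProb_eq]
      rw [← bernMean_sum]
      refine (bernMean_mono ht (g := fun _ => 1) fun ω => ?_).trans (bernMean_const t 1).le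
      rw [Finset.sum_ite_eq]
      split_ifs
      exacts [le_rfl, zero_le_one]
    calc bernProb t (Bad A B)
        ≤ bernProb t (fun ω => ¬ Suff (hitSet E ω A U) ∨ ∃ h ∈ U.powerset,
            hitSet E ω A U = h ∧ (Suff h ∧ Bad (tr h) U ω)) := by
          refine bernProb_mono ht fun ω hω => ?_
          by_cases hS : Suff (hitSet E ω A U)
          · refine Or.inr ⟨_, Finset.mem_powerset.mpr (Finset.filter_subset _ _), rfl, hS, ?_⟩
            obtain ⟨k, hk⟩ := hω
            refine ⟨k, lt_of_le_of_lt ?_ hk⟩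
            exact_mod_cast Finset.card_le_card (classPart_mono
              (reachSet_subset_reachSet E ω hAB (htrsub _)) k)
          · exact Or.inl hS
      _ ≤ η + r * η := (bernProb_or_le ht _ _).trans (add_le_add hfirst hsecond)
      _ = ((r + 1 : ℕ) : ℝ) * η := by push_cast; ring

end Exploration

/-! ### Large clusters and their merging by sprinkling -/

section Clusters

variable {W : Type*} [Fintype W] [DecidableEq W]

open Classical in
/-- The equivalence class of `x` as a finite set. -/
def classFinset (r : W → W → Prop) (x : W) : Finset W := Finset.univ.filter fun y => r x y

lemma mem_classFinset {r : W → W → Prop} {x y : W} : y ∈ classFinset r x ↔ r x y := by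
  classical
  simp [classFinset]

lemma classFinset_eq {r : W → W → Prop} (hr : Equivalence r) {x y : W} (h : r x y) :
    classFinset r x = classFinset r y := by
  ext z
  rw [mem_classFinset, mem_classFinset]
  exact ⟨fun h' => hr.trans (hr.symm h) h', fun h' => hr.trans h h'⟩

/-- Vertices that are related to `A` mostly lie in large classes. -/
lemma card_le_card_large_add {r : W → W → Prop} (hr : Equivalence r) (A X : Finset W) (K : ℕ)
    (hX : ∀ y ∈ X, ∃ a ∈ A, r a y) :
    X.card ≤ (X.filter fun y => K ≤ (classFinset r y).card).card + K * A.card := by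
  classical
  rw [← Finset.card_filter_add_card_filter_not (s := X) (fun y => K ≤ (classFinset r y).card)]
  refine Nat.add_le_add_left ?_ _
  -- The small classes that are met contain a point of `A`, so there are at most `A.card` of them.
  have hsub : (X.filter fun y => ¬ K ≤ (classFinset r y).card) ⊆
      (A.filter fun a => (classFinset r a).card ≤ K).biUnion (classFinset r) := by
    intro y hy
    obtain ⟨hyX, hyK⟩ := Finset.mem_filter.mp hy
    obtain ⟨a, ha, hay⟩ := hX y hyX
    refine Finset.mem_biUnion.mpr ⟨a, Finset.mem_filter.mpr ⟨ha, ?_⟩, mem_classFinset.mpr hay⟩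
    rw [classFinset_eq hr hay]
    omega
  refine (Finset.card_le_card hsub).trans ((Finset.card_biUnion_le_card_mul _ _ K ?_).trans ?_)
  · intro a ha
    exact (Finset.mem_filter.mp ha).2
  · rw [mul_comm]
    exact Nat.mul_le_mul_left K (Finset.card_filter_le _ _)

/-- The classes with at least `K` elements. -/
def largeClasses (r : W → W → Prop) (K : ℕ) : Finset (Finset W) :=
  (Finset.univ.image (classFinset r)).filter fun c => K ≤ c.card

/-- Distinct classes are disjoint. The bound controls the entropy of the union bound in the
sprinkling argument. -/
lemma card_largeClasses_mul_le {r : W → W → Prop} (hr : Equivalence r) (K : ℕ) :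
    (largeClasses r K).card * K ≤ Fintype.card W := by
  classical
  have hdisj : ((largeClasses r K : Finset (Finset W)) : Set (Finset W)).PairwiseDisjoint id := by
    intro c hc c' hc' hne
    rw [Finset.mem_coe] at hc hc'
    obtain ⟨x, -, rfl⟩ := Finset.mem_image.mp (Finset.mem_filter.mp hc).1
    obtain ⟨y, -, rfl⟩ := Finset.mem_image.mp (Finset.mem_filter.mp hc').1
    refine Finset.disjoint_left.mpr fun z hz hz' => hne ?_
    simp only [id, mem_classFinset] at hz hz'
    exact (classFinset_eq hr hz).trans (classFinset_eq hr hz').symm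
  calc (largeClasses r K).card * K ≤ ∑ c ∈ largeClasses r K, c.card := by
        rw [← smul_eq_mul]
        exact Finset.card_nsmul_le_sum _ _ _ fun c hc => (Finset.mem_filter.mp hc).2
    _ = ((largeClasses r K).biUnion id).card := (Finset.card_biUnion hdisj).symm
    _ ≤ Fintype.card W := Finset.card_le_univ _

/-- Disjointness of `X` and `Y` makes the unordered pairs distinct, so there are `X.card * Y.card`
independent chances. -/
lemma bernProb_no_edge_between_le {t : Sym2 W → ℝ} (ht : ∀ e, t e ∈ Set.Icc (0 : ℝ) 1)
    {X Y : Finset W} (hXY : Disjoint X Y) {p : ℝ}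
    (hp : ∀ x ∈ X, ∀ y ∈ Y, p ≤ t s(x, y)) :
    bernProb t (fun ω => ∀ x ∈ X, ∀ y ∈ Y, ω s(x, y) = false) ≤
      Real.exp (-(p * X.card * Y.card)) := by
  classical
  set S : Finset (Sym2 W) := (X ×ˢ Y).image fun q => s(q.1, q.2) with hS
  have hinj : Set.InjOn (fun q : W × W => s(q.1, q.2)) (X ×ˢ Y : Finset (W × W)) := by
    rintro ⟨x, y⟩ hq ⟨x', y'⟩ hq' h
    rw [Finset.mem_coe, Finset.mem_product] at hq hq'
    rcases Sym2.eq_iff.mp h with ⟨h1, h2⟩ | ⟨h1, h2⟩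
    · exact Prod.ext h1 h2
    · exact absurd hq'.2 (Finset.disjoint_left.mp hXY (h1 ▸ hq.1))
  refine (bernProb_mono ht fun ω hω i hi => ?_).trans ((bernProb_forall_closed_le ht S).trans ?_)
  · obtain ⟨⟨x, y⟩, hq, rfl⟩ := Finset.mem_image.mp hi
    rw [Finset.mem_product] at hq
    exact hω x hq.1 y hq.2
  · refine Real.exp_le_exp.mpr (neg_le_neg ?_)
    rw [hS, Finset.sum_image hinj]
    calc p * X.card * Y.card = ∑ q ∈ X ×ˢ Y, p := by
          rw [Finset.sum_const, Finset.card_product, nsmul_eq_mul]; push_cast; ring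
      _ ≤ _ := Finset.sum_le_sum fun q hq => by
          rw [Finset.mem_product] at hq
          exact hp q.1 hq.1 q.2 hq.2

/-- The relation generated by `r` and the open edges of `ω`. -/
def SprinkledConn (r : W → W → Prop) (ω : Sym2 W → Bool) : W → W → Prop :=
  Relation.EqvGen fun x y => r x y ∨ ω s(x, y) = true

/-- A set met in moderate proportion by a union of classes, unless one class is large. -/
lemma exists_saturated_of_small_classes {q : W → W → Prop} (hq : Equivalence q) (D : Finset W)
    {m : ℝ} (hm : 0 < m) (hD : m ≤ D.card)
    (hsmall : ∀ x, ((D ∩ classFinset q x).card : ℝ) < m / 3) :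
    ∃ S : Finset W, (∀ x y, q x y → (x ∈ S ↔ y ∈ S)) ∧
      m / 3 ≤ (D ∩ S).card ∧ m / 3 ≤ (D \ S).card := by
  classical
  let sat : Finset W → Finset W := fun T => T.biUnion (classFinset q)
  have hsat : ∀ T x y, q x y → (x ∈ sat T ↔ y ∈ sat T) := by
    intro T x y h
    simp only [sat, Finset.mem_biUnion, mem_classFinset]
    exact exists_congr fun a => and_congr_right fun _ =>
      ⟨fun h' => hq.trans h' h, fun h' => hq.trans h' (hq.symm h)⟩
  let good : Finset (Finset W) := Finset.univ.filter fun T => m / 3 ≤ (D ∩ sat T).card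
  have hne : good.Nonempty := by
    refine ⟨D, Finset.mem_filter.mpr ⟨Finset.mem_univ _, ?_⟩⟩
    have : D ∩ sat D = D := Finset.inter_eq_left.mpr fun x hx =>
      Finset.mem_biUnion.mpr ⟨x, hx, mem_classFinset.mpr (hq.refl x)⟩
    rw [this]
    linarith
  -- By minimality, `T` without one point saturates less than `m / 3` of `D`, and the class of that
  -- point adds less than `m / 3`; at least `m / 3` of `D` is left out.
  obtain ⟨T, hT, hmin⟩ := Finset.exists_min_image good Finset.card hne
  have hT1 : m / 3 ≤ (D ∩ sat T).card := (Finset.mem_filter.mp hT).2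
  have hTne : T.Nonempty := by
    rw [Finset.nonempty_iff_ne_empty]
    rintro rfl
    simp only [sat, Finset.biUnion_empty, Finset.inter_empty, Finset.card_empty,
      Nat.cast_zero] at hT1
    linarith
  obtain ⟨x, hx⟩ := hTne
  have hlt : ((D ∩ sat (T.erase x)).card : ℝ) < m / 3 := by
    by_contra hge
    have h1 := hmin (T.erase x) (Finset.mem_filter.mpr ⟨Finset.mem_univ _, not_lt.mp hge⟩)
    have h2 := Finset.card_erase_lt_of_mem hx
    omega
  have hsub : D ∩ sat T ⊆ (D ∩ sat (T.erase x)) ∪ (D ∩ classFinset q x) := by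
    intro y hy
    obtain ⟨hyD, hyT⟩ := Finset.mem_inter.mp hy
    obtain ⟨a, ha, hya⟩ := Finset.mem_biUnion.mp hyT
    by_cases hax : a = x
    · subst hax
      exact Finset.mem_union_right _ (Finset.mem_inter.mpr ⟨hyD, hya⟩)
    · exact Finset.mem_union_left _ (Finset.mem_inter.mpr ⟨hyD, Finset.mem_biUnion.mpr
        ⟨a, Finset.mem_erase.mpr ⟨hax, ha⟩, hya⟩⟩)
  have hcard : ((D ∩ sat T).card : ℝ) ≤
      (D ∩ sat (T.erase x)).card + (D ∩ classFinset q x).card := by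
    exact_mod_cast (Finset.card_le_card hsub).trans (Finset.card_union_le _ _)
  have hsd : ((D \ sat T).card : ℝ) + (D ∩ sat T).card = D.card := by
    exact_mod_cast Finset.card_sdiff_add_card_inter D (sat T)
  refine ⟨sat T, hsat T, hT1, ?_⟩
  have := hsmall x
  linarith

/-- Sprinkling: if the sets `D j` consist of vertices in large classes, then adding a few random
edges within each `D j` and between successive ones creates a class with a positive proportion of
all of them. -/
theorem bernProb_sprinkling_fails_le {r : W → W → Prop} (hr : Equivalence r) {R K M : ℕ}
    (D : ℕ → Finset W) {m p : ℝ} (hm : 0 < m) (hp : 0 ≤ p) (hR : 0 < R)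
    (hDK : ∀ j < R, ∀ x ∈ D j, K ≤ (classFinset r x).card)
    (hM : (largeClasses r K).card ≤ M)
    (hDm : ∀ j < R, m ≤ (D j).card)
    {t : Sym2 W → ℝ} (ht : ∀ e, t e ∈ Set.Icc (0 : ℝ) 1)
    (htp : ∀ j < R, ∀ x ∈ D j, ∀ y, y ∈ D j ∨ (j + 1 < R ∧ y ∈ D (j + 1)) → x ≠ y →
      p ≤ t s(x, y)) :
    bernProb t (fun ω => ¬ ∃ C : Finset W, (∀ x ∈ C, ∀ y ∈ C, SprinkledConn r ω x y) ∧
      ∀ j < R, m / 3 ≤ (C ∩ D j).card) ≤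
      2 ^ M * (2 * R) * Real.exp (-(p * (m / 3) ^ 2)) := by
  classical
  set L := largeClasses r K
  let U : Finset (Finset W) → Finset W := fun F => F.biUnion id
  let pairs : Finset (ℕ × ℕ) := (Finset.range R).image (fun j => (j, j)) ∪
    (Finset.range (R - 1)).image (fun j => (j, j + 1))
  have hpairs : (pairs.card : ℝ) ≤ 2 * R := by
    have h1 : pairs.card ≤ 2 * R := by
      refine (Finset.card_union_le _ _).trans ?_
      have h2 := Finset.card_image_le (s := Finset.range R) (f := fun j => (j, j))
      have h3 := Finset.card_image_le (s := Finset.range (R - 1)) (f := fun j => (j, j + 1))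
      rw [Finset.card_range] at h2 h3
      omega
    exact_mod_cast h1
  -- Sprinkling fails only if some union of large classes separates a third of `D j` from a third of
  -- `D j` or `D (j + 1)`. There are at most `2 ^ M` unions and `2 * R` pairs of indices.
  let Bad : Finset (Finset W) × (ℕ × ℕ) → (Sym2 W → Bool) → Prop := fun a ω =>
    (m / 3 ≤ (D a.2.1 ∩ U a.1).card ∧ m / 3 ≤ (D a.2.2 \ U a.1).card) ∧
      ∀ x ∈ D a.2.1 ∩ U a.1, ∀ y ∈ D a.2.2 \ U a.1, ω s(x, y) = false
  have hmem_pairs : ∀ q ∈ pairs, q.1 < R ∧ (q.2 = q.1 ∨ (q.1 + 1 < R ∧ q.2 = q.1 + 1)) := by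
    intro q hq
    rcases Finset.mem_union.mp hq with h | h
    · obtain ⟨j, hj, rfl⟩ := Finset.mem_image.mp h
      exact ⟨Finset.mem_range.mp hj, Or.inl rfl⟩
    · obtain ⟨j, hj, rfl⟩ := Finset.mem_image.mp h
      rw [Finset.mem_range] at hj
      exact ⟨by dsimp only; omega, Or.inr ⟨by dsimp only; omega, rfl⟩⟩
  have hbad : ∀ a ∈ L.powerset ×ˢ pairs, bernProb t (Bad a) ≤ Real.exp (-(p * (m / 3) ^ 2)) := by
    rintro ⟨F, q⟩ ha
    have hq := hmem_pairs q (Finset.mem_product.mp ha).2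
    by_cases h : m / 3 ≤ (D q.1 ∩ U F).card ∧ m / 3 ≤ (D q.2 \ U F).card
    · refine (bernProb_mono ht fun ω hω => hω.2).trans
        ((bernProb_no_edge_between_le ht (X := D q.1 ∩ U F) (Y := D q.2 \ U F) (p := p)
          ?_ ?_).trans ?_)
      · exact Finset.disjoint_left.mpr fun x hx hx' =>
          (Finset.mem_sdiff.mp hx').2 (Finset.mem_inter.mp hx).2
      · intro x hx y hy
        have hxD := (Finset.mem_inter.mp hx).1
        have hyD := (Finset.mem_sdiff.mp hy).1
        refine htp q.1 hq.1 x hxD y ?_ ?_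
        · rcases hq.2 with h' | ⟨h', h''⟩
          · exact Or.inl (h' ▸ hyD)
          · exact Or.inr ⟨h', h'' ▸ hyD⟩
        · rintro rfl
          exact (Finset.mem_sdiff.mp hy).2 (Finset.mem_inter.mp hx).2
      · refine Real.exp_le_exp.mpr (neg_le_neg ?_)
        have hm3 : 0 ≤ m / 3 := by positivity
        calc p * (m / 3) ^ 2 = p * (m / 3) * (m / 3) := by ring
          _ ≤ p * (D q.1 ∩ U F).card * (D q.2 \ U F).card := by
            gcongr
            exacts [h.1, h.2]
    · have : ∀ ω, Bad (F, q) ω → False := fun ω hω => h hω.1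
      refine (bernProb_mono ht this).trans ?_
      rw [bernProb_false]
      exact (Real.exp_pos _).le
  have hunion : bernProb t (fun ω => ∃ a ∈ L.powerset ×ˢ pairs, Bad a ω) ≤
      2 ^ M * (2 * R) * Real.exp (-(p * (m / 3) ^ 2)) := by
    refine (bernProb_exists_le ht _ _).trans ((Finset.sum_le_sum hbad).trans ?_)
    rw [Finset.sum_const, nsmul_eq_mul, Finset.card_product, Finset.card_powerset]
    push_cast
    gcongr
    · norm_num
  refine (bernProb_mono ht fun ω hω => ?_).trans hunion
  by_contra hno
  push Not at hno
  apply hω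
  set q := SprinkledConn r ω with hqdef
  have hq : Equivalence q := Relation.EqvGen.is_equivalence _
  have hrq : ∀ x y, r x y → q x y := fun x y h => Relation.EqvGen.rel _ _ (Or.inl h)
  have hωq : ∀ x y, ω s(x, y) = true → q x y := fun x y h => Relation.EqvGen.rel _ _ (Or.inr h)
  -- saturated sets are not separated
  have hsep : ∀ S : Finset W, (∀ x y, q x y → (x ∈ S ↔ y ∈ S)) → ∀ j j', (j, j') ∈ pairs →
      m / 3 ≤ (D j ∩ S).card → m / 3 ≤ (D j' \ S).card → False := by
    intro S hS j j' hjj h1 h2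
    have hpq := hmem_pairs _ hjj
    have hj : j < R := hpq.1
    have hj' : j' < R := by
      rcases hpq.2 with h | ⟨h, h'⟩
      · dsimp only at h; omega
      · dsimp only at h h'; omega
    -- Every point of the sets `D i` lies in a large class of `r`, and `S` is a union of such
    -- classes and others; on the sets `D i` it therefore agrees with `U F`.
    let F := L.filter fun c => c ⊆ S
    have hUS : ∀ i < R, ∀ x ∈ D i, x ∈ U F ↔ x ∈ S := by
      intro i hi x hx
      simp only [U, F, Finset.mem_biUnion, Finset.mem_filter, id]
      constructor
      · rintro ⟨c, ⟨-, hc⟩, hxc⟩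
        exact hc hxc
      · intro hxS
        refine ⟨classFinset r x, ⟨Finset.mem_filter.mpr
          ⟨Finset.mem_image_of_mem _ (Finset.mem_univ x), hDK i hi x hx⟩, fun y hy => ?_⟩,
          mem_classFinset.mpr (hr.refl x)⟩
        exact (hS x y (hrq x y (mem_classFinset.mp hy))).mp hxS
    have e1 : D j ∩ U F = D j ∩ S := by
      ext x
      simp only [Finset.mem_inter]
      exact and_congr_right fun hx => hUS j hj x hx
    have e2 : D j' \ U F = D j' \ S := by
      ext x
      simp only [Finset.mem_sdiff]
      exact and_congr_right fun hx => not_congr (hUS j' hj' x hx)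
    refine hno (F, (j, j')) (Finset.mem_product.mpr
      ⟨Finset.mem_powerset.mpr (Finset.filter_subset _ _), hjj⟩) ⟨⟨?_, ?_⟩, ?_⟩
    · dsimp only; rw [e1]; exact h1
    · dsimp only; rw [e2]; exact h2
    · dsimp only
      rw [e1, e2]
      intro x hx y hy
      by_contra hne
      have hxy := hωq x y (by simpa using hne)
      exact (Finset.mem_sdiff.mp hy).2 ((hS x y hxy).mp (Finset.mem_inter.mp hx).2)
  have hlarge : ∀ j < R, ∃ x, m / 3 ≤ (D j ∩ classFinset q x).card := by
    intro j hj
    by_contra hcon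
    push Not at hcon
    obtain ⟨S, hS, h1, h2⟩ := exists_saturated_of_small_classes hq (D j) hm (hDm j hj) hcon
    exact hsep S hS j j (Finset.mem_union_left _ (Finset.mem_image.mpr
      ⟨j, Finset.mem_range.mpr hj, rfl⟩)) h1 h2
  obtain ⟨x₀, hx₀⟩ := hlarge 0 hR
  refine ⟨classFinset q x₀, fun x hx y hy => hq.trans (hq.symm (mem_classFinset.mp hx))
    (mem_classFinset.mp hy), ?_⟩
  intro j
  rw [Finset.inter_comm]
  induction j with
  | zero => exact fun _ => hx₀
  | succ j ih =>
    intro hj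
    have hprev := ih (by omega)
    rw [Finset.inter_comm] at hprev ⊢
    obtain ⟨x, hx⟩ := hlarge (j + 1) hj
    by_cases hxx : q x₀ x
    · rwa [classFinset_eq hq hxx, Finset.inter_comm]
    · exfalso
      -- If the class that is large in `D (j + 1)` were a different one, the class of `x₀` would
      -- separate `D j` from `D (j + 1)`.
      refine hsep (classFinset q x₀) (fun a b hab => ?_) j (j + 1) (Finset.mem_union_right _
        (Finset.mem_image.mpr ⟨j, Finset.mem_range.mpr (by omega), rfl⟩)) ?_ ?_
      · rw [mem_classFinset, mem_classFinset]
        exact ⟨fun h => hq.trans h hab, fun h => hq.trans h (hq.symm hab)⟩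
      · rwa [Finset.inter_comm]
      · refine hx.trans ?_
        have hsub : D (j + 1) ∩ classFinset q x ⊆ D (j + 1) \ classFinset q x₀ := by
          intro y hy
          obtain ⟨hyD, hyx⟩ := Finset.mem_inter.mp hy
          refine Finset.mem_sdiff.mpr ⟨hyD, fun hy' => hxx ?_⟩
          exact hq.trans (mem_classFinset.mp hy') (hq.symm (mem_classFinset.mp hyx))
        exact_mod_cast Finset.card_le_card hsub

end Clusters

/-! ### The column graph of a brick and its supercritical growth -/

section Brick

/-- The columns of a brick, arranged in `R` blocks of length `b`. -/
abbrev Col (R b : ℕ) : Type := Fin R × Fin b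

variable {R b : ℕ}

open Classical in
/-- The edges available between two columns: the one in the bottom layer and, if both columns are
vertically connected, the one in the top layer. -/
def colEdges (T : Finset (Col R b)) (e : Sym2 (Col R b)) : Finset (Sym2 (Col R b) × Bool) :=
  if ∀ x ∈ e, x ∈ T then {(e, false), (e, true)} else {(e, false)}

lemma fst_of_mem_colEdges {T : Finset (Col R b)} {e : Sym2 (Col R b)}
    {i : Sym2 (Col R b) × Bool} (hi : i ∈ colEdges T e) : i.1 = e := by
  classical
  rw [colEdges] at hi
  split_ifs at hi
  · rcases Finset.mem_insert.mp hi with h | h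
    · rw [h]
    · rw [Finset.mem_singleton.mp h]
  · rw [Finset.mem_singleton.mp hi]

lemma disjoint_colEdges (T : Finset (Col R b)) (e e' : Sym2 (Col R b)) (h : e ≠ e') :
    Disjoint (colEdges T e) (colEdges T e') :=
  Finset.disjoint_left.mpr fun _ hi hi' =>
    h ((fst_of_mem_colEdges hi).symm.trans (fst_of_mem_colEdges hi'))

lemma equivalence_connIn_univ {W ι : Type*} [Fintype W] (E : Sym2 W → Finset ι)
    (ω : ι → Bool) : Equivalence (ConnIn E ω Finset.univ) where
  refl _ := Relation.ReflTransGen.refl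
  symm h := by
    induction h with
    | refl => exact Relation.ReflTransGen.refl
    | tail _ h ih =>
      refine Relation.ReflTransGen.head ⟨Finset.mem_univ _, Finset.mem_univ _, ?_⟩ ih
      obtain ⟨i, hi, hω⟩ := h.2.2
      exact ⟨i, Sym2.eq_swap ▸ hi, hω⟩
  trans h h' := h.trans h'

/-- The class of a column: its block and whether it belongs to `T`. -/
def colClass (T : Finset (Col R b)) (x : Col R b) : Fin R × Bool := (x.1, decide (x ∈ T))

lemma card_filter_block (j : Fin R) :
    (Finset.univ.filter fun x : Col R b => x.1 = j).card = b := by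
  have : (Finset.univ.filter fun x : Col R b => x.1 = j) = {j} ×ˢ Finset.univ := by
    ext x
    rw [Finset.mem_filter, Finset.mem_product, Finset.mem_singleton]
    exact ⟨fun h => ⟨h.2, Finset.mem_univ _⟩, fun h => ⟨Finset.mem_univ _, h.1⟩⟩
  rw [this, Finset.card_product, Finset.card_singleton, Finset.card_univ, Fintype.card_fin,
    one_mul]

lemma card_classPart_colClass (T : Finset (Col R b)) {NT : ℕ}
    (hT : ∀ j, (T.filter fun x => x.1 = j).card = NT) (k : Fin R × Bool) :
    (classPart (colClass T) Finset.univ k).card = if k.2 then NT else b - NT := by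
  obtain ⟨j, β⟩ := k
  have htrue : (classPart (colClass T) Finset.univ (j, true)).card = NT := by
    rw [← hT j]
    congr 1
    ext x
    simp [classPart, colClass, and_comm]
  cases β
  · have hsplit : classPart (colClass T) Finset.univ (j, false) =
        (Finset.univ.filter fun x : Col R b => x.1 = j) \
          classPart (colClass T) Finset.univ (j, true) := by
      ext x
      simp only [classPart, colClass, Finset.mem_filter, Finset.mem_univ, true_and,
        Prod.mk.injEq, decide_eq_false_iff_not, Finset.mem_sdiff, decide_eq_true_eq]
      tauto
    rw [hsplit, Finset.card_sdiff_of_subset, card_filter_block, htrue]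
    · simp
    · intro x hx
      simp only [classPart, colClass, Finset.mem_filter, Finset.mem_univ, true_and,
        Prod.mk.injEq] at hx ⊢
      exact hx.1
  · simpa using htrue

lemma colEdges_rate {T : Finset (Col R b)} {p : Sym2 (Col R b) × Bool → ℝ} {c : ℝ}
    {x y : Col R b} (hp : ∀ β, c ≤ p (s(x, y), β)) :
    (if x ∈ T ∧ y ∈ T then 2 else 1) * c ≤ ∑ i ∈ colEdges T s(x, y), p i := by
  classical
  have h0 := hp false
  have h1 := hp true
  have hiff : (∀ z ∈ s(x, y), z ∈ T) ↔ (x ∈ T ∧ y ∈ T) := by simp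
  by_cases h : x ∈ T ∧ y ∈ T
  · rw [if_pos h, colEdges, if_pos (hiff.mpr h), Finset.sum_pair (by simp)]
    linarith
  · rw [if_neg h, colEdges, if_neg (fun h' => h (hiff.mp h')), Finset.sum_singleton]
    linarith

/-- The growth rates of the column graph. -/
lemma colEdges_growth (T : Finset (Col R b)) {NT : ℕ} (hb : 0 < b) {τ θ δ : ℝ} (hτ : 0 < τ)
    (hτ1 : τ ≤ 1) (hNT : τ * b ≤ NT)
    (hδ : (1 + θ) ^ 4 ≤ (1 - δ) * (1 + τ ^ 2 / 2)) (hδ1 : δ < 1)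
    {ν : Fin R → ℝ} (hν : ∀ j, 0 ≤ ν j) {g : Fin R → Fin R → ℝ} (hg : ∀ j j', 0 ≤ g j j')
    (hgν : ∀ j', (1 - δ) * ν j' ≤ ∑ j, g j j' * ν j)
    {p : Sym2 (Col R b) × Bool → ℝ}
    (hp : ∀ x y : Col R b, x ≠ y → ∀ β, g x.1 y.1 / b ≤ p (s(x, y), β))
    (A : Finset (Col R b)) {a : ℝ} (ha : 0 ≤ a)
    (hA : ∀ k : Fin R × Bool, a * (ν k.1 * if k.2 then 1 + τ / 2 else 1) *
      (if k.2 then (NT : ℝ) else b - NT) ≤ (classPart (colClass T) A k).card)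
    {y : Col R b} (hy : y ∉ A) :
    a * (1 + θ) ^ 4 * (ν y.1 * if y ∈ T then 1 + τ / 2 else 1) ≤
      ∑ u ∈ A, ∑ i ∈ colEdges T s(u, y), p i := by
  have hb' : (0 : ℝ) < b := by exact_mod_cast hb
  set cy : ℝ := if y ∈ T then 2 else 1 with hcy
  have hcy1 : 1 ≤ cy := by rw [hcy]; split_ifs <;> norm_num
  have h1 : ∀ k : Fin R × Bool, ((classPart (colClass T) A k).card : ℝ) *
      ((if k.2 then cy else 1) * (g k.1 y.1 / b)) ≤
      ∑ u ∈ A with colClass T u = k, ∑ i ∈ colEdges T s(u, y), p i := by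
    intro k
    rw [← nsmul_eq_mul]
    refine Finset.card_nsmul_le_sum _ _ _ fun u hu => ?_
    obtain ⟨huA, huk⟩ := mem_classPart.mp hu
    have huy : u ≠ y := fun h => hy (h ▸ huA)
    have h2 := colEdges_rate (T := T) (hp u y huy)
    have hk1 : u.1 = k.1 := by rw [← huk]; rfl
    have hk2 : decide (u ∈ T) = k.2 := by rw [← huk]; rfl
    rw [hk1] at h2
    refine le_trans (le_of_eq ?_) h2
    congr 1
    rw [← hk2, hcy]
    by_cases hu : u ∈ T <;> by_cases hy : y ∈ T <;> simp [hu, hy]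
  have h3 : ∑ u ∈ A, ∑ i ∈ colEdges T s(u, y), p i =
      ∑ k : Fin R × Bool, ∑ u ∈ A with colClass T u = k, ∑ i ∈ colEdges T s(u, y), p i :=
    (Finset.sum_fiberwise A (colClass T) _).symm
  rw [h3]
  refine le_trans ?_ (Finset.sum_le_sum fun k _ => h1 k)
  set τ' : ℝ := NT / b with hτ'
  have hττ : τ ≤ τ' := by rw [hτ', le_div_iff₀ hb']; exact hNT
  -- The total rate towards `y`, with weight `1 + τ / 2` on the fraction `τ'` of columns in `T`;
  -- these count twice if `y` is in `T` as well.
  set q : ℝ := (1 + τ / 2) * τ' * cy + (1 - τ') with hq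
  have h4 : ∀ j : Fin R, a * q * (g j y.1 * ν j) ≤
      ∑ β : Bool, ((classPart (colClass T) A (j, β)).card : ℝ) *
      ((if β then cy else 1) * (g j y.1 / b)) := by
    intro j
    have hgb : 0 ≤ g j y.1 / b := div_nonneg (hg _ _) hb'.le
    have ht := mul_le_mul_of_nonneg_right (hA (j, true))
      (mul_nonneg (zero_le_one.trans hcy1) hgb)
    have hf := mul_le_mul_of_nonneg_right (hA (j, false)) hgb
    simp only [if_true, Bool.false_eq_true, if_false, mul_one] at ht hf
    rw [Fintype.sum_bool]
    simp only [if_true, Bool.false_eq_true, if_false, one_mul]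
    refine le_trans (le_of_eq ?_) (add_le_add ht hf)
    rw [hq, hτ']
    field_simp
  rw [Fintype.sum_prod_type]
  refine le_trans ?_ (Finset.sum_le_sum fun j _ => h4 j)
  rw [← Finset.mul_sum]
  -- The weights `1 + τ / 2` on `T` and `1` off `T` are multiplied by at least `1 + τ ^ 2 / 2`. This
  -- is the whole gain over the critical single layer.
  have hq' : (1 + τ ^ 2 / 2) * (if y ∈ T then 1 + τ / 2 else 1) ≤ q := by
    rw [hq, hcy]
    split_ifs
    · nlinarith
    · nlinarith
  have hδ0 : 0 < 1 - δ := by linarith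
  have hm0 : (0 : ℝ) ≤ if y ∈ T then 1 + τ / 2 else 1 := by split_ifs <;> positivity
  have hq0 : 0 ≤ q := le_trans (mul_nonneg (by positivity) hm0) hq'
  calc a * (1 + θ) ^ 4 * (ν y.1 * if y ∈ T then 1 + τ / 2 else 1)
      ≤ a * ((1 - δ) * (1 + τ ^ 2 / 2)) * (ν y.1 * if y ∈ T then 1 + τ / 2 else 1) := by
        have := hν y.1
        gcongr
    _ = a * ((1 + τ ^ 2 / 2) * (if y ∈ T then 1 + τ / 2 else 1)) * ((1 - δ) * ν y.1) := by ring
    _ ≤ a * q * ∑ j, g j y.1 * ν j := by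
        have := hν y.1
        gcongr
        exact hgν y.1

/-- The number of vertices used by the whole exploration: the geometric series and the rounding
errors each take at most half of `n * (θ / (1 + θ))`, so at least `n / (1 + θ)` vertices stay
unexplored. -/
lemma geometric_budget_le {θ ρ d n : ℝ} (N : ℕ) (hθ : 0 < θ) (hρ : 0 ≤ ρ) (hd : 0 ≤ d)
    (hn : 0 < n) (hρd : ρ * d * (1 + θ) ^ 5 ≤ θ ^ 2 / 2)
    (hN : (N + 1 : ℝ) * (2 * (1 + θ)) ≤ θ * n) :
    ∑ i ∈ Finset.range (N + 1), (ρ / (1 + θ) ^ i * d * n + 1) ≤ n * (θ / (1 + θ)) := by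
  have hθ1' : 0 < 1 + θ := by linarith
  have hgeo : ∑ i ∈ Finset.range (N + 1), (1 / (1 + θ)) ^ i ≤ (1 + θ) / θ := by
    have hx : 1 / (1 + θ) < 1 := by rw [div_lt_one hθ1']; linarith
    rw [geom_sum_eq hx.ne, ← neg_div_neg_eq]
    have e : -(1 / (1 + θ) - 1) = θ / (1 + θ) := by field_simp; ring
    rw [e, div_le_div_iff₀ (by positivity) hθ]
    have hpow : 0 ≤ (1 / (1 + θ)) ^ (N + 1) := by positivity
    have : (1 + θ) * (θ / (1 + θ)) = θ := by field_simp
    rw [this]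
    nlinarith
  rw [Finset.sum_add_distrib, Finset.sum_const, Finset.card_range, nsmul_eq_mul, mul_one]
  have e1 : ∑ i ∈ Finset.range (N + 1), ρ / (1 + θ) ^ i * d * n =
      ρ * d * n * ∑ i ∈ Finset.range (N + 1), (1 / (1 + θ)) ^ i := by
    rw [Finset.mul_sum]
    refine Finset.sum_congr rfl fun i _ => ?_
    rw [one_div, inv_pow]; field_simp
  rw [e1]
  have e2 : ρ * d * n * ∑ i ∈ Finset.range (N + 1), (1 / (1 + θ)) ^ i ≤
      n * (θ / (1 + θ)) / 2 := by
    have hp4 : (1 + θ) ^ 2 ≤ (1 + θ) ^ 5 := pow_le_pow_right₀ (by linarith) (by norm_num)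
    calc ρ * d * n * ∑ i ∈ Finset.range (N + 1), (1 / (1 + θ)) ^ i
        ≤ ρ * d * n * ((1 + θ) / θ) := by gcongr
      _ = n * ((ρ * d * (1 + θ) ^ 2) / (θ * (1 + θ))) := by field_simp
      _ ≤ n * ((ρ * d * (1 + θ) ^ 5) / (θ * (1 + θ))) := by gcongr
      _ ≤ n * ((θ ^ 2 / 2) / (θ * (1 + θ))) := by gcongr
      _ = n * (θ / (1 + θ)) / 2 := by field_simp
  have e3 : ((N + 1 : ℕ) : ℝ) ≤ n * (θ / (1 + θ)) / 2 := by
    push_cast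
    rw [show n * (θ / (1 + θ)) / 2 = θ * n / (2 * (1 + θ)) by field_simp]
    rw [le_div_iff₀ (by positivity)]
    exact hN
  linarith

set_option maxHeartbeats 1000000 in
/-- A positive density of columns in large clusters. -/
lemma bernProb_few_large_clusters_le (T : Finset (Col R b)) {NT K N : ℕ} (hb : 0 < b)
    {τ θ δ η n₁ : ℝ} (hτ : 0 < τ) (hτ1 : τ ≤ 1) (hNT : τ * b ≤ NT) (hNT2 : 2 * NT ≤ b)
    (hT : ∀ j, (T.filter fun x => x.1 = j).card = NT)
    (hθ : 0 < θ) (hθ1 : θ ≤ 1)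
    (hδ : (1 + θ) ^ 4 ≤ (1 - δ) * (1 + τ ^ 2 / 2)) (hδ1 : δ < 1)
    {ν : Fin R → ℝ} (hν : ∀ j, 1 ≤ ν j) (hn₁ : 1 ≤ n₁) (hνn : ∀ j, ν j ≤ n₁)
    {g : Fin R → Fin R → ℝ} (hg : ∀ j j', 0 ≤ g j j')
    (hgν : ∀ j', (1 - δ) * ν j' ≤ ∑ j, g j j' * ν j)
    {p : Sym2 (Col R b) × Bool → ℝ} (hp01 : ∀ i, p i ∈ Set.Icc (0 : ℝ) 1)
    (hp : ∀ x y : Col R b, x ≠ y → ∀ β, g x.1 y.1 / b ≤ p (s(x, y), β))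
    {ρ : ℝ} (hρ : ρ = θ ^ 2 / (4 * n₁ * (1 + θ) ^ 5))
    (hN1 : (N + 1 : ℝ) * (2 * (1 + θ)) ≤ θ * τ * b)
    (hK : (K : ℝ) * (2 * R * (ρ / (1 + θ) ^ N * (2 * n₁) * b + 1)) ≤ ρ * τ / 2 * b)
    (hη : N * (2 * R * ((1 + θ) ^ (N + 1) / (θ ^ 2 * (ρ * (τ * b))))) ≤ η) :
    bernProb p (fun h => ¬ ∀ j, ρ * τ / 2 * b ≤ ((T.filter fun x => x.1 = j ∧
      K ≤ (classFinset (ConnIn (colEdges T) h Finset.univ) x).card).card : ℝ)) ≤ η := by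
  classical
  have hb' : (0 : ℝ) < b := by exact_mod_cast hb
  have hθ1' : 0 < 1 + θ := by linarith
  have hρ0 : 0 < ρ := by rw [hρ]; positivity
  let d : Fin R × Bool → ℝ := fun k => ν k.1 * if k.2 then 1 + τ / 2 else 1
  let n : Fin R × Bool → ℝ := fun k => if k.2 then (NT : ℝ) else b - NT
  have hNTb : (2 : ℝ) * NT ≤ b := by exact_mod_cast hNT2
  have hNT0 : (0 : ℝ) < NT := lt_of_lt_of_le (by positivity) hNT
  have hd1 : ∀ k, 1 ≤ d k := fun k => by
    have := hν k.1
    simp only [d]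
    split_ifs
    · nlinarith
    · linarith
  have hd2 : ∀ k, d k ≤ 2 * n₁ := fun k => by
    have h1 := hν k.1
    have h2 := hνn k.1
    simp only [d]
    split_ifs
    · nlinarith
    · linarith
  have hd0 : ∀ k, 0 < d k := fun k => lt_of_lt_of_le one_pos (hd1 k)
  have hnτ : ∀ k, τ * b ≤ n k := fun k => by
    simp only [n]
    split_ifs
    · exact hNT
    · linarith
  have hn0 : ∀ k, 0 < n k := fun k => lt_of_lt_of_le (by positivity) (hnτ k)
  have hnb : ∀ k, n k ≤ b := fun k => by
    simp only [n]
    split_ifs <;> linarith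
  have hcard : ∀ k, ((classPart (colClass T) Finset.univ k).card : ℝ) = n k := fun k => by
    rw [card_classPart_colClass T hT k]
    simp only [n]
    split_ifs
    · rfl
    · rw [Nat.cast_sub (by omega)]
  have hρd : ∀ k, ρ * d k * (1 + θ) ^ 5 ≤ θ ^ 2 / 2 := fun k => by
    rw [hρ]
    calc θ ^ 2 / (4 * n₁ * (1 + θ) ^ 5) * d k * (1 + θ) ^ 5
        ≤ θ ^ 2 / (4 * n₁ * (1 + θ) ^ 5) * (2 * n₁) * (1 + θ) ^ 5 := by
          gcongr
          exact hd2 k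
      _ = θ ^ 2 / 2 := by field_simp; ring
  -- the starting set
  have hA0le : ∀ k, ⌈ρ / (1 + θ) ^ N * d k * n k⌉₊ ≤
      (classPart (colClass T) Finset.univ k).card := by
    intro k
    rw [Nat.ceil_le, hcard]
    have h1 : ρ / (1 + θ) ^ N * d k ≤ 1 := by
      have h2 : ρ / (1 + θ) ^ N ≤ ρ := div_le_self hρ0.le (one_le_pow₀ (by linarith))
      have h3 : (1 : ℝ) ≤ (1 + θ) ^ 5 := one_le_pow₀ (by linarith)
      have h4 := hρd k
      have h5 := hd0 k
      have h6 : ρ / (1 + θ) ^ N * d k ≤ ρ * d k := by gcongr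
      have h7 : ρ * d k ≤ ρ * d k * (1 + θ) ^ 5 := le_mul_of_one_le_right (by positivity) h3
      nlinarith
    have := hn0 k
    nlinarith
  obtain ⟨A₀, -, hA₀⟩ := exists_subset_classPart_card (colClass T) Finset.univ _ hA0le
  have hA₀card : (A₀.card : ℝ) ≤ 2 * R * (ρ / (1 + θ) ^ N * (2 * n₁) * b + 1) := by
    have h1 : A₀.card = ∑ k, (classPart (colClass T) A₀ k).card :=
      Finset.card_eq_sum_card_fiberwise fun _ _ => Finset.mem_univ _
    rw [h1]
    push_cast
    calc ∑ k, ((classPart (colClass T) A₀ k).card : ℝ)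
        ≤ ∑ _k : Fin R × Bool, (ρ / (1 + θ) ^ N * (2 * n₁) * b + 1) := by
          refine Finset.sum_le_sum fun k _ => ?_
          rw [hA₀ k]
          have hdk := hd0 k
          have hnk := hn0 k
          refine (Nat.ceil_lt_add_one (by positivity)).le.trans ?_
          gcongr
          · exact hd2 k
          · exact hnb k
      _ = 2 * R * (ρ / (1 + θ) ^ N * (2 * n₁) * b + 1) := by
          rw [Finset.sum_const, Finset.card_univ, Fintype.card_prod, Fintype.card_fin,
            Fintype.card_bool, nsmul_eq_mul]
          push_cast; ring
  set η₁ : ℝ := 2 * R * ((1 + θ) ^ (N + 1) / (θ ^ 2 * (ρ * (τ * b)))) with hη₁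
  have hη₁0 : 0 ≤ η₁ := by positivity
  have hreach := bernProb_reachSet_small_le (disjoint_colEdges T) hp01 (colClass T) d n hθ hρ0
    hd0 hn0 hη₁0 (fun k => (hρd k).trans (by nlinarith)) (fun A a ha hA y hy => by
      have := colEdges_growth T hb hτ hτ1 hNT hδ hδ1 (fun j => zero_le_one.trans (hν j)) hg hgν hp
        A ha hA hy
      refine le_trans (le_of_eq ?_) this
      simp [d, colClass]) N
    (by
      calc ∑ k, (1 + θ) ^ (N + 1) / (θ ^ 2 * (ρ * d k * n k))
          ≤ ∑ _k : Fin R × Bool, (1 + θ) ^ (N + 1) / (θ ^ 2 * (ρ * (τ * b))) := by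
            refine Finset.sum_le_sum fun k _ => ?_
            have h1 := hd1 k
            have h2 := hnτ k
            have h4 := hd0 k
            have h3 : ρ * (τ * b) ≤ ρ * d k * n k := by
              calc ρ * (τ * b) ≤ ρ * d k * (τ * b) := by
                    gcongr
                    exact le_mul_of_one_le_right hρ0.le h1
                _ ≤ _ := by gcongr
            gcongr
        _ = η₁ := by
            rw [Finset.sum_const, Finset.card_univ, Fintype.card_prod, Fintype.card_fin,
              Fintype.card_bool, nsmul_eq_mul, hη₁]
            push_cast; ring) N le_rfl A₀ Finset.univ (Finset.subset_univ _)
    (fun k => by rw [hA₀ k]; exact Nat.le_ceil _)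
    (fun k => by
      have hsd : classPart (colClass T) (Finset.univ \ A₀) k =
          classPart (colClass T) Finset.univ k \ classPart (colClass T) A₀ k := by
        ext w
        simp only [mem_classPart, Finset.mem_sdiff]
        tauto
      have h2 := Finset.card_sdiff_add_card_eq_card
        (classPart_mono (cl := colClass T) (Finset.subset_univ A₀) k)
      rw [← hsd, hA₀ k] at h2
      have h3 : ((classPart (colClass T) (Finset.univ \ A₀) k).card : ℝ) +
          ⌈ρ / (1 + θ) ^ N * d k * n k⌉₊ = n k :=
        (show _ = ((classPart (colClass T) Finset.univ k).card : ℝ) by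
          exact_mod_cast h2).trans (hcard k)
      have hdk := hd0 k
      have hnk := hn0 k
      have h5 := (Nat.ceil_lt_add_one (a := ρ / (1 + θ) ^ N * d k * n k) (by positivity)).le
      have hsum := geometric_budget_le N hθ hρ0.le hdk.le hnk (hρd k)
        (hN1.trans (by rw [mul_assoc]; exact mul_le_mul_of_nonneg_left (hnτ k) hθ.le))
      -- The summand with index `N` pays for the seed, the others for the `N` steps.
      rw [Finset.sum_range_succ] at hsum
      have h8 : n k / (1 + θ) + n k * (θ / (1 + θ)) = n k := by field_simp
      linarith)
  refine (bernProb_mono hp01 fun h hh => ?_).trans (hreach.trans hη)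
  by_contra hno
  push Not at hno
  apply hh
  intro j
  have h1 := hno (j, true)
  set r := ConnIn (colEdges T) h Finset.univ
  set X := classPart (colClass T) (reachSet (colEdges T) h A₀ Finset.univ) (j, true)
  -- The reached set has at least `ρ * τ * b` columns of the block, while the seed is so small that
  -- `K * A₀.card` is at most half of that; the other half lies in large clusters.
  have h2 := card_le_card_large_add (equivalence_connIn_univ (colEdges T) h) A₀ X K
    (fun y hy => (Finset.mem_filter.mp (mem_classPart.mp hy).1).2)
  have h3 : (X.filter fun y => K ≤ (classFinset r y).card).card ≤
      (T.filter fun x => x.1 = j ∧ K ≤ (classFinset r x).card).card := by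
    refine Finset.card_le_card fun y hy => ?_
    obtain ⟨hyX, hyK⟩ := Finset.mem_filter.mp hy
    have := (mem_classPart.mp hyX).2
    simp only [colClass, Prod.mk.injEq, decide_eq_true_eq] at this
    exact Finset.mem_filter.mpr ⟨this.2, this.1, hyK⟩
  have h4 : (X.card : ℝ) ≤ (T.filter fun x => x.1 = j ∧ K ≤ (classFinset r x).card).card +
      K * A₀.card := by
    exact_mod_cast h2.trans (Nat.add_le_add_right h3 _)
  have h5 : (K : ℝ) * A₀.card ≤ ρ * τ / 2 * b :=
    (mul_le_mul_of_nonneg_left hA₀card (Nat.cast_nonneg K)).trans hK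
  have h6 : ρ * τ * b ≤ ρ * d (j, true) * n (j, true) := by
    calc ρ * τ * b = ρ * 1 * (τ * b) := by ring
      _ ≤ ρ * d (j, true) * n (j, true) := by
          have := hd0 (j, true)
          gcongr
          · exact hd1 _
          · exact hnτ _
  linarith

end Brick

/-! ### Existence of a core in a large brick -/

section BrickTheorem

/-- The bonds of a brick: the vertical ones, the horizontal ones in both layers, and additional
horizontal ones in the bottom layer. -/
abbrev BrickIdx (R b : ℕ) : Type :=
  Col R b ⊕ ((Sym2 (Col R b) × Bool) ⊕ Sym2 (Col R b))

variable {R b : ℕ}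

/-- Two columns are joined by open bonds. -/
def ColAdj (ω : BrickIdx R b → Bool) (x y : Col R b) : Prop :=
  ω (.inr (.inl (s(x, y), false))) = true ∨
    (ω (.inl x) = true ∧ ω (.inl y) = true ∧ ω (.inr (.inl (s(x, y), true))) = true) ∨
    ω (.inr (.inr s(x, y))) = true

/-- A connected set of columns which has many vertically open columns in every block. -/
def IsBrickCore (ρ : ℝ) (ω : BrickIdx R b → Bool) (C : Finset (Col R b)) : Prop :=
  (∀ x ∈ C, ∀ y ∈ C, Relation.EqvGen (ColAdj ω) x y) ∧
    ∀ j, ρ * b ≤ (C.filter fun x => x.1 = j ∧ ω (.inl x) = true).card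

/-- Many columns of every block are vertically open. -/
lemma bernProb_few_vertical_le (hb : 0 < b) {t : ℝ} (ht : 0 < t) {p : Col R b → ℝ}
    (hp01 : ∀ i, p i ∈ Set.Icc (0 : ℝ) 1) (hp : ∀ x, t ≤ p x) :
    bernProb p (fun ω => ¬ ∀ j, t * b / 2 ≤
      ((Finset.univ.filter fun x : Col R b => x.1 = j ∧ ω x = true).card : ℝ)) ≤
      R * (4 / (t * b)) := by
  classical
  have hb' : (0 : ℝ) < b := by exact_mod_cast hb
  have h1 : ∀ j : Fin R, bernProb p (fun ω =>
      (((Finset.univ.filter fun x : Col R b => x.1 = j).filter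
        fun x => ω x = true).card : ℝ) < t * b / 2) ≤ 4 / (t * b) := by
    intro j
    have hsum : t * b ≤ ∑ x ∈ Finset.univ.filter fun x : Col R b => x.1 = j,
        bernProb p (fun ω => ω x = true) := by
      have := Finset.card_nsmul_le_sum (Finset.univ.filter fun x : Col R b => x.1 = j)
        (fun x => bernProb p (fun ω => ω x = true)) t
        (fun x _ => by rw [bernProb_coord]; exact hp x)
      rw [card_filter_block, nsmul_eq_mul] at this
      linarith
    have hpos : 0 < t * b := by positivity
    refine (bernProb_mono hp01 fun ω hω => ?_).trans
      ((bernProb_card_lt_le hp01 (Finset.univ.filter fun x : Col R b => x.1 = j)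
      (P := fun x ω => ω x = true) (m := t * b / 2) (θ := 1) ?_ one_pos (hpos.trans_le hsum)
      (by linarith)).trans ?_)
    · convert hω
    · intro x _ y _ hxy
      exact bernProb_and_of_dependsOn p (dependsOn_coord x true) (dependsOn_coord y true)
        (by simpa using hxy)
    · rw [show ((1 : ℝ) + 1) ^ 2 = 4 by norm_num, one_pow, one_mul]
      gcongr
  refine (bernProb_mono hp01 (Q := fun ω => ∃ j ∈ (Finset.univ : Finset (Fin R)),
      (((Finset.univ.filter fun x : Col R b => x.1 = j).filter
        fun x => ω x = true).card : ℝ) < t * b / 2) fun ω hω => ?_).trans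
    ((bernProb_exists_le hp01 _ _).trans ((Finset.sum_le_sum fun j _ => h1 j).trans ?_))
  · push Not at hω
    obtain ⟨j, hj⟩ := hω
    exact ⟨j, Finset.mem_univ _, by rwa [Finset.filter_filter]⟩
  · rw [Finset.sum_const, Finset.card_univ, Fintype.card_fin, nsmul_eq_mul]

/-- Sprinkling merges the large clusters of a brick. -/
lemma bernProb_brick_sprinkling_le {r : Col R b → Col R b → Prop} (hr : Equivalence r)
    (T : Finset (Col R b)) {K : ℕ} (hR : 0 < R) (hb : 0 < b) {ρ s : ℝ} (hρ : 0 < ρ) (hs : 0 < s)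
    (hK : 18 * R / (s * ρ ^ 2) ≤ K) (hK0 : 0 < K)
    (hT : ∀ j, ρ * b ≤ ((T.filter fun x => x.1 = j ∧ K ≤ (classFinset r x).card).card : ℝ))
    {p : Sym2 (Col R b) → ℝ} (hp01 : ∀ i, p i ∈ Set.Icc (0 : ℝ) 1)
    (hp : ∀ x y : Col R b, x ≠ y → (y.1 = x.1 ∨ (y.1 : ℕ) = x.1 + 1) → s / b ≤ p s(x, y)) :
    bernProb p (fun ω => ¬ ∃ C : Finset (Col R b),
      (∀ x ∈ C, ∀ y ∈ C, SprinkledConn r ω x y) ∧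
      ∀ j, ρ / 3 * b ≤ ((C.filter fun x => x.1 = j ∧ x ∈ T).card : ℝ)) ≤
      2 * R * Real.exp (-(s * ρ ^ 2 / 18 * b)) := by
  classical
  have hb' : (0 : ℝ) < b := by exact_mod_cast hb
  have hR' : (0 : ℝ) < R := by exact_mod_cast hR
  have hK' : (0 : ℝ) < K := by exact_mod_cast hK0
  let D : ℕ → Finset (Col R b) := fun j =>
    T.filter fun x => (x.1 : ℕ) = j ∧ K ≤ (classFinset r x).card
  have hD : ∀ j : Fin R, D j = T.filter fun x => x.1 = j ∧ K ≤ (classFinset r x).card := by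
    intro j
    ext x
    simp only [D, Finset.mem_filter, Fin.ext_iff]
  have hM : (largeClasses r K).card ≤ R * b / K := by
    rw [Nat.le_div_iff_mul_le hK0]
    refine (card_largeClasses_mul_le hr K).trans (le_of_eq ?_)
    rw [Fintype.card_prod, Fintype.card_fin, Fintype.card_fin]
  have h := bernProb_sprinkling_fails_le hr (R := R) (K := K) D (m := ρ * b) (p := s / b)
    (by positivity) (by positivity) hR
    (fun j _ x hx => (Finset.mem_filter.mp hx).2.2) hM
    (fun j hj => by have := hT ⟨j, hj⟩; rwa [← hD] at this) hp01
    (fun j _ x hx y hy hxy => by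
      have hx1 := (Finset.mem_filter.mp hx).2.1
      refine hp x y hxy ?_
      rcases hy with hy | ⟨-, hy⟩
      · have hy1 := (Finset.mem_filter.mp hy).2.1
        exact Or.inl (Fin.ext (by omega))
      · have hy1 := (Finset.mem_filter.mp hy).2.1
        exact Or.inr (by omega))
  refine (bernProb_mono hp01 fun ω hω => ?_).trans (h.trans ?_)
  · rintro ⟨C, hC, hCD⟩
    refine hω ⟨C, hC, fun j => ?_⟩
    have h1 := hCD j j.2
    rw [hD] at h1
    rw [div_mul_eq_mul_div]
    refine h1.trans ?_
    norm_cast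
    refine Finset.card_le_card fun x hx => ?_
    obtain ⟨hxC, hx⟩ := Finset.mem_inter.mp hx
    obtain ⟨hxT, hxj, -⟩ := Finset.mem_filter.mp hx
    exact Finset.mem_filter.mpr ⟨hxC, hxj, hxT⟩
  -- The exponent from the sprinkled edges is `s * ρ ^ 2 / 9 * b`; the choice of `K` lets the number
  -- of unions of clusters use up only half of it.
  · have h2 : (2 : ℝ) ^ (R * b / K) ≤ Real.exp (s * ρ ^ 2 / 18 * b) := by
      have h3 : (2 : ℝ) ≤ Real.exp 1 := by
        have := Real.add_one_le_exp (1 : ℝ)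
        linarith
      have h4 : ((R * b / K : ℕ) : ℝ) ≤ s * ρ ^ 2 / 18 * b := by
        refine Nat.cast_div_le.trans ?_
        push_cast
        rw [div_le_iff₀ hK']
        rw [div_le_iff₀ (by positivity)] at hK
        nlinarith
      calc (2 : ℝ) ^ (R * b / K) ≤ Real.exp 1 ^ (R * b / K) := by gcongr
        _ = Real.exp ((R * b / K : ℕ) : ℝ) := by rw [← Real.exp_nat_mul, mul_one]
        _ ≤ _ := Real.exp_le_exp.mpr h4
    calc 2 ^ (R * b / K) * (2 * (R : ℝ)) * Real.exp (-(s / b * (ρ * b / 3) ^ 2))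
        ≤ Real.exp (s * ρ ^ 2 / 18 * b) * (2 * R) * Real.exp (-(s / b * (ρ * b / 3) ^ 2)) := by
          gcongr
      _ = 2 * R * (Real.exp (s * ρ ^ 2 / 18 * b) * Real.exp (-(s / b * (ρ * b / 3) ^ 2))) := by
          ring
      _ = 2 * R * Real.exp (-(s * ρ ^ 2 / 18 * b)) := by
          rw [← Real.exp_add]
          congr 2
          field_simp
          ring

lemma eventually_le_mul_natCast {c : ℝ} (hc : 0 < c) (C : ℝ) :
    ∀ᶠ b : ℕ in atTop, C ≤ c * b :=
  (tendsto_natCast_atTop_atTop.const_mul_atTop hc).eventually_ge_atTop C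

/-- Edges of the top layer are used only between columns of `T`, whose vertical bonds are open. -/
lemma eqvGen_colAdj_of_sprinkled {T : Finset (Col R b)} {ω : BrickIdx R b → Bool}
    (hT : ∀ x ∈ T, ω (.inl x) = true) {x y : Col R b}
    (h : SprinkledConn (ConnIn (colEdges T) (fun e => ω (.inr (.inl e))) Finset.univ)
      (fun e => ω (.inr (.inr e))) x y) : Relation.EqvGen (ColAdj ω) x y := by
  induction h with
  | refl x => exact .refl x
  | symm x y _ ih => exact .symm _ _ ih
  | trans x y z _ _ ih ih' => exact .trans _ _ _ ih ih'
  | rel x y h =>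
    rcases h with h | h
    · induction h with
      | refl => exact .refl x
      | tail _ h ih =>
        refine .trans _ _ _ ih (.rel _ _ ?_)
        obtain ⟨i, hi, hω⟩ := h.2.2
        rename_i u v _
        rw [colEdges] at hi
        split_ifs at hi with hT'
        · rcases Finset.mem_insert.mp hi with rfl | hi
          · exact Or.inl hω
          · rw [Finset.mem_singleton] at hi
            subst hi
            exact Or.inr (Or.inl ⟨hT _ (hT' _ (Sym2.mem_mk_left _ _)),
              hT _ (hT' _ (Sym2.mem_mk_right _ _)), hω⟩)
        · rw [Finset.mem_singleton] at hi
          subst hi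
          exact Or.inl hω
    · exact .rel _ _ (Or.inr (Or.inr h))

/-- A large brick contains a core with high probability. -/
theorem exists_brickCore_density (hR : 0 < R) {ν : Fin R → ℝ} (hν : ∀ j, 1 ≤ ν j) {t θ δ : ℝ}
    (ht : 0 < t) (ht1 : t ≤ 1) (hθ : 0 < θ) (hθ1 : θ ≤ 1) (hδ1 : δ < 1)
    (hδ : (1 + θ) ^ 4 ≤ (1 - δ) * (1 + (t / 4) ^ 2 / 2)) :
    ∃ ρ : ℝ, 0 < ρ ∧ ∀ s : ℝ, 0 < s → ∀ η : ℝ, 0 < η → ∀ᶠ b : ℕ in atTop,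
      ∀ g : Fin R → Fin R → ℝ, (∀ j j', 0 ≤ g j j') →
      (∀ j', (1 - δ) * ν j' ≤ ∑ j, g j j' * ν j) →
      ∀ p : BrickIdx R b → ℝ, (∀ i, p i ∈ Set.Icc (0 : ℝ) 1) →
      (∀ x, t ≤ p (.inl x)) →
      (∀ x y : Col R b, x ≠ y → ∀ β, g x.1 y.1 / b ≤ p (.inr (.inl (s(x, y), β)))) →
      (∀ x y : Col R b, x ≠ y → (y.1 = x.1 ∨ (y.1 : ℕ) = x.1 + 1) →
        s / b ≤ p (.inr (.inr s(x, y)))) →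
      bernProb p (fun ω => ¬ ∃ C, IsBrickCore ρ ω C) ≤ η := by
  classical
  obtain ⟨n₁, hn₁, hνn⟩ : ∃ n₁ : ℝ, 1 ≤ n₁ ∧ ∀ j, ν j ≤ n₁ := by
    obtain ⟨j, -, hj⟩ := Finset.exists_max_image Finset.univ ν ⟨⟨0, hR⟩, Finset.mem_univ _⟩
    exact ⟨ν j, hν j, fun j' => hj j' (Finset.mem_univ _)⟩
  -- With high probability at least `t * b / 2` columns of every block are vertically open, which
  -- leaves room for choosing `⌈τ * b⌉₊` of them, and this number is at most half of a block.
  set τ : ℝ := t / 4 with hτdef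
  have hτ : 0 < τ := by positivity
  set ρ₀ : ℝ := θ ^ 2 / (4 * n₁ * (1 + θ) ^ 5) with hρ₀def
  have hρ₀ : 0 < ρ₀ := by positivity
  set ρ₁ : ℝ := ρ₀ * τ / 2 with hρ₁def
  have hρ₁ : 0 < ρ₁ := by positivity
  have hR' : (0 : ℝ) < R := by exact_mod_cast hR
  refine ⟨ρ₁ / 3, by positivity, fun s hs η hη => ?_⟩
  -- The order of the choices matters: `K` makes the clusters few enough for sprinkling, `N` makes
  -- the seed small compared with `1 / K`, and then `b` is large.
  obtain ⟨K, hK⟩ := exists_nat_ge (18 * R / (s * ρ₁ ^ 2))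
  have hK0 : 0 < K := by
    have : (0 : ℝ) < K := lt_of_lt_of_le (by positivity) hK
    exact_mod_cast this
  obtain ⟨N, hN⟩ : ∃ N : ℕ, K * (2 * R * (ρ₀ * (2 * n₁))) / (ρ₀ * τ / 4) ≤ (1 + θ) ^ N := by
    obtain ⟨N, hN⟩ := pow_unbounded_of_one_lt (K * (2 * R * (ρ₀ * (2 * n₁))) / (ρ₀ * τ / 4))
      (show (1 : ℝ) < 1 + θ by linarith)
    exact ⟨N, hN.le⟩
  have hc : 0 < s * ρ₁ ^ 2 / 18 := by positivity
  filter_upwards [eventually_gt_atTop 0, eventually_le_mul_natCast ht 4,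
    eventually_le_mul_natCast (show 0 < θ * τ by positivity) ((N + 1) * (2 * (1 + θ))),
    eventually_le_mul_natCast (show 0 < ρ₀ * τ / 4 by positivity) (K * (2 * R)),
    eventually_le_mul_natCast (show 0 < η / 3 by positivity)
      (N * (2 * R * ((1 + θ) ^ (N + 1) / (θ ^ 2 * (ρ₀ * τ))))),
    eventually_le_mul_natCast (show 0 < η / 3 by positivity) (R * (4 / t)),
    eventually_le_mul_natCast (show 0 < η / 3 by positivity) (2 * R / (s * ρ₁ ^ 2 / 18))]
    with b hb hb4 hbN hbK hbη hbV hbS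
  intro g hg hgν p hp01 hpV hpH hpS
  have hb' : (0 : ℝ) < b := by exact_mod_cast hb
  have hpe : p = Sum.elim (fun x => p (.inl x))
      (Sum.elim (fun e => p (.inr (.inl e))) (fun e => p (.inr (.inr e)))) := by
    funext i
    rcases i with i | i | i <;> rfl
  have hV := bernProb_few_vertical_le hb ht (p := fun x : Col R b => p (.inl x))
    (fun _ => hp01 _) hpV
  have hV' : (R : ℝ) * (4 / (t * b)) ≤ η / 3 := by
    rw [← div_div, mul_div_assoc', div_le_iff₀ hb']
    exact hbV
  rw [hpe]
  -- Three independent stages: vertical bonds, horizontal bonds, additional bonds.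
  have key : η / 3 + (η / 3 + η / 3) = η := by ring
  rw [← key]
  refine bernProb_sum_elim_le (fun _ => hp01 _)
    (fun i => by rcases i with i | i <;> exact hp01 _) _ (hV.trans hV') (by positivity) ?_
  intro v hv
  -- the vertically open columns, in equal number in every block
  set NT : ℕ := ⌈τ * b⌉₊ with hNTdef
  have hNT1 : τ * b ≤ NT := Nat.le_ceil _
  have hNT2 : (NT : ℝ) ≤ τ * b + 1 := (Nat.ceil_lt_add_one (by positivity)).le
  have hτb : τ * b = t * b / 4 := by rw [hτdef]; ring
  have htb : t * b ≤ b := mul_le_of_le_one_left hb'.le ht1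
  have hNTb : 2 * NT ≤ b := by
    have : (2 : ℝ) * NT ≤ b := by linarith
    exact_mod_cast this
  have hex : ∀ j : Fin R, ∃ S ⊆ Finset.univ.filter (fun x : Col R b => x.1 = j ∧ v x = true),
      S.card = NT := by
    intro j
    refine Finset.exists_subset_card_eq ?_
    have h1 := hv j
    have h2 : (NT : ℝ) ≤ t * b / 2 := by linarith
    exact_mod_cast h2.trans h1
  choose S hS hScard using hex
  set T : Finset (Col R b) := Finset.univ.biUnion S with hTdef
  have hTS : ∀ j, T.filter (fun x => x.1 = j) = S j := by
    intro j
    ext x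
    simp only [hTdef, Finset.mem_filter, Finset.mem_biUnion, Finset.mem_univ, true_and]
    constructor
    · rintro ⟨⟨j', hx⟩, rfl⟩
      have := (Finset.mem_filter.mp (hS j' hx)).2.1
      rwa [this]
    · exact fun hx => ⟨⟨j, hx⟩, (Finset.mem_filter.mp (hS j hx)).2.1⟩
  have hTv : ∀ x ∈ T, v x = true := by
    intro x hx
    obtain ⟨j, -, hx⟩ := Finset.mem_biUnion.mp hx
    exact (Finset.mem_filter.mp (hS j hx)).2.2
  have hclusters := bernProb_few_large_clusters_le T (K := K) (N := N) (η := η / 3) hb hτ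
    (by linarith) hNT1 hNTb
    (fun j => by rw [hTS, hScard]) hθ hθ1 hδ hδ1 hν hn₁ hνn hg hgν
    (p := fun e => p (.inr (.inl e))) (fun _ => hp01 _) hpH hρ₀def hbN
    (by
      rw [div_le_iff₀ (by positivity)] at hN
      have h1 : K * (2 * R * (ρ₀ / (1 + θ) ^ N * (2 * n₁) * b)) ≤ ρ₀ * τ / 4 * b := by
        have e : K * (2 * R * (ρ₀ / (1 + θ) ^ N * (2 * n₁) * b)) =
            K * (2 * R * (ρ₀ * (2 * n₁))) / (1 + θ) ^ N * b := by field_simp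
        rw [e]
        refine mul_le_mul_of_nonneg_right ?_ hb'.le
        rw [div_le_iff₀ (by positivity)]
        linarith
      linarith)
    (by
      have e : (N : ℝ) * (2 * R * ((1 + θ) ^ (N + 1) / (θ ^ 2 * (ρ₀ * (τ * b))))) =
          N * (2 * R * ((1 + θ) ^ (N + 1) / (θ ^ 2 * (ρ₀ * τ)))) / b := by
        field_simp
      rw [e, div_le_iff₀ hb']
      exact hbη)
  refine bernProb_sum_elim_le (fun _ => hp01 _) (fun _ => hp01 _) _ hclusters (by positivity) ?_
  intro h hh
  have hsp := bernProb_brick_sprinkling_le (equivalence_connIn_univ (colEdges T) h) T hR hb hρ₁ hs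
    hK hK0 hh (p := fun e => p (.inr (.inr e))) (fun _ => hp01 _) hpS
  refine (bernProb_mono (fun _ => hp01 _) fun ω hω => ?_).trans (hsp.trans ?_)
  · rintro ⟨C, hC, hCT⟩
    refine hω ⟨C, fun x hx y hy => ?_, fun j => (hCT j).trans ?_⟩
    · exact eqvGen_colAdj_of_sprinkled (T := T) (fun x hx => hTv x hx) (hC x hx y hy)
    · norm_cast
      refine Finset.card_le_card fun x hx => ?_
      obtain ⟨hxC, hxj, hxT⟩ := Finset.mem_filter.mp hx
      exact Finset.mem_filter.mpr ⟨hxC, hxj, hTv x hxT⟩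
  · have h1 : Real.exp (-(s * ρ₁ ^ 2 / 18 * b)) ≤ 1 / (s * ρ₁ ^ 2 / 18 * b) := by
      rw [Real.exp_neg, ← one_div]
      gcongr
      have := Real.add_one_le_exp (s * ρ₁ ^ 2 / 18 * b)
      linarith
    calc 2 * R * Real.exp (-(s * ρ₁ ^ 2 / 18 * b)) ≤ 2 * R * (1 / (s * ρ₁ ^ 2 / 18 * b)) := by
          gcongr
      _ = 2 * R / (s * ρ₁ ^ 2 / 18) / b := by field_simp
      _ ≤ η / 3 := by rw [div_le_iff₀ hb']; exact hbS

end BrickTheorem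

/-! ### Hierarchical percolation of good sites on the square lattice -/

section Hierarchy

/-- The nine children of a box. -/
def child (Q : ℤ × ℤ) (c : Fin 3 × Fin 3) : ℤ × ℤ := (3 * Q.1 + (c.1 : ℕ), 3 * Q.2 + (c.2 : ℕ))

/-- A box is bad if two of its children are. -/
def HierBad (bad : ℤ × ℤ → Prop) : ℕ → ℤ × ℤ → Prop
  | 0, Q => bad Q
  | n + 1, Q => ∃ c c', c ≠ c' ∧ HierBad bad n (child Q c) ∧ HierBad bad n (child Q c')

/-- The box of level `n` with index `Q` contains `z`. -/
def InBox (n : ℕ) (Q z : ℤ × ℤ) : Prop := z.1 / 3 ^ n = Q.1 ∧ z.2 / 3 ^ n = Q.2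

lemma InBox.of_child {n : ℕ} {Q z : ℤ × ℤ} {c : Fin 3 × Fin 3} (h : InBox n (child Q c) z) :
    InBox (n + 1) Q z := by
  obtain ⟨h1, h2⟩ := h
  have hc1 := c.1.2
  have hc2 := c.2.2
  simp only [child] at h1 h2
  refine ⟨?_, ?_⟩
  · rw [pow_succ, ← Int.ediv_ediv_of_nonneg (by positivity), h1]
    omega
  · rw [pow_succ, ← Int.ediv_ediv_of_nonneg (by positivity), h2]
    omega

lemma child_injective (Q : ℤ × ℤ) : Function.Injective (child Q) := by
  rintro ⟨c1, c2⟩ ⟨d1, d2⟩ h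
  simp only [child, Prod.mk.injEq] at h
  refine Prod.ext (Fin.ext ?_) (Fin.ext ?_) <;> simp only <;> omega

lemma InBox.unique {n : ℕ} {Q Q' z : ℤ × ℤ} (h : InBox n Q z) (h' : InBox n Q' z) : Q = Q' :=
  Prod.ext (h.1.symm.trans h'.1) (h.2.symm.trans h'.2)

/-- The sets of `2 ^ n` sites whose badness makes a box of level `n` bad. -/
def badFamily : ℕ → ℤ × ℤ → Finset (Finset (ℤ × ℤ))
  | 0, Q => {{Q}}
  | n + 1, Q => (Finset.univ.filter fun a : (Fin 3 × Fin 3) × (Fin 3 × Fin 3) => a.1 ≠ a.2).biUnion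
      fun a => (badFamily n (child Q a.1) ×ˢ badFamily n (child Q a.2)).image fun s => s.1 ∪ s.2

lemma exists_badFamily {bad : ℤ × ℤ → Prop} {n : ℕ} {Q : ℤ × ℤ} (h : HierBad bad n Q) :
    ∃ S ∈ badFamily n Q, ∀ z ∈ S, bad z := by
  induction n generalizing Q with
  | zero => exact ⟨{Q}, by simp [badFamily], by simpa [HierBad] using h⟩
  | succ n ih =>
    obtain ⟨c, c', hc, h1, h2⟩ := h
    obtain ⟨S, hS, hSb⟩ := ih h1
    obtain ⟨S', hS', hSb'⟩ := ih h2
    refine ⟨S ∪ S', ?_, ?_⟩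
    · rw [badFamily, Finset.mem_biUnion]
      exact ⟨(c, c'), Finset.mem_filter.mpr ⟨Finset.mem_univ _, hc⟩, Finset.mem_image.mpr
        ⟨(S, S'), Finset.mem_product.mpr ⟨hS, hS'⟩, rfl⟩⟩
    · intro z hz
      rcases Finset.mem_union.mp hz with hz | hz
      · exact hSb z hz
      · exact hSb' z hz

lemma inBox_of_mem_badFamily {n : ℕ} {Q : ℤ × ℤ} {S : Finset (ℤ × ℤ)} (hS : S ∈ badFamily n Q)
    {z : ℤ × ℤ} (hz : z ∈ S) : InBox n Q z := by
  induction n generalizing Q S with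
  | zero =>
    rw [badFamily, Finset.mem_singleton] at hS
    subst hS
    rw [Finset.mem_singleton] at hz
    subst hz
    simp [InBox]
  | succ n ih =>
    rw [badFamily, Finset.mem_biUnion] at hS
    obtain ⟨a, -, hS⟩ := hS
    obtain ⟨s, hs, rfl⟩ := Finset.mem_image.mp hS
    obtain ⟨h1, h2⟩ := Finset.mem_product.mp hs
    rcases Finset.mem_union.mp hz with hz | hz
    · exact (ih h1 hz).of_child
    · exact (ih h2 hz).of_child

lemma card_of_mem_badFamily {n : ℕ} {Q : ℤ × ℤ} {S : Finset (ℤ × ℤ)}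
    (hS : S ∈ badFamily n Q) : S.card = 2 ^ n := by
  induction n generalizing Q S with
  | zero =>
    rw [badFamily, Finset.mem_singleton] at hS
    subst hS
    simp
  | succ n ih =>
    rw [badFamily, Finset.mem_biUnion] at hS
    obtain ⟨a, ha, hS⟩ := hS
    obtain ⟨s, hs, rfl⟩ := Finset.mem_image.mp hS
    obtain ⟨h1, h2⟩ := Finset.mem_product.mp hs
    rw [Finset.card_union_of_disjoint, ih h1, ih h2, pow_succ]
    · ring
    · refine Finset.disjoint_left.mpr fun z hz hz' => (Finset.mem_filter.mp ha).2 ?_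
      exact child_injective Q ((inBox_of_mem_badFamily h1 hz).unique
        (inBox_of_mem_badFamily h2 hz'))

/-- There are `9 * 8 = 72` ordered pairs of distinct children, so the cardinality satisfies `c' ≤ 72
* c ^ 2`; the quantity `72 * c` is at most squared at each level. -/
lemma card_badFamily_le (n : ℕ) (Q : ℤ × ℤ) : 72 * (badFamily n Q).card ≤ 72 ^ 2 ^ n := by
  induction n generalizing Q with
  | zero => simp [badFamily]
  | succ n ih =>
    have h1 : (badFamily (n + 1) Q).card ≤ ∑ a ∈ Finset.univ.filter
        fun a : (Fin 3 × Fin 3) × (Fin 3 × Fin 3) => a.1 ≠ a.2,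
        (badFamily n (child Q a.1)).card * (badFamily n (child Q a.2)).card := by
      rw [badFamily]
      refine Finset.card_biUnion_le.trans (Finset.sum_le_sum fun a _ => ?_)
      exact Finset.card_image_le.trans (Finset.card_product _ _).le
    have h2 : (Finset.univ.filter
        fun a : (Fin 3 × Fin 3) × (Fin 3 × Fin 3) => a.1 ≠ a.2).card = 72 := by decide
    rw [pow_succ, mul_two, pow_add]
    generalize 72 ^ 2 ^ n = X at ih ⊢
    have h3 : ∀ a : (Fin 3 × Fin 3) × (Fin 3 × Fin 3), 72 * 72 *
        ((badFamily n (child Q a.1)).card * (badFamily n (child Q a.2)).card) ≤ X * X := fun a =>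
      le_trans (le_of_eq (by ring)) (Nat.mul_le_mul (ih (child Q a.1)) (ih (child Q a.2)))
    have h4 : 72 * 72 * (badFamily (n + 1) Q).card ≤ 72 * (X * X) := by
      refine (Nat.mul_le_mul_left _ h1).trans ?_
      rw [Finset.mul_sum]
      refine (Finset.sum_le_sum fun a _ => h3 a).trans (le_of_eq ?_)
      rw [Finset.sum_const, h2, smul_eq_mul]
    omega

variable {ι : Type*} [Fintype ι] [DecidableEq ι] {p : ι → ℝ}

lemma bernProb_hierBad_le (hp : ∀ i, p i ∈ Set.Icc (0 : ℝ) 1) {bad : (ι → Bool) → ℤ × ℤ → Prop}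
    {q : ℝ} (hq : 0 ≤ q) {n : ℕ} {Q : ℤ × ℤ}
    (hbad : ∀ T : Finset (ℤ × ℤ), (∀ z ∈ T, InBox n Q z) →
      bernProb p (fun ω => ∀ z ∈ T, bad ω z) ≤ q ^ T.card) :
    bernProb p (fun ω => HierBad (bad ω) n Q) ≤ (72 * q) ^ 2 ^ n := by
  refine (bernProb_mono hp fun ω h => exists_badFamily h).trans
    ((bernProb_exists_le hp _ _).trans ?_)
  calc ∑ S ∈ badFamily n Q, bernProb p (fun ω => ∀ z ∈ S, bad ω z)
      ≤ ∑ _S ∈ badFamily n Q, q ^ 2 ^ n := by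
        refine Finset.sum_le_sum fun S hS => ?_
        rw [← card_of_mem_badFamily hS]
        exact hbad S fun z hz => inBox_of_mem_badFamily hS hz
    _ = (badFamily n Q).card * q ^ 2 ^ n := by rw [Finset.sum_const, nsmul_eq_mul]
    _ ≤ (72 * q) ^ 2 ^ n := by
        rw [mul_pow]
        gcongr
        have h1 := card_badFamily_le n Q
        have h2 : (badFamily n Q).card ≤ 72 ^ 2 ^ n := by omega
        exact_mod_cast h2

lemma InBox.mono_zero {n m : ℕ} (hnm : n ≤ m) {z : ℤ × ℤ} (h : InBox n 0 z) : InBox m 0 z := by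
  induction m, hnm using Nat.le_induction with
  | base => exact h
  | succ m _ ih =>
    refine InBox.of_child (c := (0, 0)) ?_
    have h0 : child 0 (0, 0) = 0 := by simp [child]
    rwa [h0]

/-- If sets of sites are bad with exponentially small probability, all boxes around the origin are
good with probability at least `1 / 2`. -/
theorem half_le_bernProb_not_hierBad (hp : ∀ i, p i ∈ Set.Icc (0 : ℝ) 1)
    {bad : (ι → Bool) → ℤ × ℤ → Prop} {q : ℝ} (hq : 0 ≤ q) (hq' : q ≤ 1 / 288) (N : ℕ)
    (hbad : ∀ T : Finset (ℤ × ℤ), (∀ z ∈ T, InBox N 0 z) →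
      bernProb p (fun ω => ∀ z ∈ T, bad ω z) ≤ q ^ T.card) :
    1 / 2 ≤ bernProb p (fun ω => ∀ n ≤ N, ¬ HierBad (bad ω) n 0) := by
  have h1 : ∀ n ∈ Finset.range (N + 1), bernProb p (fun ω => HierBad (bad ω) n 0) ≤
      (1 / 4) * (1 / 2) ^ n := by
    intro n hn
    rw [Finset.mem_range] at hn
    refine (bernProb_hierBad_le hp hq fun T hT =>
      hbad T fun z hz => (hT z hz).mono_zero (by omega)).trans ?_
    -- From `q ≤ 1 / 288` one has `72 * q ≤ 1 / 4`; the doubly exponential bounds are weakened to a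
    -- geometric series with sum at most `1 / 2`.
    have h2 : n + 1 ≤ 2 ^ n := Nat.lt_two_pow_self
    calc (72 * q) ^ 2 ^ n ≤ (1 / 4) ^ 2 ^ n := by gcongr; linarith
      _ ≤ (1 / 4) ^ (n + 1) := pow_le_pow_of_le_one (by norm_num) (by norm_num) h2
      _ = (1 / 4) * (1 / 4) ^ n := by rw [pow_succ]; ring
      _ ≤ _ := by gcongr; norm_num
  have h2 : bernProb p (fun ω => ¬ ∀ n ≤ N, ¬ HierBad (bad ω) n 0) ≤ 1 / 2 := by
    refine (bernProb_mono hp (Q := fun ω => ∃ n ∈ Finset.range (N + 1), HierBad (bad ω) n 0)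
      fun ω h => ?_).trans ((bernProb_exists_le hp _ _).trans ((Finset.sum_le_sum h1).trans ?_))
    · push Not at h
      obtain ⟨n, hn, h⟩ := h
      exact ⟨n, Finset.mem_range.mpr (by omega), h⟩
    · rw [← Finset.mul_sum, geom_sum_eq (by norm_num)]
      have : (0 : ℝ) ≤ (1 / 2) ^ (N + 1) := by positivity
      rw [show ((1 : ℝ) / 2 - 1) = -(1 / 2) by norm_num, div_neg]
      linarith
  rw [bernProb_compl] at h2
  linarith

open Classical in
/-- The good cluster of a good box. -/
def hierCluster (bad : ℤ × ℤ → Prop) : ℕ → ℤ × ℤ → Finset (ℤ × ℤ)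
  | 0, Q => {Q}
  | n + 1, Q => (Finset.univ.filter fun c => ¬ HierBad bad n (child Q c)).biUnion
      fun c => hierCluster bad n (child Q c)

variable {bad : ℤ × ℤ → Prop}

lemma hierCluster_child_subset {n : ℕ} {Q : ℤ × ℤ} {c : Fin 3 × Fin 3}
    (hc : ¬ HierBad bad n (child Q c)) :
    hierCluster bad n (child Q c) ⊆ hierCluster bad (n + 1) Q := by
  classical
  rw [hierCluster]
  exact Finset.subset_biUnion_of_mem (fun c => hierCluster bad n (child Q c))
    (Finset.mem_filter.mpr ⟨Finset.mem_univ _, hc⟩)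

lemma inBox_of_mem_hierCluster {n : ℕ} {Q z : ℤ × ℤ} (hz : z ∈ hierCluster bad n Q) :
    InBox n Q z := by
  classical
  induction n generalizing Q with
  | zero =>
    rw [hierCluster, Finset.mem_singleton] at hz
    subst hz
    simp [InBox]
  | succ n ih =>
    rw [hierCluster, Finset.mem_biUnion] at hz
    obtain ⟨c, -, hz⟩ := hz
    exact (ih hz).of_child

lemma exists_forall_ne_not_hierBad {n : ℕ} {Q : ℤ × ℤ} (h : ¬ HierBad bad (n + 1) Q) :
    ∃ c₀, ∀ c ≠ c₀, ¬ HierBad bad n (child Q c) := by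
  by_cases h' : ∃ c₀, HierBad bad n (child Q c₀)
  · obtain ⟨c₀, hc₀⟩ := h'
    exact ⟨c₀, fun c hc hbad => h ⟨c, c₀, hc, hbad, hc₀⟩⟩
  · push Not at h'
    -- Without a bad child, any index may be the exceptional one.
    exact ⟨(0, 0), fun c _ => h' c⟩

lemma hierCluster_nonempty {n : ℕ} {Q : ℤ × ℤ} (h : ¬ HierBad bad n Q) :
    (hierCluster bad n Q).Nonempty := by
  induction n generalizing Q with
  | zero => simp [hierCluster]
  | succ n ih =>
    obtain ⟨c₀, hc₀⟩ := exists_forall_ne_not_hierBad h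
    obtain ⟨c, hc⟩ := exists_ne c₀
    exact (ih (hc₀ c hc)).mono (hierCluster_child_subset (hc₀ c hc))

lemma line_connected {r : Fin 3 → Fin 3 → Prop} (hrefl : ∀ i, r i i)
    (hsymm : ∀ i j, r i j → r j i) (htrans : ∀ i j k, r i j → r j k → r i k) (h01 : r 0 1)
    (h12 : r 1 2) (i j : Fin 3) : r i j := by
  have h : ∀ i, r 1 i := by
    intro i
    fin_cases i
    · exact hsymm _ _ h01
    · exact hrefl _
    · exact h12
  exact htrans _ _ _ (hsymm _ _ (h i)) (h j)

/-- A `3 × 3` grid remains connected when one site is removed. -/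
lemma grid_connected {r : Fin 3 × Fin 3 → Fin 3 × Fin 3 → Prop} (c₀ : Fin 3 × Fin 3)
    (hrefl : ∀ c ≠ c₀, r c c) (hsymm : ∀ c d, r c d → r d c)
    (htrans : ∀ c, ∀ d ≠ c₀, ∀ e, r c d → r d e → r c e)
    (h1 : ∀ i i' j : Fin 3, (i' : ℕ) = i + 1 → (i, j) ≠ c₀ → (i', j) ≠ c₀ → r (i, j) (i', j))
    (h2 : ∀ i j j' : Fin 3, (j' : ℕ) = j + 1 → (i, j) ≠ c₀ → (i, j') ≠ c₀ → r (i, j) (i, j'))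
    {c d : Fin 3 × Fin 3} (hc : c ≠ c₀) (hd : d ≠ c₀) : r c d := by
  have hrow : ∀ j ≠ c₀.2, ∀ i i', r (i, j) (i', j) := by
    intro j hj
    have hne : ∀ i, (i, j) ≠ c₀ := fun i h => hj (by rw [← h])
    exact line_connected (fun i => hrefl _ (hne i)) (fun _ _ => hsymm _ _)
      (fun _ k _ => htrans _ _ (hne k) _) (h1 0 1 j rfl (hne _) (hne _))
      (h1 1 2 j rfl (hne _) (hne _))
  have hcol : ∀ i ≠ c₀.1, ∀ j j', r (i, j) (i, j') := by
    intro i hi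
    have hne : ∀ j, (i, j) ≠ c₀ := fun j h => hi (by rw [← h])
    exact line_connected (fun j => hrefl _ (hne j)) (fun _ _ => hsymm _ _)
      (fun _ k _ => htrans _ _ (hne k) _) (h2 i 0 1 rfl (hne _) (hne _))
      (h2 i 1 2 rfl (hne _) (hne _))
  -- A row and a column that avoid the removed site meet in a hub to which every other site is
  -- connected.
  obtain ⟨i₁, hi₁⟩ := exists_ne c₀.1
  obtain ⟨j₁, hj₁⟩ := exists_ne c₀.2
  have hroot : ∀ c ≠ c₀, r c (i₁, j₁) := by
    rintro ⟨i, j⟩ hc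
    by_cases hj : j = c₀.2
    · have hi : i ≠ c₀.1 := fun hi => hc (Prod.ext hi hj)
      exact htrans _ (i, j₁) (fun h => hi (by rw [← h])) _ (hcol i hi j j₁) (hrow j₁ hj₁ i i₁)
    · exact htrans _ (i₁, j) (fun h => hj (by rw [← h])) _ (hrow j hj i i₁) (hcol i₁ hi₁ j j₁)
  exact htrans _ _ (fun h => hi₁ (by rw [← h])) _ (hroot c hc) (hsymm _ _ (hroot d hd))

/-- The clusters of a good box and of its good neighbours are connected. -/
lemma hierCluster_connected {q : ℤ × ℤ → ℤ × ℤ → Prop} (hq : Equivalence q)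
    (h1 : ∀ z, ¬ bad z → ¬ bad (z + (1, 0)) → q z (z + (1, 0)))
    (h2 : ∀ z, ¬ bad z → ¬ bad (z + (0, 1)) → q z (z + (0, 1))) (n : ℕ) :
    (∀ Q, ¬ HierBad bad n Q → ∀ x ∈ hierCluster bad n Q, ∀ y ∈ hierCluster bad n Q, q x y) ∧
    (∀ Q, ∀ e ∈ ({(1, 0), (0, 1)} : Set (ℤ × ℤ)), ¬ HierBad bad n Q → ¬ HierBad bad n (Q + e) →
      ∀ x ∈ hierCluster bad n Q, ∀ y ∈ hierCluster bad n (Q + e), q x y) := by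
  classical
  induction n with
  | zero =>
    refine ⟨fun Q _ x hx y hy => ?_, fun Q e he hQ hQe x hx y hy => ?_⟩
    · rw [hierCluster, Finset.mem_singleton] at hx hy
      rw [hx, hy]
      exact hq.refl _
    · rw [hierCluster, Finset.mem_singleton] at hx hy
      rw [hx, hy]
      rcases he with rfl | rfl
      · exact h1 Q hQ hQe
      · exact h2 Q hQ hQe
  | succ n ih =>
    obtain ⟨ih1, ih2⟩ := ih
    have hin : ∀ Q, ¬ HierBad bad (n + 1) Q → ∀ x ∈ hierCluster bad (n + 1) Q,
        ∀ y ∈ hierCluster bad (n + 1) Q, q x y := by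
      intro Q hQ x hx y hy
      rw [hierCluster, Finset.mem_biUnion] at hx hy
      obtain ⟨c, hc, hx⟩ := hx
      obtain ⟨d, hd, hy⟩ := hy
      have hc := (Finset.mem_filter.mp hc).2
      have hd := (Finset.mem_filter.mp hd).2
      obtain ⟨c₀, hcc, hdc, hc₀⟩ : ∃ c₀, c ≠ c₀ ∧ d ≠ c₀ ∧
          ∀ c ≠ c₀, ¬ HierBad bad n (child Q c) := by
        by_cases h' : ∃ c₀, HierBad bad n (child Q c₀)
        · obtain ⟨c₀, hc₀⟩ := h'
          exact ⟨c₀, fun h => hc (h ▸ hc₀), fun h => hd (h ▸ hc₀), fun c hc hbad =>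
            hQ ⟨c, c₀, hc, hbad, hc₀⟩⟩
        · push Not at h'
          have : ∀ c d : Fin 3 × Fin 3, ∃ c₀, c ≠ c₀ ∧ d ≠ c₀ := by decide
          obtain ⟨c₀, h1, h2⟩ := this c d
          exact ⟨c₀, h1, h2, fun c _ => h' c⟩
      refine grid_connected (r := fun c d => ∀ x ∈ hierCluster bad n (child Q c),
        ∀ y ∈ hierCluster bad n (child Q d), q x y) c₀ (fun c hc => ih1 _ (hc₀ c hc))
        (fun c d h x hx y hy => hq.symm (h y hy x hx)) (fun c d hd e h h' x hx y hy => ?_)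
        (fun i i' j hi hc hd => ?_) (fun i j j' hj hc hd => ?_) hcc hdc x hx y hy
      -- Transitivity passes through a point of the middle cluster, so the middle child has to be
      -- good.
      · obtain ⟨w, hw⟩ := hierCluster_nonempty (hc₀ d hd)
        exact hq.trans (h x hx w hw) (h' w hw y hy)
      · have e : child Q (i', j) = child Q (i, j) + (1, 0) := by
          simp only [child, hi, Prod.mk_add_mk]
          push_cast
          exact Prod.ext (by ring) (by ring)
        have hc' := hc₀ _ hc
        have hd' := hc₀ _ hd
        rw [e] at hd' ⊢
        exact ih2 _ _ (Or.inl rfl) hc' hd'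
      · have e : child Q (i, j') = child Q (i, j) + (0, 1) := by
          simp only [child, hj, Prod.mk_add_mk]
          push_cast
          exact Prod.ext (by ring) (by ring)
        have hc' := hc₀ _ hc
        have hd' := hc₀ _ hd
        rw [e] at hd' ⊢
        exact ih2 _ _ (Or.inr rfl) hc' hd'
    refine ⟨hin, fun Q e he hQ hQe x hx y hy => ?_⟩
    obtain ⟨c, d, hc, hd, hcd⟩ : ∃ c d, ¬ HierBad bad n (child Q c) ∧
        ¬ HierBad bad n (child (Q + e) d) ∧ child (Q + e) d = child Q c + e := by
      obtain ⟨c₀, hc₀⟩ := exists_forall_ne_not_hierBad hQ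
      obtain ⟨d₀, hd₀⟩ := exists_forall_ne_not_hierBad hQe
      -- Three pairs of children face each other across the common side and each box has at most one
      -- bad child, so one pair consists of good children.
      have hk : ∀ a b : Fin 3, ∃ k, k ≠ a ∧ k ≠ b := by decide
      rcases he with rfl | rfl
      · obtain ⟨k, hk1, hk2⟩ := hk c₀.2 d₀.2
        refine ⟨(2, k), (0, k), hc₀ _ fun h => hk1 (by rw [← h]),
          hd₀ _ fun h => hk2 (by rw [← h]), ?_⟩
        refine Prod.ext ?_ ?_ <;> (simp [child]; try ring)
      · obtain ⟨k, hk1, hk2⟩ := hk c₀.1 d₀.1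
        refine ⟨(k, 2), (k, 0), hc₀ _ fun h => hk1 (by rw [← h]),
          hd₀ _ fun h => hk2 (by rw [← h]), ?_⟩
        refine Prod.ext ?_ ?_ <;> (simp [child]; try ring)
    obtain ⟨u, hu⟩ := hierCluster_nonempty hc
    obtain ⟨v, hv⟩ := hierCluster_nonempty hd
    have huv : q u v := by
      have hd' := hd
      rw [hcd] at hd' hv
      exact ih2 _ e he hc hd' u hu v hv
    exact hq.trans (hin Q hQ x hx u (hierCluster_child_subset hc hu))
      (hq.trans huv (hin _ hQe v (hierCluster_child_subset hd hv) y hy))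

/-- If all boxes around the origin are good, the origin is connected to a distant site. -/
theorem exists_far_connected {q : ℤ × ℤ → ℤ × ℤ → Prop} (hq : Equivalence q)
    (h1 : ∀ z, ¬ bad z → ¬ bad (z + (1, 0)) → q z (z + (1, 0)))
    (h2 : ∀ z, ¬ bad z → ¬ bad (z + (0, 1)) → q z (z + (0, 1))) (N : ℕ)
    (hgood : ∀ n ≤ N + 1, ¬ HierBad bad n 0) :
    ∃ z : ℤ × ℤ, 3 ^ N ≤ z.1 ∧ 0 ≤ z.2 ∧ q 0 z := by
  have hchild : child 0 (0, 0) = 0 := by simp [child]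
  -- The origin lies in the corner child at every level, and that child is good by hypothesis.
  have h0 : ∀ n ≤ N + 1, (0 : ℤ × ℤ) ∈ hierCluster bad n 0 := by
    intro n
    induction n with
    | zero => intro _; simp [hierCluster]
    | succ n ih =>
      intro hn
      have hb := hgood n (by omega)
      rw [← hchild] at hb
      have := hierCluster_child_subset hb
      rw [hchild] at this
      exact this (ih (by omega))
  obtain ⟨c₀, hc₀⟩ := exists_forall_ne_not_hierBad (hgood (N + 1) le_rfl)
  -- A good child in the middle column of the box of level `N + 1`: its sites have first coordinate
  -- at least `3 ^ N`.
  have hk : ∀ a : Fin 3 × Fin 3, ∃ k : Fin 3, (1, k) ≠ a := by decide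
  obtain ⟨k, hk⟩ := hk c₀
  obtain ⟨z, hz⟩ := hierCluster_nonempty (hc₀ _ hk)
  obtain ⟨hz1, hz2⟩ := inBox_of_mem_hierCluster hz
  simp only [child] at hz1 hz2
  refine ⟨z, ?_, ?_, (hierCluster_connected hq h1 h2 (N + 1)).1 0 (hgood _ le_rfl) 0
    (h0 _ le_rfl) z (hierCluster_child_subset (hc₀ _ hk) hz)⟩
  · have h3 := Int.mul_ediv_self_le (x := z.1) (k := 3 ^ N) (by positivity)
    rw [hz1] at h3
    simpa using h3
  · have h3 := Int.mul_ediv_self_le (x := z.2) (k := 3 ^ N) (by positivity)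
    rw [hz2] at h3
    refine le_trans ?_ h3
    simp only [Prod.snd_zero, mul_zero, zero_add]
    positivity

end Hierarchy

/-! ### The diagonal arrangement of the bricks in the lattice -/

section Embedding

/-- Bonds with distinct ends or kinds use up at most the coupling of their ends. -/
lemma sum_bonds_le_coupling {J : ℝ → ℝ} {γ ε δ : ℝ} (hJ : IsKacProfile J) (hγ : 0 < γ)
    (hε : 0 < ε) (hδ : δ ∈ Set.Icc (0 : ℝ) 1) {ι : Type*} [Fintype ι] (a b : ι → Site)
    (kind : ι → Bool) (hinj : Function.Injective fun i => (s(a i, b i), kind i)) (u v : Site) :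
    (∑ i, if a i = u ∧ b i = v then
        (if kind i then δ else 1 - δ) * coupling J γ ε (a i) (b i) else 0) +
      (∑ i, if a i = v ∧ b i = u then
        (if kind i then δ else 1 - δ) * coupling J γ ε (a i) (b i) else 0) ≤
      coupling J γ ε u v := by
  classical
  have hc := coupling_nonneg hJ hγ hε u v
  by_cases huv : u = v
  · subst huv
    have h0 : coupling J γ ε u u = 0 := by simp [coupling]
    have hz : ∀ i, (if a i = u ∧ b i = u then
        (if kind i then δ else 1 - δ) * coupling J γ ε (a i) (b i) else 0) = 0 := by
      intro i
      split_ifs with h h'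
      · rw [h.1, h.2, h0, mul_zero]
      · rw [h.1, h.2, h0, mul_zero]
      · rfl
    simp only [hz, Finset.sum_const_zero, add_zero, h0, le_refl]
  · rw [← Finset.sum_add_distrib]
    have h1 : ∀ i, ((if a i = u ∧ b i = v then
        (if kind i then δ else 1 - δ) * coupling J γ ε (a i) (b i) else 0) +
        (if a i = v ∧ b i = u then
        (if kind i then δ else 1 - δ) * coupling J γ ε (a i) (b i) else 0)) =
        if s(a i, b i) = s(u, v) then (if kind i then δ else 1 - δ) * coupling J γ ε u v else 0 := by
      intro i
      by_cases h : a i = u ∧ b i = v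
      · have h' : ¬ (a i = v ∧ b i = u) := fun h' => huv (h.1.symm.trans h'.1)
        rw [if_pos h, if_neg h', h.1, h.2, if_pos rfl, add_zero]
      · by_cases h' : a i = v ∧ b i = u
        · rw [if_neg h, if_pos h', h'.1, h'.2, if_pos Sym2.eq_swap, zero_add,
            coupling_symm hJ]
        · rw [if_neg h, if_neg h', if_neg, add_zero]
          rw [Sym2.eq_iff]
          tauto
    rw [Finset.sum_congr rfl fun i _ => h1 i, ← Finset.sum_filter, ← Finset.sum_mul]
    refine mul_le_of_le_one_left hc ?_
    -- At most one bond of each kind joins `u` and `v`, and the shares `δ` and `1 - δ` add up to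
    -- one.
    have hinj' : Set.InjOn kind (Finset.univ.filter fun i => s(a i, b i) = s(u, v) : Finset ι) := by
      intro i hi j hj hij
      have hi' := (Finset.mem_filter.mp hi).2
      have hj' := (Finset.mem_filter.mp hj).2
      exact hinj (Prod.ext (hi'.trans hj'.symm) hij)
    rw [← Finset.sum_image (f := fun β : Bool => if β then δ else 1 - δ) hinj']
    refine (Finset.sum_le_sum_of_subset_of_nonneg (Finset.subset_univ _) fun β _ _ => ?_).trans ?_
    · split_ifs <;> linarith [hδ.1, hδ.2]
    · simp

/-- The position of a column within its brick. -/
def colOff {R b : ℕ} (x : Col R b) : ℤ := (x.1 : ℕ) * b + (x.2 : ℕ)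

variable {R b : ℕ}

lemma colOff_nonneg (x : Col R b) : 0 ≤ colOff x := by
  unfold colOff
  positivity

lemma colOff_lt (x : Col R b) : colOff x < R * b := by
  have h1 : (x.1 : ℕ) + 1 ≤ R := x.1.2
  have h2 : (x.2 : ℕ) < b := x.2.2
  have h3 : (x.1 : ℕ) * b + x.2 < R * b := by
    calc (x.1 : ℕ) * b + x.2 < ((x.1 : ℕ) + 1) * b := by rw [Nat.add_mul, Nat.one_mul]; omega
      _ ≤ R * b := Nat.mul_le_mul_right _ h1
  unfold colOff
  exact_mod_cast h3

lemma int_mul_add_inj {L k k' o o' : ℤ} (ho : 0 ≤ o) (ho' : 0 ≤ o') (hoL : o < L) (hoL' : o' < L)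
    (h : k * L + o = k' * L + o') : k = k' ∧ o = o' := by
  have hk : k = k' := by
    rcases lt_trichotomy k k' with hlt | heq | hlt
    · nlinarith
    · exact heq
    · nlinarith
  subst hk
  exact ⟨rfl, by linarith⟩

lemma colOff_injective : Function.Injective (colOff (R := R) (b := b)) := by
  rintro ⟨x1, x2⟩ ⟨y1, y2⟩ h
  have h2 := x2.2
  have h2' := y2.2
  obtain ⟨h3, h4⟩ := int_mul_add_inj (Nat.cast_nonneg _) (Nat.cast_nonneg _)
    (by exact_mod_cast h2) (by exact_mod_cast h2') h
  exact Prod.ext (Fin.ext (by exact_mod_cast h3)) (Fin.ext (by exact_mod_cast h4))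

/-- The site with a given brick, layer (`true` for the top one) and column. -/
def brickSite (A : (ℤ × ℤ) × Bool × Col R b) : Site :=
  ((A.1.1 + A.1.2) * (R * b) + colOff A.2.2, A.1.1 - A.1.2 + if A.2.1 then 1 else 0)

/-- The first coordinate of a site determines the sum of the indices of its brick and the column.
The difference of the indices has the parity of the sum, so the second coordinate determines it
together with the layer. -/
lemma brickSite_injective : Function.Injective (brickSite (R := R) (b := b)) := by
  rintro ⟨⟨a, a'⟩, β, x⟩ ⟨⟨c, c'⟩, β', y⟩ h
  simp only [brickSite, Prod.mk.injEq] at h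
  obtain ⟨h1, h2⟩ := h
  obtain ⟨h3, h4⟩ := int_mul_add_inj (colOff_nonneg x) (colOff_nonneg y) (colOff_lt x)
    (colOff_lt y) h1
  have h5 := colOff_injective h4
  subst h5
  cases β <;> cases β' <;> simp at h2 ⊢ <;> omega

variable (R b) in
/-- The bonds of a finite set of bricks, and those from a brick to its two forward neighbours. -/
abbrev LatticeIdx (Z : Finset (ℤ × ℤ)) : Type :=
  (Z × BrickIdx R b) ⊕ (Z × Bool × Col R b × Col R b)

set_option synthInstance.maxSize 1000 in
instance decidableEqLatticeIdx (Z : Finset (ℤ × ℤ)) : DecidableEq (LatticeIdx R b Z) :=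
  inferInstance

/-- The two forward directions. -/
def forward (d : Bool) : ℤ × ℤ := if d then (0, 1) else (1, 0)

variable {Z : Finset (ℤ × ℤ)}

/-- The ends of a bond. -/
def bondEnds : LatticeIdx R b Z → ((ℤ × ℤ) × Bool × Col R b) × ((ℤ × ℤ) × Bool × Col R b)
  | .inl (z, .inl x) => ((z, false, x), (z, true, x))
  | .inl (z, .inr (.inl (e, β))) => ((z, β, (Quot.out e).1), (z, β, (Quot.out e).2))
  | .inl (z, .inr (.inr e)) => ((z, false, (Quot.out e).1), (z, false, (Quot.out e).2))
  | .inr (z, d, x, y) => ((z, !d, x), (z + forward d, d, y))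

/-- The additional bonds of the bottom layers. -/
def bondKind : LatticeIdx R b Z → Bool
  | .inl (_, .inr (.inr _)) => true
  | _ => false

lemma sym2_out {α : Type*} (e : Sym2 α) : s((Quot.out e).1, (Quot.out e).2) = e :=
  Quot.out_eq e

lemma sym2_out_congr {α : Type*} {e e' : Sym2 α}
    (h : ((Quot.out e).1 = (Quot.out e').1 ∧ (Quot.out e).2 = (Quot.out e').2) ∨
      ((Quot.out e).1 = (Quot.out e').2 ∧ (Quot.out e).2 = (Quot.out e').1)) : e = e' := by
  rw [← sym2_out e, ← sym2_out e']
  exact Sym2.eq_iff.mpr h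

/-- The condition of `sum_bonds_le_coupling`: vertical bonds, bonds within a layer and bonds between
bricks have different pairs of ends, and the additional bonds differ in kind. -/
lemma bondEnds_injective : Function.Injective fun i : LatticeIdx R b Z =>
    (s(brickSite (bondEnds i).1, brickSite (bondEnds i).2), bondKind i) := by
  intro i j h
  simp only [Prod.mk.injEq, Sym2.eq_iff, brickSite_injective.eq_iff] at h
  obtain ⟨h, hk⟩ := h
  have hzf : ∀ (z : ℤ × ℤ) d, z + forward d ≠ z := fun z d => by
    cases d <;> simp [forward]
  rcases i with ⟨⟨z, hz⟩, x | ⟨e, β⟩ | e⟩ | ⟨⟨z, hz⟩, d, x, y⟩ <;>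
  rcases j with ⟨⟨z', hz'⟩, x' | ⟨e', β'⟩ | e'⟩ | ⟨⟨z', hz'⟩, d', x', y'⟩ <;>
  simp only [bondEnds, bondKind, Prod.mk.injEq, reduceCtorEq] at h hk
  · rcases h with ⟨⟨rfl, -, rfl⟩, -⟩ | ⟨⟨-, h, -⟩, -⟩
    · rfl
    · exact h.elim
  · rcases h with ⟨⟨-, h, -⟩, -, h', -⟩ | ⟨⟨-, h, -⟩, -, h', -⟩ <;> simp [← h] at h'
  · exact (hzf z' d' (by rcases h with ⟨⟨h, -⟩, h', -⟩ | ⟨⟨h', -⟩, h, -⟩ <;> rw [← h', h])).elim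
  · rcases h with ⟨⟨-, h, -⟩, -, h', -⟩ | ⟨⟨-, h, -⟩, -, h', -⟩ <;> simp [h] at h'
  · obtain ⟨rfl, rfl⟩ : z = z' ∧ β = β' := by
      rcases h with ⟨⟨h, h', -⟩, -⟩ | ⟨⟨h, h', -⟩, -⟩ <;> exact ⟨h, h'⟩
    have : e = e' := sym2_out_congr (h.imp (fun h => ⟨h.1.2.2, h.2.2.2⟩)
      (fun h => ⟨h.1.2.2, h.2.2.2⟩))
    rw [this]
  · exact (hzf z' d' (by rcases h with ⟨⟨h, -⟩, h', -⟩ | ⟨⟨h', -⟩, h, -⟩ <;> rw [← h', h])).elim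
  · obtain rfl : z = z' := by
      rcases h with ⟨⟨h, -⟩, -⟩ | ⟨⟨h, -⟩, -⟩ <;> exact h
    have : e = e' := sym2_out_congr (h.imp (fun h => ⟨h.1.2.2, h.2.2.2⟩)
      (fun h => ⟨h.1.2.2, h.2.2.2⟩))
    rw [this]
  · exact (hzf z d (by rcases h with ⟨⟨h, -⟩, h', -⟩ | ⟨⟨h, -⟩, h', -⟩ <;> rw [h', h])).elim
  · exact (hzf z d (by rcases h with ⟨⟨h, -⟩, h', -⟩ | ⟨⟨h, -⟩, h', -⟩ <;> rw [h', h])).elim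
  · rcases h with ⟨⟨rfl, -, rfl⟩, -, rfl, rfl⟩ | ⟨⟨h, -⟩, h', -⟩
    · rfl
    -- Both bonds lead forward, so their ends cannot be exchanged.
    · exfalso
      rw [h, Prod.ext_iff] at h'
      cases d <;> cases d' <;> simp [forward] at h' <;> omega

end Embedding

/-! ### Sets of bad bricks have exponentially small probability -/

section LatticeProbability

/-- Independence of blocks of variables. -/
lemma bernMean_prod_curry {α β : Type*} [Fintype α] [DecidableEq α] [Fintype β] [DecidableEq β]
    (p : α × β → ℝ) (F : α → (β → Bool) → ℝ) :
    bernMean p (fun ω => ∏ a, F a fun i => ω (a, i)) =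
      ∏ a, bernMean (fun i => p (a, i)) (F a) := by
  simp only [bernMean]
  rw [Finset.prod_univ_sum, Fintype.piFinset_univ,
    ← Equiv.sum_comp (Equiv.curry α β Bool)]
  refine Finset.sum_congr rfl fun ω _ => ?_
  rw [Fintype.prod_prod_type, Finset.prod_mul_distrib]
  rfl

variable {R b : ℕ} {Z : Finset (ℤ × ℤ)}

open Classical in
/-- A core of a brick, if there is one. -/
def brickCore (ρ : ℝ) (ω : BrickIdx R b → Bool) : Finset (Col R b) :=
  if h : ∃ C, IsBrickCore ρ ω C then h.choose else ∅

lemma isBrickCore_brickCore {ρ : ℝ} {ω : BrickIdx R b → Bool} (h : ∃ C, IsBrickCore ρ ω C) :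
    IsBrickCore ρ ω (brickCore ρ ω) := by
  rw [brickCore, dif_pos h]
  exact h.choose_spec

/-- The vertically open columns of the core in a given block. -/
def coreBlock (ρ : ℝ) (ω : BrickIdx R b → Bool) (j : Fin R) : Finset (Col R b) :=
  (brickCore ρ ω).filter fun x => x.1 = j ∧ ω (.inl x) = true

/-- A brick is bad if it has no core or if its core is not joined to that of a forward neighbour. -/
def LatticeBad (ρ : ℝ) (jf jl : Fin R) (v : Z × BrickIdx R b → Bool)
    (w : Z × Bool × Col R b × Col R b → Bool) (z : ℤ × ℤ) : Prop :=
  ∀ hz : z ∈ Z, (¬ ∃ C, IsBrickCore ρ (fun i => v (⟨z, hz⟩, i)) C) ∨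
    ∃ d, ∃ hd : z + forward d ∈ Z,
      (∃ C, IsBrickCore ρ (fun i => v (⟨z + forward d, hd⟩, i)) C) ∧
      ∀ x ∈ coreBlock ρ (fun i => v (⟨z, hz⟩, i)) jl,
        ∀ y ∈ coreBlock ρ (fun i => v (⟨z + forward d, hd⟩, i)) jf,
          w (⟨z, hz⟩, d, x, y) = false

/-- Only forward crossings are tested, so given the bricks the badness of different sites is decided
by disjoint sets of crossing edges. -/
lemma dependsOn_latticeBad (ρ : ℝ) (jf jl : Fin R) (v : Z × BrickIdx R b → Bool) (z : ℤ × ℤ) :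
    DependsOn (fun w => LatticeBad ρ jf jl v w z) {i | (i.1 : ℤ × ℤ) = z} := by
  intro w w' h
  have h' : ∀ (hz : z ∈ Z) d x y, w (⟨z, hz⟩, d, x, y) = w' (⟨z, hz⟩, d, x, y) :=
    fun hz d x y => h _ rfl
  simp only [LatticeBad, h']

lemma bernProb_no_crossing_le {p : Z × Bool × Col R b × Col R b → ℝ}
    (hp : ∀ i, p i ∈ Set.Icc (0 : ℝ) 1) (z : Z) (d : Bool) (X Y : Finset (Col R b)) {ρ s : ℝ}
    (hb : 0 < b) (hρ : 0 ≤ ρ) (hs : 0 ≤ s) (hX : ρ * b ≤ X.card) (hY : ρ * b ≤ Y.card)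
    (hpXY : ∀ x ∈ X, ∀ y ∈ Y, s / b ≤ p (z, d, x, y)) :
    bernProb p (fun w => ∀ x ∈ X, ∀ y ∈ Y, w (z, d, x, y) = false) ≤
      Real.exp (-(s * ρ ^ 2 * b)) := by
  classical
  have hb' : (0 : ℝ) < b := by exact_mod_cast hb
  set E : Finset (Z × Bool × Col R b × Col R b) :=
    (X ×ˢ Y).map ⟨fun q => (z, d, q.1, q.2), fun q q' h => by
      simp only [Prod.mk.injEq, true_and] at h
      exact Prod.ext h.1 h.2⟩ with hE
  refine (bernProb_mono hp (Q := fun w => ∀ i ∈ E, w i = false) fun w h i hi => ?_).trans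
    ((bernProb_forall_closed_le hp E).trans ?_)
  · obtain ⟨q, hq, rfl⟩ := Finset.mem_map.mp hi
    exact h _ (Finset.mem_product.mp hq).1 _ (Finset.mem_product.mp hq).2
  · refine Real.exp_le_exp.mpr (neg_le_neg ?_)
    rw [hE, Finset.sum_map]
    have h1 := Finset.card_nsmul_le_sum (X ×ˢ Y) (fun q => p (z, d, q.1, q.2)) (s / b)
      (fun q hq => hpXY _ (Finset.mem_product.mp hq).1 _ (Finset.mem_product.mp hq).2)
    rw [Finset.card_product, nsmul_eq_mul] at h1
    refine le_trans ?_ h1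
    push_cast
    calc s * ρ ^ 2 * b = (ρ * b) * (ρ * b) * (s / b) := by field_simp
      _ ≤ X.card * Y.card * (s / b) := by gcongr

open Classical in
/-- Given the bricks, a brick with a core is bad with small probability. -/
lemma bernProb_latticeBad_le {p : Z × Bool × Col R b × Col R b → ℝ}
    (hp : ∀ i, p i ∈ Set.Icc (0 : ℝ) 1) {ρ s η : ℝ} {jf jl : Fin R}
    (hb : 0 < b) (hρ : 0 ≤ ρ) (hs : 0 ≤ s)
    (hps : ∀ z d x y, x.1 = jl → y.1 = jf → s / b ≤ p (z, d, x, y))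
    (hη : Real.exp (-(s * ρ ^ 2 * b)) ≤ η) (v : Z × BrickIdx R b → Bool) (z : Z) :
    bernProb p (fun w => LatticeBad ρ jf jl v w z) ≤
      (if ¬ ∃ C, IsBrickCore ρ (fun i => v (z, i)) C then 1 else 0) + 2 * η := by
  have hη0 : 0 ≤ η := (Real.exp_pos _).le.trans hη
  by_cases hc : ∃ C, IsBrickCore ρ (fun i => v (z, i)) C
  · rw [if_neg (not_not_intro hc), zero_add]
    let P : Bool → (Z × Bool × Col R b × Col R b → Bool) → Prop := fun d w =>
      ∃ hd : (z : ℤ × ℤ) + forward d ∈ Z,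
      (∃ C, IsBrickCore ρ (fun i => v (⟨z + forward d, hd⟩, i)) C) ∧
      ∀ x ∈ coreBlock ρ (fun i => v (z, i)) jl,
        ∀ y ∈ coreBlock ρ (fun i => v (⟨z + forward d, hd⟩, i)) jf,
          w (z, d, x, y) = false
    have hP : ∀ d, bernProb p (P d) ≤ η := by
      intro d
      by_cases hd : ∃ hd : (z : ℤ × ℤ) + forward d ∈ Z,
          ∃ C, IsBrickCore ρ (fun i => v (⟨z + forward d, hd⟩, i)) C
      · obtain ⟨hd, hC⟩ := hd
        refine (bernProb_mono hp fun w (hw : P d w) => ?_).trans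
          ((bernProb_no_crossing_le hp z d (coreBlock ρ (fun i => v (z, i)) jl)
            (coreBlock ρ (fun i => v (⟨z + forward d, hd⟩, i)) jf) hb hρ hs
            ((isBrickCore_brickCore hc).2 jl) ((isBrickCore_brickCore hC).2 jf)
            (fun x hx y hy => hps z d x y (Finset.mem_filter.mp hx).2.1
              (Finset.mem_filter.mp hy).2.1)).trans hη)
        obtain ⟨_, _, hw⟩ := hw
        exact hw
      · refine (bernProb_mono hp (Q := fun _ => False) fun w (hw : P d w) => ?_).trans ?_
        · obtain ⟨h, h', -⟩ := hw
          exact hd ⟨h, h'⟩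
        · rwa [bernProb_false]
    refine (bernProb_mono hp (Q := fun w => P false w ∨ P true w) fun w hw => ?_).trans
      ((bernProb_or_le hp _ _).trans (by linarith [hP false, hP true]))
    rcases hw z.2 with h | ⟨d, h⟩
    · exact absurd hc h
    · cases d
      · exact Or.inl h
      · exact Or.inr h
  · rw [if_pos hc]
    have := bernProb_le_one hp (fun w => LatticeBad ρ jf jl v w z)
    linarith

set_option synthInstance.maxSize 1000 in
/-- Sets of bricks are bad with exponentially small probability. -/
theorem bernProb_forall_latticeBad_le {p₁ : Z × BrickIdx R b → ℝ}
    {p₂ : Z × Bool × Col R b × Col R b → ℝ} (hp₁ : ∀ i, p₁ i ∈ Set.Icc (0 : ℝ) 1)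
    (hp₂ : ∀ i, p₂ i ∈ Set.Icc (0 : ℝ) 1) {ρ s η η' : ℝ} {jf jl : Fin R}
    (hb : 0 < b) (hρ : 0 ≤ ρ) (hs : 0 ≤ s)
    (hbrick : ∀ z, bernProb (fun i => p₁ (z, i)) (fun ω => ¬ ∃ C, IsBrickCore ρ ω C) ≤ η)
    (hps : ∀ z d x y, x.1 = jl → y.1 = jf → s / b ≤ p₂ (z, d, x, y))
    (hη : Real.exp (-(s * ρ ^ 2 * b)) ≤ η') {T : Finset (ℤ × ℤ)} (hT : T ⊆ Z) :
    bernProb (Sum.elim p₁ p₂) (fun ω => ∀ z ∈ T,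
      LatticeBad ρ jf jl (fun i => ω (.inl i)) (fun i => ω (.inr i)) z) ≤ (η + 2 * η') ^ T.card := by
  classical
  have hη0 : 0 ≤ η' := (Real.exp_pos _).le.trans hη
  have hsub : ∀ f : ℤ × ℤ → ℝ, ∏ z ∈ T, f z = ∏ z : Z, if (z : ℤ × ℤ) ∈ T then f z else 1 := by
    intro f
    rw [Finset.prod_coe_sort Z (fun z => if z ∈ T then f z else 1), Finset.prod_ite_mem,
      Finset.inter_eq_right.mpr hT]
  -- A bound for the conditional probability that depends on the brick `z` alone, because a missing
  -- core of a neighbour does not make `z` bad. The average over the bricks then factorizes.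
  let G : Z → (BrickIdx R b → Bool) → ℝ := fun z ω => if (z : ℤ × ℤ) ∈ T then
    (if ¬ ∃ C, IsBrickCore ρ ω C then 1 else 0) + 2 * η' else 1
  have hG : ∀ z : Z, bernMean (fun i => p₁ (z, i)) (G z) ≤
      if (z : ℤ × ℤ) ∈ T then η + 2 * η' else 1 := by
    intro z
    by_cases hz : (z : ℤ × ℤ) ∈ T
    · simp only [G, if_pos hz]
      rw [bernMean_add, bernMean_const, ← bernProb_eq]
      linarith [hbrick z]
    · simp only [G, if_neg hz]
      rw [bernMean_const]
  have hG0 : ∀ z ω, 0 ≤ G z ω := by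
    intro z ω
    simp only [G]
    split_ifs <;> linarith
  rw [bernProb_eq, bernMean_sum_elim]
  calc bernMean p₁ (fun v => bernMean p₂ fun w => if ∀ z ∈ T, LatticeBad ρ jf jl
          (fun i => Sum.elim v w (.inl i)) (fun i => Sum.elim v w (.inr i)) z then 1 else 0)
      ≤ bernMean p₁ (fun v => ∏ z : Z, G z fun i => v (z, i)) := by
        refine bernMean_mono hp₁ fun v => ?_
        simp only [Sum.elim_inl, Sum.elim_inr]
        have h1 := bernProb_forall_of_dependsOn p₂ T
          (P := fun z w => LatticeBad ρ jf jl v w z) (S := fun z => {i | (i.1 : ℤ × ℤ) = z})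
          (fun z _ => dependsOn_latticeBad ρ jf jl v z)
          (fun z _ z' _ hzz => Set.disjoint_left.mpr fun i hi hi' => hzz (hi.symm.trans hi'))
        rw [bernProb_eq, hsub] at h1
        refine le_trans (le_of_eq ?_) (h1.le.trans (Finset.prod_le_prod (fun z _ => ?_)
          fun z _ => ?_))
        · congr
        · split_ifs
          · exact bernProb_nonneg hp₂ _
          · exact zero_le_one
        · by_cases hz : (z : ℤ × ℤ) ∈ T
          · simp only [G, if_pos hz]
            exact bernProb_latticeBad_le hp₂ hb hρ hs hps hη v z
          · simp only [G, if_neg hz, le_refl]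
    _ = ∏ z : Z, bernMean (fun i => p₁ (z, i)) (G z) := bernMean_prod_curry p₁ G
    _ ≤ ∏ z : Z, if (z : ℤ × ℤ) ∈ T then η + 2 * η' else 1 := by
        refine Finset.prod_le_prod (fun z _ => ?_) fun z _ => hG z
        have := bernMean_mono (fun i => hp₁ (z, i)) (f := fun _ => 0) (g := G z) (hG0 z)
        rwa [bernMean_const] at this
    _ = (η + 2 * η') ^ T.card := by
        rw [← hsub (fun _ => η + 2 * η'), Finset.prod_const]

end LatticeProbability

/-! ### From good bricks to long connections and to the magnetization -/

section LatticePercolation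

lemma equivalence_openConn {ι : Type*} (a b : ι → Site) (ω : ι → Bool) :
    Equivalence (OpenConn a b ω) where
  refl _ := Relation.ReflTransGen.refl
  symm h := by
    induction h with
    | refl => exact Relation.ReflTransGen.refl
    | tail _ h ih =>
      obtain ⟨i, hi, h⟩ := h
      exact Relation.ReflTransGen.head ⟨i, hi, h.symm⟩ ih
  trans h h' := h.trans h'

lemma openConn_of_open {ι : Type*} {a b : ι → Site} {ω : ι → Bool} {i : ι} (h : ω i = true) :
    OpenConn a b ω (a i) (b i) :=
  Relation.ReflTransGen.single ⟨i, h, Or.inl ⟨rfl, rfl⟩⟩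

variable {R b : ℕ} {Z : Finset (ℤ × ℤ)}

/-- Two sites are joined by open bonds of the lattice of bricks. -/
def LatticeConn (ω : LatticeIdx R b Z → Bool) : Site → Site → Prop :=
  OpenConn (fun i => brickSite (bondEnds i).1) (fun i => brickSite (bondEnds i).2) ω

lemma latticeConn_vertical {ω : LatticeIdx R b Z → Bool} {z : Z} {x : Col R b}
    (h : ω (.inl (z, .inl x)) = true) :
    LatticeConn ω (brickSite ((z : ℤ × ℤ), false, x)) (brickSite ((z : ℤ × ℤ), true, x)) :=
  openConn_of_open (a := fun i => brickSite (bondEnds i).1) h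

lemma sym2_out_mk {α : Type*} (x y : α) :
    Quot.out s(x, y) = (x, y) ∨ Quot.out s(x, y) = (y, x) := by
  have h := sym2_out s(x, y)
  rcases Sym2.eq_iff.mp h with ⟨h1, h2⟩ | ⟨h1, h2⟩
  · exact Or.inl (Prod.ext h1 h2)
  · exact Or.inr (Prod.ext h1 h2)

lemma latticeConn_horizontal {ω : LatticeIdx R b Z → Bool} {z : Z} {x y : Col R b} {β : Bool}
    (h : ω (.inl (z, .inr (.inl (s(x, y), β)))) = true) :
    LatticeConn ω (brickSite ((z : ℤ × ℤ), β, x)) (brickSite ((z : ℤ × ℤ), β, y)) := by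
  have h1 := openConn_of_open (a := fun i => brickSite (bondEnds i).1)
    (b := fun i => brickSite (bondEnds i).2) h
  simp only [bondEnds] at h1
  rcases sym2_out_mk x y with he | he
  · rw [he] at h1
    exact h1
  · rw [he] at h1
    exact (equivalence_openConn _ _ ω).symm h1

lemma latticeConn_additional {ω : LatticeIdx R b Z → Bool} {z : Z} {x y : Col R b}
    (h : ω (.inl (z, .inr (.inr s(x, y)))) = true) :
    LatticeConn ω (brickSite ((z : ℤ × ℤ), false, x)) (brickSite ((z : ℤ × ℤ), false, y)) := by
  have h1 := openConn_of_open (a := fun i => brickSite (bondEnds i).1)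
    (b := fun i => brickSite (bondEnds i).2) h
  simp only [bondEnds] at h1
  rcases sym2_out_mk x y with he | he
  · rw [he] at h1
    exact h1
  · rw [he] at h1
    exact (equivalence_openConn _ _ ω).symm h1

lemma latticeConn_of_eqvGen {ω : LatticeIdx R b Z → Bool} {z : Z} {x y : Col R b}
    (h : Relation.EqvGen (ColAdj fun i => ω (.inl (z, i))) x y) :
    LatticeConn ω (brickSite ((z : ℤ × ℤ), false, x)) (brickSite ((z : ℤ × ℤ), false, y)) := by
  have hE := equivalence_openConn (fun i => brickSite (bondEnds i).1)
    (fun i => brickSite (bondEnds i).2) ω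
  induction h with
  | refl x => exact hE.refl _
  | symm x y _ ih => exact hE.symm ih
  | trans x y z _ _ ih ih' => exact hE.trans ih ih'
  | rel x y h =>
    rcases h with h | ⟨hx, hy, h⟩ | h
    · exact latticeConn_horizontal h
    · exact hE.trans (latticeConn_vertical hx)
        (hE.trans (latticeConn_horizontal h) (hE.symm (latticeConn_vertical hy)))
    · exact latticeConn_additional h

/-- The cores of adjacent good bricks are connected. -/
lemma latticeConn_of_not_latticeBad {ω : LatticeIdx R b Z → Bool} {ρ : ℝ} {jf jl : Fin R}
    {z : ℤ × ℤ} {d : Bool}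
    (h : ¬ LatticeBad ρ jf jl (fun i => ω (.inl i)) (fun i => ω (.inr i)) z)
    (h' : ¬ LatticeBad ρ jf jl (fun i => ω (.inl i)) (fun i => ω (.inr i)) (z + forward d))
    (hz : z ∈ Z) (hd : z + forward d ∈ Z) {x y : Col R b}
    (hx : x ∈ brickCore ρ fun i => ω (.inl (⟨z, hz⟩, i)))
    (hy : y ∈ brickCore ρ fun i => ω (.inl (⟨z + forward d, hd⟩, i))) :
    LatticeConn ω (brickSite (z, false, x)) (brickSite (z + forward d, false, y)) := by
  have hE := equivalence_openConn (fun i => brickSite (bondEnds i).1)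
    (fun i => brickSite (bondEnds i).2) ω
  simp only [LatticeBad, not_forall, not_or, not_not, not_exists, not_and] at h h'
  obtain ⟨_, hC, hcross⟩ := h
  obtain ⟨_, hC', -⟩ := h'
  obtain ⟨x', hx', y', hy', hw⟩ := hcross d hd hC'
  obtain ⟨hx'C, -, hx'v⟩ := Finset.mem_filter.mp hx'
  obtain ⟨hy'C, -, hy'v⟩ := Finset.mem_filter.mp hy'
  have hw' : ω (.inr (⟨z, hz⟩, d, x', y')) = true := by simpa using hw
  have h1 : LatticeConn ω (brickSite (z, false, x)) (brickSite (z, false, x')) :=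
    latticeConn_of_eqvGen (z := ⟨z, hz⟩) ((isBrickCore_brickCore hC).1 x hx x' hx'C)
  have h2 : LatticeConn ω (brickSite (z + forward d, false, y'))
      (brickSite (z + forward d, false, y)) :=
    latticeConn_of_eqvGen (z := ⟨z + forward d, hd⟩)
      ((isBrickCore_brickCore hC').1 y' hy'C y hy)
  have h3 : LatticeConn ω (brickSite (z, !d, x')) (brickSite (z + forward d, d, y')) :=
    openConn_of_open (a := fun i => brickSite (bondEnds i).1) hw'
  have h4 : LatticeConn ω (brickSite (z, false, x')) (brickSite (z, true, x')) :=
    latticeConn_vertical (z := ⟨z, hz⟩) hx'v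
  have h5 : LatticeConn ω (brickSite (z + forward d, false, y'))
      (brickSite (z + forward d, true, y')) :=
    latticeConn_vertical (z := ⟨z + forward d, hd⟩) hy'v
  -- In one direction the path climbs to the top layer before it crosses to the bottom layer of the
  -- neighbour; in the other it crosses into the top layer of the neighbour and then descends.
  cases d
  · exact hE.trans h1 (hE.trans h4 (hE.trans h3 h2))
  · exact hE.trans h1 (hE.trans h3 (hE.trans (hE.symm h5) h2))

lemma brickCore_nonempty {ρ : ℝ} {ω : BrickIdx R b → Bool} (hρ : 0 < ρ) (hb : 0 < b) (j : Fin R)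
    (h : ∃ C, IsBrickCore ρ ω C) : (brickCore ρ ω).Nonempty := by
  have hb' : (0 : ℝ) < b := by exact_mod_cast hb
  have h1 := (isBrickCore_brickCore h).2 j
  have h2 : (0 : ℝ) < ((brickCore ρ ω).filter fun x => x.1 = j ∧ ω (.inl x) = true).card :=
    lt_of_lt_of_le (by positivity) h1
  have h3 : 0 < ((brickCore ρ ω).filter fun x => x.1 = j ∧ ω (.inl x) = true).card := by
    exact_mod_cast h2
  exact (Finset.card_pos.mp h3).mono (Finset.filter_subset _ _)

/-- If all boxes around the origin are good, the brick at the origin is connected to distant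
sites. -/
lemma exists_latticeConn_far {ω : LatticeIdx R b Z → Bool} {ρ : ℝ} {jf jl : Fin R} (hρ : 0 < ρ)
    (hb : 0 < b) (N : ℕ)
    (hgood : ∀ n ≤ N + 1, ¬ HierBad
      (LatticeBad ρ jf jl (fun i => ω (.inl i)) (fun i => ω (.inr i))) n 0) :
    ∃ (x : Col R b) (w : Site), 3 ^ N ≤ w.1 ∧ LatticeConn ω (brickSite (0, false, x)) w := by
  classical
  have hE := equivalence_openConn (fun i => brickSite (bondEnds i).1)
    (fun i => brickSite (bondEnds i).2) ω
  let c : ℤ × ℤ → Col R b := fun z =>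
    if h : ∃ x, ∃ hz : z ∈ Z, x ∈ brickCore ρ fun i => ω (.inl (⟨z, hz⟩, i)) then h.choose
    else (jf, ⟨0, hb⟩)
  have hc : ∀ z, ¬ LatticeBad ρ jf jl (fun i => ω (.inl i)) (fun i => ω (.inr i)) z →
      ∃ hz : z ∈ Z, c z ∈ brickCore ρ fun i => ω (.inl (⟨z, hz⟩, i)) := by
    intro z hz
    have hz' := hz
    simp only [LatticeBad, not_forall, not_or, not_not] at hz'
    -- Sites outside `Z` are bad by the form of `LatticeBad`, so a good site lies in `Z`.
    obtain ⟨hzZ, hC, -⟩ := hz'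
    obtain ⟨x, hx⟩ := brickCore_nonempty hρ hb jf hC
    have h : ∃ x, ∃ hz : z ∈ Z, x ∈ brickCore ρ fun i => ω (.inl (⟨z, hz⟩, i)) := ⟨x, hzZ, hx⟩
    have hcz : c z = h.choose := dif_pos h
    rw [hcz]
    exact h.choose_spec
  have hstep : ∀ z d,
      ¬ LatticeBad ρ jf jl (fun i => ω (.inl i)) (fun i => ω (.inr i)) z →
      ¬ LatticeBad ρ jf jl (fun i => ω (.inl i)) (fun i => ω (.inr i)) (z + forward d) →
      LatticeConn ω (brickSite (z, false, c z))
        (brickSite (z + forward d, false, c (z + forward d))) := by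
    intro z d h h'
    obtain ⟨hz, hx⟩ := hc z h
    obtain ⟨hd, hy⟩ := hc _ h'
    exact latticeConn_of_not_latticeBad h h' hz hd hx hy
  obtain ⟨z, hz1, hz2, hz⟩ := exists_far_connected
    (q := fun z z' => LatticeConn ω (brickSite (z, false, c z)) (brickSite (z', false, c z')))
    ⟨fun _ => hE.refl _, fun h => hE.symm h, fun h h' => hE.trans h h'⟩
    (fun z => hstep z false) (fun z => hstep z true) N hgood
  refine ⟨c 0, _, ?_, hz⟩
  have h1 := colOff_nonneg (c z)
  have h2 := colOff_lt (c z)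
  have h3 : (1 : ℤ) ≤ R * b := by linarith
  have h4 : (0 : ℤ) ≤ 3 ^ N := by positivity
  simp only [brickSite]
  nlinarith

lemma InBox.bounds {n : ℕ} {z : ℤ × ℤ} (h : InBox n 0 z) :
    z ∈ Finset.Ico (0 : ℤ) (3 ^ n) ×ˢ Finset.Ico (0 : ℤ) (3 ^ n) := by
  have hpos : (0 : ℤ) < 3 ^ n := by positivity
  have key : ∀ a : ℤ, a / 3 ^ n = 0 → a ∈ Finset.Ico (0 : ℤ) (3 ^ n) := by
    intro a ha
    have h1 := Int.emod_nonneg a hpos.ne'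
    have h2 := Int.emod_lt_of_pos a hpos
    have h3 := Int.mul_ediv_add_emod a (3 ^ n)
    rw [ha, mul_zero, zero_add] at h3
    rw [Finset.mem_Ico, ← h3]
    exact ⟨h1, h2⟩
  exact Finset.mem_product.mpr ⟨key _ h.1, key _ h.2⟩

/-- The coupling assigned to a bond. -/
def bondCoupling (J : ℝ → ℝ) (γ ε δ : ℝ) (i : LatticeIdx R b Z) : ℝ :=
  (if bondKind i then δ else 1 - δ) *
    coupling J γ ε (brickSite (bondEnds i).1) (brickSite (bondEnds i).2)

/-- If bricks have cores, and adjacent cores are joined, with high probability, then the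
magnetization of the plus state is bounded from below. -/
theorem half_le_sum_gibbsMean {J : ℝ → ℝ} {γ ε δ : ℝ} (hJ : IsKacProfile J) (hγ : 0 < γ)
    (hε : 0 < ε) (hδ : δ ∈ Set.Icc (0 : ℝ) 1) (hb : 0 < b) {ρ s η η' : ℝ} {jf jl : Fin R}
    (hρ : 0 < ρ) (hs : 0 ≤ s)
    (hbrick : ∀ (Z : Finset (ℤ × ℤ)) (z : Z),
      bernProb (fun i => Real.tanh (bondCoupling (Z := Z) J γ ε δ (.inl (z, i))))
        (fun ω : BrickIdx R b → Bool => ¬ ∃ C, IsBrickCore ρ ω C) ≤ η)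
    (hcross : ∀ (Z : Finset (ℤ × ℤ)) (z : Z) (d : Bool) (x y : Col R b), x.1 = jl → y.1 = jf →
      s / b ≤ Real.tanh (bondCoupling (Z := Z) J γ ε δ (.inr (z, d, x, y))))
    (hη : Real.exp (-(s * ρ ^ 2 * b)) ≤ η') (hq0 : 0 ≤ η) (hq : η + 2 * η' ≤ 1 / 288)
    (Λ : Finset Site) :
    1 / 2 ≤ ∑ v ∈ (Finset.univ : Finset (Col R b)).image fun x => brickSite (0, false, x),
      gibbsMean J γ ε Λ plusConfig (spinProd {v}) := by
  classical
  set Q : Finset Site := (Finset.univ : Finset (Col R b)).image fun x => brickSite (0, false, x)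
  have hη0 : 0 ≤ η' := (Real.exp_pos _).le.trans hη
  -- Since `N < 3 ^ N`, a site with first coordinate at least `3 ^ N` is outside `Λ`.
  set N : ℕ := Λ.sup fun w => w.1.toNat with hN
  set Z : Finset (ℤ × ℤ) := Finset.Ico (0 : ℤ) (3 ^ (N + 1)) ×ˢ Finset.Ico (0 : ℤ) (3 ^ (N + 1))
  let K : LatticeIdx R b Z → ℝ := bondCoupling J γ ε δ
  have hK0 : ∀ i, 0 ≤ K i := fun i => mul_nonneg
    (by split_ifs <;> linarith [hδ.1, hδ.2]) (coupling_nonneg hJ hγ hε _ _)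
  have hp : ∀ i, Real.tanh (K i) ∈ Set.Icc (0 : ℝ) 1 := fun i => tanh_mem_Icc (hK0 i)
  let bad : (LatticeIdx R b Z → Bool) → ℤ × ℤ → Prop := fun ω =>
    LatticeBad ρ jf jl (fun i => ω (.inl i)) (fun i => ω (.inr i))
  have hhier := half_le_bernProb_not_hierBad hp (bad := bad) (add_nonneg hq0 (by linarith)) hq
    (N + 1) (fun T hT => by
      have hTZ : T ⊆ Z := fun z hz => (hT z hz).bounds
      have h := bernProb_forall_latticeBad_le (Z := Z) (fun i => hp (.inl i)) (fun i => hp (.inr i))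
        hb hρ.le hs (hbrick Z) (hcross Z) hη hTZ
      have he : (fun i => Real.tanh (K i)) = Sum.elim (fun i => Real.tanh (K (.inl i)))
          (fun i => Real.tanh (K (.inr i))) := by
        funext i
        rcases i with i | i <;> rfl
      rw [he]
      convert h)
  refine hhier.trans ((bernProb_mono hp (Q := fun ω => ∃ v ∈ Q, ∃ w, w ∉ Λ ∧
    LatticeConn ω v w) fun ω hω => ?_).trans ((bernProb_exists_le hp _ _).trans
      (Finset.sum_le_sum fun v _ => ?_)))
  · obtain ⟨x, w, hw, hconn⟩ := exists_latticeConn_far hρ hb N hω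
    refine ⟨_, Finset.mem_image_of_mem _ (Finset.mem_univ x), w, fun hwΛ => ?_, hconn⟩
    have h1 : w.1.toNat ≤ N := Finset.le_sup (f := fun w : Site => w.1.toNat) hwΛ
    have h2 : N < 3 ^ N := Nat.lt_pow_self (by norm_num)
    have h3 : (N : ℤ) < 3 ^ N := by exact_mod_cast h2
    omega
  · rw [bernProb_eq]
    have := connectionProbability_le_gibbsMean_plus (ε := ε) hJ hγ
      (fun i : LatticeIdx R b Z => brickSite (bondEnds i).1) (fun i => brickSite (bondEnds i).2) K
      hK0 (sum_bonds_le_coupling hJ hγ hε hδ _ _ bondKind bondEnds_injective) Λ v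
    refine le_trans (le_of_eq ?_) this
    rfl

end LatticePercolation

/-! ### The Kac kernel at block scale and a profile that it almost preserves -/

section Kernel

variable {J : ℝ → ℝ} {γ : ℝ}

lemma IsKacProfile.hasCompactSupport (hJ : IsKacProfile J) : HasCompactSupport J :=
  HasCompactSupport.of_support_subset_isCompact isCompact_Icc hJ.support_subset

lemma IsKacProfile.eq_zero (hJ : IsKacProfile J) {r : ℝ} (hr : 1 < |r|) : J r = 0 := by
  by_contra h
  have := hJ.support_subset (Function.mem_support.mpr h)
  have h2 := abs_le.mpr ⟨this.1, this.2⟩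
  linarith

lemma IsKacProfile.exists_bound (hJ : IsKacProfile J) : ∃ M, 0 < M ∧ ∀ r, J r ≤ M := by
  obtain ⟨M, hM⟩ := hJ.contDiff.continuous.bddAbove_range_of_hasCompactSupport hJ.hasCompactSupport
  have h : ∀ r, J r ≤ M := fun r => hM ⟨r, rfl⟩
  exact ⟨M, hJ.pos_zero.trans_le (h 0), h⟩

lemma IsKacProfile.exists_modulus (hJ : IsKacProfile J) {ξ : ℝ} (hξ : 0 < ξ) :
    ∃ r₀ > 0, ∀ r r', |r - r'| < r₀ → |J r - J r'| < ξ := by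
  have huc := hJ.hasCompactSupport.uniformContinuous_of_continuous hJ.contDiff.continuous
  obtain ⟨r₀, hr₀, h⟩ := Metric.uniformContinuous_iff.mp huc ξ hξ
  exact ⟨r₀, hr₀, fun r r' hr => by simpa [Real.dist_eq] using h (by simpa [Real.dist_eq] using hr)⟩

/-- The inverse of the normalization of the interaction, as a finite sum. -/
lemma inv_kacNormalization_eq (hJ : IsKacProfile J) (hγ : 0 < γ) {n : ℕ} (hn : 1 ≤ γ * n) :
    (kacNormalization J γ)⁻¹ =
      ∑ k ∈ Finset.Icc (-(n : ℤ)) n, if k = 0 then 0 else γ * J (γ * (k : ℝ)) := by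
  rw [kacNormalization, inv_inv]
  refine tsum_eq_sum fun k hk => ?_
  split_ifs with h0
  · rfl
  · have hk' : (n : ℤ) + 1 ≤ |k| := by
      rw [Finset.mem_Icc] at hk
      by_contra h
      have : |k| ≤ n := by omega
      exact hk (abs_le.mp this)
    have hk2 : (n : ℝ) + 1 ≤ |(k : ℝ)| := by exact_mod_cast hk'
    rw [hJ.eq_zero, mul_zero]
    rw [abs_mul, abs_of_pos hγ]
    nlinarith

lemma inv_kacNormalization_le (hJ : IsKacProfile J) (hγ : 0 < γ) (hγ1 : γ ≤ 1) {M : ℝ}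
    (hM0 : 0 < M) (hM : ∀ r, J r ≤ M) : (kacNormalization J γ)⁻¹ ≤ 5 * M := by
  set n := ⌈1 / γ⌉₊
  have hn1 : 1 / γ ≤ n := Nat.le_ceil _
  have hn2 : (n : ℝ) ≤ 1 / γ + 1 := (Nat.ceil_lt_add_one (by positivity)).le
  have hn1' : 1 ≤ γ * n := by
    rw [div_le_iff₀ hγ] at hn1
    linarith
  have hn2' : γ * n ≤ 1 + γ := by
    calc γ * n ≤ γ * (1 / γ + 1) := by gcongr
      _ = 1 + γ := by field_simp
  rw [inv_kacNormalization_eq hJ hγ hn1']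
  have h1 := Finset.sum_le_card_nsmul (Finset.Icc (-(n : ℤ)) n)
    (fun k => if k = 0 then 0 else γ * J (γ * (k : ℝ))) (γ * M) (fun k _ => by
      split_ifs
      · positivity
      · exact mul_le_mul_of_nonneg_left (hM _) hγ.le)
  refine h1.trans ?_
  rw [Int.card_Icc, nsmul_eq_mul]
  have h2 : ((n : ℤ) + 1 - -(n : ℤ)).toNat = 2 * n + 1 := by omega
  rw [h2]
  push_cast
  nlinarith

/-- Keep only the `⌊r₁ / γ⌋₊` sites to the right within distance `r₁ / γ`; since `2 * γ ≤ r₁`,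
rounding loses at most half of `r₁`. -/
lemma le_inv_kacNormalization (hJ : IsKacProfile J) (hγ : 0 < γ) {r₁ c : ℝ} (hr₁ : r₁ ≤ 1)
    (hγr : 2 * γ ≤ r₁) (hc : 0 ≤ c) (hJc : ∀ r, |r| ≤ r₁ → c ≤ J r) :
    r₁ / 2 * c ≤ (kacNormalization J γ)⁻¹ := by
  set n := ⌈1 / γ⌉₊
  have hn1 : 1 / γ ≤ n := Nat.le_ceil _
  have hn1' : 1 ≤ γ * n := by
    rw [div_le_iff₀ hγ] at hn1
    linarith
  rw [inv_kacNormalization_eq hJ hγ hn1']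
  set m := ⌊r₁ / γ⌋₊
  have hm0 : 0 ≤ r₁ / γ := div_nonneg (by linarith) hγ.le
  have hm1 : (m : ℝ) ≤ r₁ / γ := Nat.floor_le hm0
  have hm2 : r₁ / γ < m + 1 := Nat.lt_floor_add_one _
  have hm1' : γ * m ≤ r₁ := by
    rw [le_div_iff₀ hγ] at hm1
    linarith
  have hm2' : r₁ < γ * (m + 1) := by
    rw [div_lt_iff₀ hγ] at hm2
    linarith
  have hmn : m ≤ n := by
    have : (m : ℝ) ≤ n := hm1.trans (le_trans (by gcongr) hn1)
    exact_mod_cast this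
  have hsub : Finset.Icc (1 : ℤ) m ⊆ Finset.Icc (-(n : ℤ)) n := fun k hk => by
    rw [Finset.mem_Icc] at hk ⊢
    omega
  refine le_trans ?_ (Finset.sum_le_sum_of_subset_of_nonneg hsub fun k _ _ => by
    split_ifs
    · exact le_rfl
    · exact mul_nonneg hγ.le (hJ.nonneg _))
  have h1 := Finset.card_nsmul_le_sum (Finset.Icc (1 : ℤ) m)
    (fun k => if k = 0 then 0 else γ * J (γ * (k : ℝ))) (γ * c) (fun k hk => by
      rw [Finset.mem_Icc] at hk
      have hk0 : k ≠ 0 := by omega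
      simp only [if_neg hk0]
      refine mul_le_mul_of_nonneg_left (hJc _ ?_) hγ.le
      have h1 : (0 : ℝ) ≤ k := by exact_mod_cast (by omega : (0 : ℤ) ≤ k)
      have h2 : (k : ℝ) ≤ m := by exact_mod_cast hk.2
      rw [abs_of_nonneg (by positivity)]
      exact (mul_le_mul_of_nonneg_left h2 hγ.le).trans hm1')
  refine le_trans ?_ h1
  rw [Int.card_Icc, nsmul_eq_mul]
  have h2 : ((m : ℤ) + 1 - 1).toNat = m := by omega
  rw [h2]
  nlinarith

/-- The total interaction is well approximated by the block kernel. -/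
lemma inv_kacNormalization_le_block (hJ : IsKacProfile J) (hγ : 0 < γ) {b D : ℕ} (hb : 0 < b)
    (hbD : 1 ≤ γ * (b * D)) {r₀ ξ : ℝ} (hξ : 0 ≤ ξ) (hbr : γ * b ≤ r₀)
    (hmod : ∀ r r', |r - r'| < r₀ → |J r - J r'| < ξ) :
    (kacNormalization J γ)⁻¹ ≤
      ∑ m ∈ Finset.Icc (-(D : ℤ)) D, γ * b * (J (γ * b * (m : ℝ)) + ξ) := by
  classical
  have hb' : (0 : ℝ) < b := by exact_mod_cast hb
  have hbz : (0 : ℤ) < b := by exact_mod_cast hb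
  rw [inv_kacNormalization_eq hJ hγ (n := b * D) (by push_cast; exact hbD)]
  have hmaps : ∀ k ∈ Finset.Icc (-((b * D : ℕ) : ℤ)) ((b * D : ℕ) : ℤ),
      k / (b : ℤ) ∈ Finset.Icc (-(D : ℤ)) D := by
    intro k hk
    rw [Finset.mem_Icc] at hk ⊢
    push_cast at hk
    constructor
    · rw [Int.le_ediv_iff_mul_le hbz]
      linarith
    · refine Int.ediv_le_of_le_mul hbz ?_
      linarith
  rw [← Finset.sum_fiberwise_of_maps_to hmaps]
  refine Finset.sum_le_sum fun m _ => ?_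
  have hsub : (Finset.Icc (-((b * D : ℕ) : ℤ)) ((b * D : ℕ) : ℤ)).filter
      (fun k => k / (b : ℤ) = m) ⊆ Finset.Ico (b * m) (b * m + b) := by
    intro k hk
    have hkm := (Finset.mem_filter.mp hk).2
    have h1 := Int.mul_ediv_add_emod k b
    have h2 := Int.emod_nonneg k hbz.ne'
    have h3 := Int.emod_lt_of_pos k hbz
    rw [hkm] at h1
    rw [Finset.mem_Ico]
    constructor <;> linarith
  have hcard := Finset.card_le_card hsub
  rw [Int.card_Ico, add_sub_cancel_left, Int.toNat_natCast] at hcard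
  have hpos : 0 ≤ γ * (J (γ * b * (m : ℝ)) + ξ) :=
    mul_nonneg hγ.le (add_nonneg (hJ.nonneg _) hξ)
  have h1 := Finset.sum_le_card_nsmul ((Finset.Icc (-((b * D : ℕ) : ℤ)) ((b * D : ℕ) : ℤ)).filter
      (fun k => k / (b : ℤ) = m)) (fun k => if k = 0 then 0 else γ * J (γ * (k : ℝ)))
      (γ * (J (γ * b * (m : ℝ)) + ξ)) (fun k hk => by
        have hk' := Finset.mem_Ico.mp (hsub hk)
        split_ifs
        · exact hpos
        · refine mul_le_mul_of_nonneg_left ?_ hγ.le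
          have h2 : (b : ℝ) * m ≤ k := by exact_mod_cast hk'.1
          have h3 : (k : ℝ) < b * m + b := by exact_mod_cast hk'.2
          have h4 := hmod (γ * k) (γ * b * m) (by
            rw [mul_assoc, ← mul_sub, abs_mul, abs_of_pos hγ, abs_of_nonneg (by linarith)]
            refine lt_of_lt_of_le (mul_lt_mul_of_pos_left ?_ hγ) hbr
            linarith)
          have h5 := (abs_lt.mp h4).2
          linarith)
  refine h1.trans ?_
  rw [nsmul_eq_mul]
  calc _ ≤ (b : ℝ) * (γ * (J (γ * b * (m : ℝ)) + ξ)) := by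
        refine mul_le_mul_of_nonneg_right ?_ hpos
        exact_mod_cast hcard
    _ = _ := by ring

/-- The concave profile of weights of the blocks. -/
def blockWeight (R : ℕ) (j : ℤ) : ℝ := ((j : ℝ) + 1) * (R - j)

/-- A symmetric kernel of range `D` almost preserves the profile of weights. -/
lemma sum_kernel_blockWeight_ge {R D : ℕ} {h : ℤ → ℝ} (h0 : ∀ m, 0 ≤ h m)
    (hsymm : ∀ m, h (-m) = h m) (j' : Fin R) :
    (∑ m ∈ Finset.Icc (-(D : ℤ)) D, h m) * (blockWeight R (j' : ℕ) - (D : ℝ) ^ 2) ≤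
      ∑ j : Fin R, h ((j : ℕ) - (j' : ℕ)) * blockWeight R (j : ℕ) := by
  classical
  set I := Finset.Icc (-(D : ℤ)) D with hI
  have hodd : ∑ m ∈ I, h m * (m : ℝ) = 0 := by
    have h1 : ∑ m ∈ I, h m * (m : ℝ) = ∑ m ∈ I, h (-m) * ((-m : ℤ) : ℝ) := by
      refine Finset.sum_equiv (Equiv.neg ℤ) (fun m => ?_) (fun m _ => ?_)
      · simp only [hI, Finset.mem_Icc, Equiv.neg_apply]
        omega
      · simp
    have h2 : ∑ m ∈ I, h (-m) * ((-m : ℤ) : ℝ) = -∑ m ∈ I, h m * (m : ℝ) := by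
      rw [← Finset.sum_neg_distrib]
      refine Finset.sum_congr rfl fun m _ => ?_
      rw [hsymm]
      push_cast
      ring
    linarith
  let φ : ℤ → ℝ := fun m => h m * blockWeight R ((j' : ℕ) + m)
  have h1 : (∑ m ∈ I, h m) * (blockWeight R (j' : ℕ) - (D : ℝ) ^ 2) ≤ ∑ m ∈ I, φ m := by
    -- The weight is quadratic with leading coefficient `-1`; the linear part of its expansion at
    -- `j'` cancels by the symmetry of `h`.
    have h2 : ∑ m ∈ I, φ m = ∑ m ∈ I, h m * (blockWeight R (j' : ℕ) - (m : ℝ) ^ 2) +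
        (R - 1 - 2 * (j' : ℕ)) * ∑ m ∈ I, h m * (m : ℝ) := by
      rw [Finset.mul_sum, ← Finset.sum_add_distrib]
      refine Finset.sum_congr rfl fun m _ => ?_
      simp only [φ, blockWeight]
      push_cast
      ring
    rw [h2, hodd, mul_zero, add_zero, Finset.sum_mul]
    refine Finset.sum_le_sum fun m hm => mul_le_mul_of_nonneg_left ?_ (h0 m)
    rw [hI, Finset.mem_Icc] at hm
    have hm1 : -(D : ℝ) ≤ m := by exact_mod_cast hm.1
    have hm2 : (m : ℝ) ≤ D := by exact_mod_cast hm.2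
    nlinarith
  refine h1.trans ?_
  set S := Finset.univ.image fun j : Fin R => ((j : ℕ) : ℤ) - ((j' : ℕ) : ℤ) with hS
  have hsum : ∑ j : Fin R, h ((j : ℕ) - (j' : ℕ)) * blockWeight R (j : ℕ) = ∑ m ∈ S, φ m := by
    rw [hS, Finset.sum_image]
    · refine Finset.sum_congr rfl fun j _ => ?_
      simp only [φ, add_sub_cancel]
    · intro i _ j _ hij
      exact Fin.ext (by simpa using hij)
  rw [hsum]
  have hpos : ∀ m ∈ S, 0 ≤ φ m := by
    intro m hm
    obtain ⟨j, -, rfl⟩ := Finset.mem_image.mp hm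
    simp only [φ, add_sub_cancel, blockWeight]
    have hj : ((j : ℕ) : ℝ) ≤ R := by exact_mod_cast j.2.le
    refine mul_nonneg (h0 _) (mul_nonneg (by positivity) ?_)
    push_cast
    linarith
  -- The parabola is nonpositive outside the brick, so leaving out those blocks can only increase
  -- the sum.
  have hneg : ∀ m ∉ S, φ m ≤ 0 := by
    intro m hm
    refine mul_nonpos_of_nonneg_of_nonpos (h0 m) ?_
    have hout : ((j' : ℕ) : ℤ) + m < 0 ∨ (R : ℤ) ≤ (j' : ℕ) + m := by
      by_contra hcon
      push Not at hcon
      refine hm (Finset.mem_image.mpr ⟨⟨(((j' : ℕ) : ℤ) + m).toNat, by omega⟩,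
        Finset.mem_univ _, ?_⟩)
      simp only
      omega
    simp only [blockWeight]
    rcases hout with h | h
    · have h3 : (((j' : ℕ) + m : ℤ) : ℝ) + 1 ≤ 0 := by exact_mod_cast h
      exact mul_nonpos_of_nonpos_of_nonneg h3 (by
        have : (0 : ℝ) ≤ R := Nat.cast_nonneg R
        linarith)
    · have h3 : (R : ℝ) ≤ (((j' : ℕ) + m : ℤ) : ℝ) := by exact_mod_cast h
      have h4 : (0 : ℝ) ≤ R := Nat.cast_nonneg R
      exact mul_nonpos_of_nonneg_of_nonpos (by linarith) (by linarith)
  calc ∑ m ∈ I, φ m = ∑ m ∈ I ∩ S, φ m + ∑ m ∈ I \ S, φ m :=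
        (Finset.sum_inter_add_sum_sdiff I S φ).symm
    _ ≤ ∑ m ∈ I ∩ S, φ m := by
        have := Finset.sum_nonpos fun m (hm : m ∈ I \ S) => hneg m (Finset.mem_sdiff.mp hm).2
        linarith
    _ ≤ ∑ m ∈ S, φ m := Finset.sum_le_sum_of_subset_of_nonneg Finset.inter_subset_right
        fun m hm _ => hpos m hm

lemma blockWeight_ge {R : ℕ} (j : Fin R) : (R : ℝ) ≤ blockWeight R (j : ℕ) := by
  have h1 : ((j : ℕ) : ℝ) + 1 ≤ R := by exact_mod_cast j.2
  have h2 : (0 : ℝ) ≤ (j : ℕ) := Nat.cast_nonneg _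
  simp only [blockWeight]
  push_cast
  nlinarith

lemma le_tanh {x : ℝ} (hx : 0 ≤ x) : x / (1 + x) ≤ Real.tanh x := by
  have h1 : 1 + 2 * x ≤ Real.exp (2 * x) := by
    have := Real.add_one_le_exp (2 * x)
    linarith
  have h2 : Real.tanh x = (Real.exp (2 * x) - 1) / (Real.exp (2 * x) + 1) := by
    rw [Real.tanh_eq_sinh_div_cosh, Real.sinh_eq, Real.cosh_eq, two_mul, Real.exp_add, Real.exp_neg]
    have := Real.exp_pos x
    field_simp
  rw [h2, div_le_div_iff₀ (by linarith) (by positivity)]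
  nlinarith

end Kernel

/-! ### Couplings of the bonds and choice of the parameters -/

section Assembly

variable {J : ℝ → ℝ} {γ ε δ : ℝ} {R b : ℕ} {Z : Finset (ℤ × ℤ)}

lemma kac_symm (hJ : IsKacProfile J) (x y : ℤ) : kac J γ x y = kac J γ y x := by
  rw [kac, kac, ← hJ.symm (γ * ((x : ℝ) - y))]
  congr 2
  ring

lemma kac_add_left (a x y : ℤ) : kac J γ (a + x) (a + y) = kac J γ x y := by
  rw [kac, kac]
  push_cast
  congr 3
  ring

lemma coupling_same_layer {u v : Site} (h2 : u.2 = v.2) (h1 : u.1 ≠ v.1) :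
    coupling J γ ε u v = kac J γ u.1 v.1 := by
  rw [coupling, if_pos ⟨h2, h1⟩, if_neg (fun h => h1 h.1), add_zero]

lemma coupling_brickSite (z : ℤ × ℤ) (β : Bool) {x y : Col R b} (hxy : x ≠ y) :
    coupling J γ ε (brickSite (z, β, x)) (brickSite (z, β, y)) =
      kac J γ (colOff x) (colOff y) := by
  rw [coupling_same_layer (by rfl)]
  · exact kac_add_left _ _ _
  · simp only [brickSite, ne_eq, add_right_inj]
    exact fun h => hxy (colOff_injective h)

lemma bondCoupling_vertical (z : Z) (x : Col R b) :
    bondCoupling J γ ε δ (.inl (z, .inl x)) = (1 - δ) * ε := by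
  simp [bondCoupling, bondKind, bondEnds, coupling, brickSite]

lemma coupling_out (hJ : IsKacProfile J) (z : ℤ × ℤ) (β : Bool) {x y : Col R b} (hxy : x ≠ y) :
    coupling J γ ε (brickSite (z, β, (Quot.out s(x, y)).1))
      (brickSite (z, β, (Quot.out s(x, y)).2)) = kac J γ (colOff x) (colOff y) := by
  rcases sym2_out_mk x y with h | h
  · rw [h]
    exact coupling_brickSite z β hxy
  · rw [h, kac_symm hJ]
    exact coupling_brickSite z β hxy.symm

lemma bondCoupling_horizontal (hJ : IsKacProfile J) (z : Z) {x y : Col R b} (hxy : x ≠ y)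
    (β : Bool) : bondCoupling J γ ε δ (.inl (z, .inr (.inl (s(x, y), β)))) =
      (1 - δ) * kac J γ (colOff x) (colOff y) := by
  rw [bondCoupling, ← coupling_out (ε := ε) hJ z β hxy]
  rfl

lemma bondCoupling_additional (hJ : IsKacProfile J) (z : Z) {x y : Col R b} (hxy : x ≠ y) :
    bondCoupling J γ ε δ (.inl (z, .inr (.inr s(x, y)))) =
      δ * kac J γ (colOff x) (colOff y) := by
  rw [bondCoupling, ← coupling_out (ε := ε) hJ z false hxy]
  rfl

/-- In both directions the ends lie in one common layer, and the neighbour starts one brick length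
`R * b` further on. -/
lemma bondCoupling_crossing (z : Z) (d : Bool) (x y : Col R b) :
    bondCoupling J γ ε δ (.inr (z, d, x, y)) =
      (1 - δ) * kac J γ (colOff x) (R * b + colOff y) := by
  obtain ⟨⟨a, a'⟩, hz⟩ := z
  have hx := colOff_lt x
  have hy := colOff_nonneg y
  rw [← kac_add_left ((a + a') * (R * b))]
  have h : ∀ d, (brickSite (((a, a') : ℤ × ℤ) + forward d, d, y)).1 =
      (a + a') * (R * b) + (R * b + colOff y) := by
    intro d
    cases d <;> simp only [brickSite, forward] <;> simp <;> ring
  rw [← h d]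
  simp only [bondCoupling, bondKind, bondEnds, Bool.false_eq_true, if_false]
  rw [coupling_same_layer]
  · rfl
  · cases d <;> simp [brickSite, forward] <;> ring
  · rw [h d]
    simp only [brickSite]
    intro heq
    linarith

lemma tanh_ge_of_le {x κ : ℝ} (hx : 0 ≤ x) (hxκ : x ≤ κ) : (1 - κ) * x ≤ Real.tanh x := by
  refine le_trans ?_ (le_tanh hx)
  rw [le_div_iff₀ (by linarith)]
  nlinarith [mul_nonneg hx (sub_nonneg.mpr hxκ), mul_nonneg (hx.trans hxκ) (mul_nonneg hx hx)]

/-- The kernel between the blocks of a brick. -/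
def blockKernel (J : ℝ → ℝ) (γ ζ ξ : ℝ) (b : ℕ) (m : ℤ) : ℝ :=
  b * ((1 - ζ) * ((1 - ζ) * (kacNormalization J γ * γ * max (J (γ * b * (m : ℝ)) - ξ) 0)))

/-- Four losses of a factor `1 - ζ`: the reserved share of the couplings, the passage to hyperbolic
tangents, the discretization of `J` to blocks, and the ends of the brick. Bernoulli's inequality
collects them into `1 - 4 * ζ`. -/
lemma blockKernel_growth (hJ : IsKacProfile J) (hγ : 0 < γ) {D : ℕ} (hb : 0 < b)
    (hbD : 1 ≤ γ * (b * D)) (hbD' : γ * b * (2 * D + 1) ≤ 7) {r₀ ξ ζ A : ℝ} (hξ : 0 ≤ ξ)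
    (hbr : γ * b ≤ r₀) (hmod : ∀ r r', |r - r'| < r₀ → |J r - J r'| < ξ)
    (hA0 : 0 < A) (hA : A ≤ (kacNormalization J γ)⁻¹) (hξA : 14 * ξ ≤ ζ * A) (hζ1 : ζ ≤ 1)
    (hRD : (D : ℝ) ^ 2 ≤ ζ * R) (j' : Fin R) :
    (1 - 4 * ζ) * blockWeight R (j' : ℕ) ≤
      ∑ j : Fin R, blockKernel J γ ζ ξ b ((j : ℕ) - (j' : ℕ)) * blockWeight R (j : ℕ) := by
  have hζ0 : 0 ≤ ζ := by
    have : 0 ≤ ζ * A := le_trans (by positivity) hξA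
    exact nonneg_of_mul_nonneg_left this hA0
  set c := kacNormalization J γ with hc
  have hc0 : 0 < c := inv_pos.mp (hA0.trans_le hA)
  have hb' : (0 : ℝ) < b := by exact_mod_cast hb
  set h : ℤ → ℝ := fun m => max (J (γ * b * (m : ℝ)) - ξ) 0 with hh
  have hsym : ∀ m, h (-m) = h m := fun m => by
    simp only [hh]
    push_cast
    rw [mul_neg, hJ.symm]
  have h1 := sum_kernel_blockWeight_ge (D := D) (h := h) (fun m => le_max_right _ _) hsym j'
  have h2 : ∑ j : Fin R, blockKernel J γ ζ ξ b ((j : ℕ) - (j' : ℕ)) * blockWeight R (j : ℕ) =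
      (1 - ζ) ^ 2 * c * (γ * b) *
        ∑ j : Fin R, h ((j : ℕ) - (j' : ℕ)) * blockWeight R (j : ℕ) := by
    rw [Finset.mul_sum]
    refine Finset.sum_congr rfl fun j _ => ?_
    simp only [blockKernel, hh]
    ring
  rw [h2]
  set H := ∑ m ∈ Finset.Icc (-(D : ℤ)) D, h m with hH
  have h3 : (1 - ζ) * c⁻¹ ≤ γ * b * H := by
    have h4 := inv_kacNormalization_le_block hJ hγ hb hbD hξ hbr hmod
    have h5 : ∑ m ∈ Finset.Icc (-(D : ℤ)) D, γ * b * (J (γ * b * (m : ℝ)) + ξ) ≤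
        γ * b * H + 2 * ξ * (γ * b * (2 * D + 1)) := by
      rw [hH, Finset.mul_sum]
      have h6 : ∑ m ∈ Finset.Icc (-(D : ℤ)) D, γ * b * (J (γ * b * (m : ℝ)) + ξ) ≤
          ∑ m ∈ Finset.Icc (-(D : ℤ)) D, (γ * b * h m + 2 * ξ * (γ * b)) := by
        refine Finset.sum_le_sum fun m _ => ?_
        have h7 : J (γ * b * (m : ℝ)) - ξ ≤ h m := le_max_left _ _
        have h8 : 0 < γ * b := by positivity
        nlinarith
      refine h6.trans (le_of_eq ?_)
      rw [Finset.sum_add_distrib, Finset.sum_const, Int.card_Icc, nsmul_eq_mul]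
      have h9 : ((D : ℤ) + 1 - -(D : ℤ)).toNat = 2 * D + 1 := by omega
      rw [h9]
      push_cast
      ring
    have h10 : 2 * ξ * (γ * b * (2 * D + 1)) ≤ 2 * ξ * 7 := by gcongr
    have h11 : ζ * A ≤ ζ * c⁻¹ := by gcongr
    linarith
  have hν := blockWeight_ge j'
  have hR0 : (0 : ℝ) ≤ R := Nat.cast_nonneg R
  have h4 : (1 - ζ) * blockWeight R (j' : ℕ) ≤ blockWeight R (j' : ℕ) - (D : ℝ) ^ 2 := by
    nlinarith
  have h1ζ : 0 ≤ 1 - ζ := by linarith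
  have hν0 : 0 ≤ blockWeight R (j' : ℕ) := hR0.trans hν
  have hD0 : 0 ≤ blockWeight R (j' : ℕ) - (D : ℝ) ^ 2 := le_trans (mul_nonneg h1ζ hν0) h4
  calc (1 - 4 * ζ) * blockWeight R (j' : ℕ)
      ≤ (1 - ζ) ^ 4 * blockWeight R (j' : ℕ) := by
        have h5 := one_add_mul_le_pow (a := -ζ) (by linarith) 4
        refine mul_le_mul_of_nonneg_right ?_ hν0
        push_cast at h5
        rw [sub_eq_add_neg 1 ζ]
        linarith
    _ = (1 - ζ) ^ 2 * c * (((1 - ζ) * c⁻¹) * ((1 - ζ) * blockWeight R (j' : ℕ))) := by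
        field_simp
    _ ≤ (1 - ζ) ^ 2 * c * ((γ * b * H) * (blockWeight R (j' : ℕ) - (D : ℝ) ^ 2)) := by
        gcongr
    _ = (1 - ζ) ^ 2 * c * (γ * b) * (H * (blockWeight R (j' : ℕ) - (D : ℝ) ^ 2)) := by ring
    _ ≤ _ := by gcongr

lemma colOff_sub_bounds (x y : Col R b) :
    |((colOff x : ℤ) : ℝ) - colOff y - b * ((((x.1 : ℕ) : ℤ) - ((y.1 : ℕ) : ℤ) : ℤ) : ℝ)| < b := by
  have hx : ((x.2 : ℕ) : ℝ) < b := by exact_mod_cast x.2.2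
  have hy : ((y.2 : ℕ) : ℝ) < b := by exact_mod_cast y.2.2
  have hx0 : (0 : ℝ) ≤ (x.2 : ℕ) := Nat.cast_nonneg _
  have hy0 : (0 : ℝ) ≤ (y.2 : ℕ) := Nat.cast_nonneg _
  simp only [colOff]
  push_cast
  rw [abs_lt]
  constructor <;> nlinarith

lemma blockKernel_div_le (hJ : IsKacProfile J) (hγ : 0 < γ) (hb : 0 < b) {r₀ ξ ζ : ℝ}
    (hbr : γ * b ≤ r₀) (hmod : ∀ r r', |r - r'| < r₀ → |J r - J r'| < ξ) (hζ0 : 0 ≤ ζ)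
    (hζ1 : ζ ≤ 1) (hsmall : ∀ x y, kac J γ x y ≤ ζ) (x y : Col R b) :
    blockKernel J γ ζ ξ b (((x.1 : ℕ) : ℤ) - ((y.1 : ℕ) : ℤ)) / b ≤
      Real.tanh ((1 - ζ) * kac J γ (colOff x) (colOff y)) := by
  have hb' : (0 : ℝ) < b := by exact_mod_cast hb
  have h1ζ : 0 ≤ 1 - ζ := by linarith
  have hk0 := kac_nonneg hJ hγ (colOff x) (colOff y)
  have hk1 := hsmall (colOff x) (colOff y)
  refine le_trans ?_ (tanh_ge_of_le (mul_nonneg h1ζ hk0)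
    (le_trans (mul_le_of_le_one_left hk0 (by linarith)) hk1))
  -- One factor `1 - ζ` is the share of the coupling, the other was spent on `tanh_ge_of_le`; what
  -- remains is that `J - ξ` at the block distance bounds `J` from below.
  rw [blockKernel, mul_div_cancel_left₀ _ hb'.ne']
  have hcγ : 0 ≤ kacNormalization J γ * γ := mul_nonneg (kacNormalization_nonneg hJ hγ) hγ.le
  refine mul_le_mul_of_nonneg_left (mul_le_mul_of_nonneg_left
    (mul_le_mul_of_nonneg_left (max_le ?_ (hJ.nonneg _)) hcγ) h1ζ) h1ζ
  have h1 := hmod (γ * b * ((((x.1 : ℕ) : ℤ) - ((y.1 : ℕ) : ℤ) : ℤ) : ℝ))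
    (γ * ((colOff x : ℝ) - colOff y)) (by
      rw [abs_sub_comm, mul_assoc, ← mul_sub, abs_mul, abs_of_pos hγ]
      exact lt_of_lt_of_le (mul_lt_mul_of_pos_left (colOff_sub_bounds x y) hγ) hbr)
  have h2 := (abs_lt.mp h1).2
  linarith

/-- At distance at most `2 * b` the rescaled distance is at most `2 * r₀`, where `J` is bounded
below, so such couplings are of order `1 / b`. Used with share `w = ζ` for the sprinkled bonds and
`w = 1 - ζ` for the crossings. -/
lemma div_le_tanh_kac (hJ : IsKacProfile J) (hγ : 0 < γ) (hb : 0 < b) {r₀ c₀ a ζ M w : ℝ}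
    (hbr : γ * b ≤ r₀) (hbr' : r₀ / 2 ≤ γ * b) (hr₀ : 0 < r₀) (hc₀ : 0 ≤ c₀)
    (hJc : ∀ r, |r| ≤ 2 * r₀ → c₀ ≤ J r) (hM : 0 < M) (hcM : (kacNormalization J γ)⁻¹ ≤ M)
    (hc : 0 < kacNormalization J γ) (hζ0 : 0 ≤ ζ) (hζw : ζ ≤ w) (hw : w ≤ 1)
    (hsmall : ∀ x y, kac J γ x y ≤ 1 / 2) {x y : ℤ} (hxy : |((x : ℝ)) - y| ≤ 2 * b)
    (ha : a = ζ * (M⁻¹ * c₀ * (r₀ / 2)) / 2) :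
    a / b ≤ Real.tanh (w * kac J γ x y) := by
  have hb' : (0 : ℝ) < b := by exact_mod_cast hb
  have hk0 := kac_nonneg hJ hγ x y
  have hk1 := hsmall x y
  have hw0 : 0 ≤ w := hζ0.trans hζw
  refine le_trans ?_ (tanh_ge_of_le (κ := 1 / 2) (mul_nonneg hw0 hk0)
    (le_trans (mul_le_of_le_one_left hk0 hw) hk1))
  have h1 : M⁻¹ ≤ kacNormalization J γ := inv_le_of_inv_le₀ hc hcM
  have h2 : c₀ ≤ J (γ * ((x : ℝ) - y)) := by
    refine hJc _ ?_
    rw [abs_mul, abs_of_pos hγ]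
    calc γ * |(x : ℝ) - y| ≤ γ * (2 * b) := by gcongr
      _ = 2 * (γ * b) := by ring
      _ ≤ 2 * r₀ := by gcongr
  rw [div_le_iff₀ hb', ha]
  have h3 : M⁻¹ * c₀ * (r₀ / 2) ≤ kac J γ x y * b := by
    rw [kac]
    calc M⁻¹ * c₀ * (r₀ / 2) ≤ kacNormalization J γ * J (γ * ((x : ℝ) - y)) * (γ * b) := by
          have := mul_nonneg hc.le (hJ.nonneg (γ * ((x : ℝ) - y)))
          gcongr
      _ = _ := by ring
  calc ζ * (M⁻¹ * c₀ * (r₀ / 2)) / 2 ≤ w * (kac J γ x y * b) / 2 := by gcongr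
    _ = (1 - 1 / 2) * (w * kac J γ x y) * b := by ring

/-- The gain `u` of the two layers pays for the four powers of the growth rate `1 + u / 32` and for
four losses of size `u / 16`. -/
lemma growth_parameters {u : ℝ} (hu0 : 0 ≤ u) (hu1 : u ≤ 1) :
    (1 + u / 32) ^ 4 ≤ (1 - 4 * (u / 16)) * (1 + u) := by
  have h2 : u ^ 2 ≤ u := by nlinarith
  have h3 : u ^ 3 ≤ u := by nlinarith
  have h4 : u ^ 4 ≤ u := by nlinarith
  ring_nf
  linarith

set_option maxHeartbeats 1000000 in
/-- For small `γ`, the magnetization of the plus state is bounded from below. -/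
theorem exists_forall_half_le_magnetization (hJ : IsKacProfile J) (hε : 0 < ε) :
    ∃ γ₀ : ℝ, 0 < γ₀ ∧ ∀ γ : ℝ, 0 < γ → γ < γ₀ → ∃ Q : Finset Site, ∀ Λ,
      1 / 2 ≤ ∑ v ∈ Q, gibbsMean J γ ε Λ plusConfig (spinProd {v}) := by
  -- the parameters of the brick
  set t : ℝ := (ε / 2) / (1 + ε / 2) with ht
  have ht0 : 0 < t := by positivity
  have ht1 : t ≤ 1 := by rw [ht, div_le_one (by positivity)]; linarith
  set u : ℝ := (t / 4) ^ 2 / 2 with hu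
  have hu0 : 0 < u := by positivity
  have hu1 : u ≤ 1 / 32 := by
    have : t ^ 2 ≤ 1 := pow_le_one₀ ht0.le ht1
    rw [hu]
    linarith
  set ζ : ℝ := u / 16 with hζ
  have hζ0 : 0 < ζ := by positivity
  have hζ1 : ζ ≤ 1 / 2 := by linarith
  have hθ : (1 + u / 32) ^ 4 ≤ (1 - 4 * ζ) * (1 + (t / 4) ^ 2 / 2) := by
    rw [← hu, hζ]
    exact growth_parameters hu0.le (by linarith)
  -- the interaction
  obtain ⟨M, hM0, hM⟩ := hJ.exists_bound
  have hJ0 := hJ.pos_zero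
  obtain ⟨r₂, hr₂, hmod₂⟩ := hJ.exists_modulus (half_pos hJ0)
  set r₁ : ℝ := min (r₂ / 2) 1 with hr₁def
  have hr₁ : 0 < r₁ := lt_min (half_pos hr₂) one_pos
  have hr₁1 : r₁ ≤ 1 := min_le_right _ _
  have hJr₁ : ∀ r, |r| ≤ r₁ → J 0 / 2 ≤ J r := by
    intro r hr
    have h1 : r₁ ≤ r₂ / 2 := min_le_left _ _
    have h2 := hmod₂ 0 r (by rw [zero_sub, abs_neg]; linarith)
    have h3 := (abs_lt.mp h2).2
    linarith
  set A : ℝ := r₁ / 2 * (J 0 / 2) with hA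
  have hA0 : 0 < A := by positivity
  set ξ : ℝ := ζ * A / 14 with hξ
  have hξ0 : 0 < ξ := by positivity
  obtain ⟨r₃, hr₃, hmod₃⟩ := hJ.exists_modulus hξ0
  -- The scale `r₃` controls the oscillation of `J` within blocks; the bound `r₁ / 2` keeps
  -- neighbouring blocks in the region where `J` is at least `J 0 / 2`.
  set r₀ : ℝ := min r₃ (r₁ / 2) with hr₀def
  have hr₀ : 0 < r₀ := lt_min hr₃ (half_pos hr₁)
  have hr₀₁ : r₀ ≤ r₁ / 2 := min_le_right _ _
  have hmod : ∀ r r', |r - r'| < r₀ → |J r - J r'| < ξ := fun r r' h =>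
    hmod₃ r r' (h.trans_le (min_le_left _ _))
  -- The blocks will satisfy `r₀ / 2 ≤ γ * b`, so `D` of them cover the range of the interaction.
  set D : ℕ := ⌈2 / r₀⌉₊ with hD
  have hD1 : 2 / r₀ ≤ D := Nat.le_ceil _
  have hD2 : (D : ℝ) ≤ 2 / r₀ + 1 := (Nat.ceil_lt_add_one (by positivity)).le
  -- Every block weight is at least `R`, so the correction `D ^ 2` at the ends of the brick is at
  -- most a fraction `ζ` of it.
  set R : ℕ := ⌈(D : ℝ) ^ 2 / ζ⌉₊ + 1 with hR
  have hRD : (D : ℝ) ^ 2 ≤ ζ * R := by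
    have h1 : (D : ℝ) ^ 2 / ζ ≤ ⌈(D : ℝ) ^ 2 / ζ⌉₊ := Nat.le_ceil _
    rw [div_le_iff₀ hζ0] at h1
    rw [hR]
    push_cast
    linarith
  have hR0 : 0 < R := Nat.succ_pos _
  have hR1 : (1 : ℝ) ≤ R := by exact_mod_cast hR0
  obtain ⟨ρ, hρ, hcore⟩ := exists_brickCore_density hR0
    (ν := fun j : Fin R => blockWeight R (j : ℕ)) (fun j => hR1.trans (blockWeight_ge j)) ht0 ht1
    (θ := u / 32) (δ := 4 * ζ) (by positivity) (by linarith) (by linarith) hθ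
  set s : ℝ := ζ * ((5 * M)⁻¹ * (J 0 / 2) * (r₀ / 2)) / 2 with hs
  have hs0 : 0 < s := by positivity
  -- The failure probabilities satisfy `1 / 576 + 2 * (1 / 1152) = 1 / 288`, the threshold of the
  -- hierarchical argument.
  obtain ⟨b₀, hb₀⟩ := eventually_atTop.mp ((hcore s hs0 (1 / 576) (by norm_num)).and
    (eventually_le_mul_natCast (show 0 < s * ρ ^ 2 by positivity) 1152))
  -- The first bound makes the block length exceed `b₀`; the second makes all Kac couplings at most
  -- `ζ`.
  refine ⟨min (r₀ / (b₀ + 2)) (ζ * A / M), lt_min (by positivity) (by positivity), ?_⟩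
  intro γ hγ hγ'
  have hγb₀ : γ * (b₀ + 2) < r₀ := by
    rw [← lt_div_iff₀ (by positivity)]
    exact hγ'.trans_le (min_le_left _ _)
  have hγM : γ * M ≤ ζ * A := by
    rw [← le_div_iff₀ hM0]
    exact (hγ'.trans_le (min_le_right _ _)).le
  have hb₀0 : (0 : ℝ) ≤ b₀ := Nat.cast_nonneg _
  have h2γ : 2 * γ ≤ r₀ := by
    have := mul_nonneg hγ.le hb₀0
    linarith
  -- the normalization
  set c := kacNormalization J γ with hc
  have hAc : A ≤ c⁻¹ := le_inv_kacNormalization hJ hγ hr₁1 (by linarith) (by positivity) hJr₁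
  have hc0 : 0 < c := inv_pos.mp (hA0.trans_le hAc)
  have hcM : c⁻¹ ≤ 5 * M := inv_kacNormalization_le hJ hγ (by linarith) hM0 hM
  have hsmall : ∀ x y, kac J γ x y ≤ ζ := by
    intro x y
    have h1 : c * A ≤ 1 := by
      calc c * A ≤ c * c⁻¹ := by gcongr
        _ = 1 := mul_inv_cancel₀ hc0.ne'
    calc kac J γ x y = c * (γ * J (γ * ((x : ℝ) - y))) := by rw [kac, mul_assoc]
      _ ≤ c * (γ * M) := by
          gcongr
          exact hM _
      _ ≤ c * (ζ * A) := by gcongr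
      _ = ζ * (c * A) := by ring
      _ ≤ ζ * 1 := by gcongr
      _ = ζ := mul_one _
  -- the length of the blocks
  set b : ℕ := ⌊r₀ / γ⌋₊ with hbdef
  have hb1 : (b : ℝ) ≤ r₀ / γ := Nat.floor_le (by positivity)
  have hb2 : r₀ / γ < b + 1 := Nat.lt_floor_add_one _
  have hbr : γ * b ≤ r₀ := by
    rw [le_div_iff₀ hγ] at hb1
    linarith
  have hbr2 : r₀ < γ * (b + 1) := by
    rw [div_lt_iff₀ hγ] at hb2
    linarith
  have hbr' : r₀ / 2 ≤ γ * b := by linarith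
  have hbb₀ : b₀ + 1 ≤ b := by
    refine Nat.le_floor ?_
    rw [le_div_iff₀ hγ]
    push_cast
    linarith
  have hb : 0 < b := by omega
  have hb' : (0 : ℝ) < b := by exact_mod_cast hb
  obtain ⟨hbrick, hbs⟩ := hb₀ b (by omega)
  have hbD : 1 ≤ γ * (b * D) := by
    calc (1 : ℝ) = (r₀ / 2) * (2 / r₀) := by field_simp
      _ ≤ (γ * b) * D := by gcongr
      _ = γ * (b * D) := by ring
  have hbD' : γ * b * (2 * D + 1) ≤ 7 := by
    calc γ * b * (2 * D + 1) ≤ r₀ * (2 * (2 / r₀ + 1) + 1) := by gcongr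
      _ = 4 + 3 * r₀ := by field_simp; ring
      _ ≤ 7 := by linarith
  have hadj : ∀ w : ℝ, ζ ≤ w → w ≤ 1 → ∀ x y : ℤ, |((x : ℝ)) - y| ≤ 2 * b →
      s / b ≤ Real.tanh (w * kac J γ x y) := fun w hζw hw x y hxy =>
    div_le_tanh_kac hJ hγ hb hbr hbr' hr₀ (by positivity)
      (fun r hr => hJr₁ r (hr.trans (by linarith))) (by positivity) hcM hc0 hζ0.le hζw hw
      (fun x y => (hsmall x y).trans hζ1) hxy hs
  have hR0' : R - 1 < R := by omega
  refine ⟨_, half_le_sum_gibbsMean (δ := ζ) (b := b) (R := R) (ρ := ρ) (s := s) (η := 1 / 576)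
    (η' := 1 / 1152) (jf := ⟨0, hR0⟩) (jl := ⟨R - 1, hR0'⟩) hJ hγ hε ⟨hζ0.le, by linarith⟩ hb hρ
    hs0.le ?_ ?_ ?_ (by norm_num) (by norm_num)⟩
  · intro Z z
    refine hbrick (fun j j' => blockKernel J γ ζ ξ b ((j : ℕ) - (j' : ℕ))) (fun j j' => ?_)
      (fun j' => blockKernel_growth hJ hγ hb hbD hbD' hξ0.le hbr hmod hA0 hAc
        (le_of_eq (by rw [hξ]; ring)) (by linarith) hRD j') _ (fun i => ?_) (fun x => ?_)
      (fun x y hxy β => ?_) (fun x y hxy hadjxy => ?_)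
    · have h1 : 0 ≤ 1 - ζ := by linarith
      have h2 : 0 ≤ max (J (γ * b * ((((j : ℕ) : ℤ) - ((j' : ℕ) : ℤ) : ℤ) : ℝ)) - ξ) 0 :=
        le_max_right _ _
      rw [blockKernel]
      positivity
    · refine tanh_mem_Icc (mul_nonneg ?_ (coupling_nonneg hJ hγ hε _ _))
      split_ifs <;> linarith
    · rw [bondCoupling_vertical, ht]
      have h1 : ε / 2 ≤ (1 - ζ) * ε := by
        have := mul_le_mul_of_nonneg_right hζ1 hε.le
        linarith
      refine le_trans ?_ (le_tanh (by linarith))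
      rw [div_le_div_iff₀ (by positivity) (by linarith)]
      linarith
    · rw [bondCoupling_horizontal hJ z hxy]
      exact blockKernel_div_le hJ hγ hb hbr hmod hζ0.le (by linarith) hsmall x y
    · rw [bondCoupling_additional hJ z hxy]
      refine hadj ζ le_rfl (by linarith) _ _ ?_
      have h1 := colOff_sub_bounds x y
      have h2 : |((((x.1 : ℕ) : ℤ) - ((y.1 : ℕ) : ℤ) : ℤ) : ℝ)| ≤ 1 := by
        have : |((x.1 : ℕ) : ℤ) - ((y.1 : ℕ) : ℤ)| ≤ 1 := by
          rw [abs_le]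
          rcases hadjxy with h | h
          · rw [h]
            omega
          · omega
        exact_mod_cast this
      rw [abs_lt] at h1
      rw [abs_le] at h2 ⊢
      have h3 := mul_le_mul_of_nonneg_left h2.1 hb'.le
      have h4 := mul_le_mul_of_nonneg_left h2.2 hb'.le
      constructor <;> linarith
  · intro Z z d x y hx hy
    rw [bondCoupling_crossing]
    refine hadj (1 - ζ) (by linarith) (by linarith) _ _ ?_
    have hx1 : ((x.1 : ℕ) : ℤ) = R - 1 := by
      have : (x.1 : ℕ) = R - 1 := by rw [hx]
      omega
    have hy1 : ((y.1 : ℕ) : ℤ) = 0 := by rw [hy]; rfl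
    have h1 := x.2.2
    have h2 := y.2.2
    have h3 : |colOff x - (R * b + colOff y)| ≤ 2 * (b : ℤ) := by
      simp only [colOff, hx1, hy1]
      rw [abs_le]
      have e : ((R : ℤ) - 1) * b + (x.2 : ℕ) - (R * b + (0 * b + (y.2 : ℕ))) =
          (x.2 : ℕ) - (y.2 : ℕ) - b := by ring
      rw [e]
      constructor <;> omega
    exact_mod_cast h3
  · rw [Real.exp_neg, inv_le_comm₀ (Real.exp_pos _) (by norm_num)]
    have := Real.add_one_le_exp (s * ρ ^ 2 * b)
    rw [one_div, inv_inv]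
    linarith

end Assembly

end KacIsing

end

theorem theorem1p1 (J : ℝ → ℝ) (hJ : KacIsing.IsKacProfile J) (ε : ℝ) (hε : 0 < ε) :
    ∃ γ₀ : ℝ, 0 < γ₀ ∧ ∀ γ : ℝ, 0 < γ → γ < γ₀ →
      ∃ μplus μminus : ProbabilityMeasure KacIsing.Config,
        KacIsing.IsThermodynamicLimit J γ ε KacIsing.plusConfig μplus ∧
        KacIsing.IsThermodynamicLimit J γ ε KacIsing.minusConfig μminus ∧
        KacIsing.IsDLR J γ ε μplus ∧
        KacIsing.IsDLR J γ ε μminus ∧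
        μplus ≠ μminus := by
  obtain ⟨γ₀, hγ₀, h⟩ := KacIsing.exists_forall_half_le_magnetization hJ hε
  refine ⟨γ₀, hγ₀, fun γ hγ hγ' => ?_⟩
  obtain ⟨Q, hQ⟩ := h γ hγ hγ'
  exact KacIsing.phaseTransition_of_magnetization hJ hγ hε Q one_half_pos hQ
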